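/- **Theorem.** For a constant $c\in\mathbb N$ consider the following estimation problem $\mathrm{SCHATTEN}_c$. An instance consists of $n$ (the number of qubits), $p\ge 1$ and $q\ge 1$ (all in unary; put $\varepsilon=1/q$), and Hermitian matrices $A_1,\dots,A_m$, where $A_j$ is given as a list of $k_j$ distinct qubits together with a $2^{k_j}\times 2^{k_j}$ Hermitian matrix with entries in $\mathbb Q(i)$ that acts on these qubits. It is promised that $$k_j\le c\lfloor\log_2 n\rfloor+c,\qquad m,\ \|A_j\|,\ p,\ 1/\varepsilon\ \le\ n^c+c ,$$ so that $A=\sum_{j=1}^m A_j$ is a $\log$-local Hermitian $2^n\times 2^n$ matrix and $p,1/\varepsilon=O(\mathrm{poly}(n))$. The task is to estimate $\mathrm{Tr}(|A|^p)/2^n$ up to additive accuracy $\varepsilon\left(\|A\|/2\right)^p$, where $\|\cdot\|$ is the operator norm; that is, a correct answer is any real $y$ with $$\left|\,y-\frac{\mathrm{Tr}(|A|^p)}{2^n}\right|\le\varepsilon\left(\frac{\|A\|}{2}\right)^p .$$ Then there is a constant $c$ such that $\mathrm{SCHATTEN}_c$ is hard for DQC1: for every promise problem $(L_{\rm yes},L_{\rm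 no})$ in DQC1 there is a function, computable in deterministic polynomial time, that maps each input $x$ to an instance $a_x$ and a dyadic rational threshold $\tau_x$ such that for $x\in L_{\rm yes}$ the instance $a_x$ satisfies the promise and every correct answer $y$ to $a_x$ has $y>\tau_x$, and for $x\in L_{\rm no}$ the instance $a_x$ satisfies the promise and every correct answer $y$ to $a_x$ has $y<\tau_x$. In particular, one query to any algorithm that solves $\mathrm{SCHATTEN}_c$ decides the problem. Here a promise problem is in DQC1 if there are a positive polynomial $r$ and a deterministic polynomial-time algorithm that maps each input $x$ to a number $w$ (in unary) and a quantum circuit on $w+1$ qubits over the gates Hadamard, phase $\mathrm{diag}(1,i)$, CNOT and Toffoli such that, if the circuit is applied to the state $|0\rangle\langle 0|\otimes I/2^w$ and the first qubit is measured in the computational basis, the probability of the outcome $0$ is at least $\frac12+\frac1{r(|x|)}$ for $x\in L_{\rm yes}$ and at most $\frac12-\frac1{r(|x|)}$ for $x\in L_{\rm no}$. -/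

import Mathlib

open Turing Computability

noncomputable section

/-! ### Qubits and operators acting on some of them -/

/-- The computational basis of `n` qubits. -/
abbrev Basis (n : ℕ) : Type := Fin n → Fin 2

/-- Operators on `n` qubits, i.e. `2 ^ n × 2 ^ n` complex matrices. -/
abbrev QOp (n : ℕ) : Type := Matrix (Basis n) (Basis n) ℂ

/-- The operator on `n` qubits that acts as `B` on the `k` distinct qubits `e 0, …, e (k - 1)`
and as the identity on all the other qubits. -/
def embed {k n : ℕ} (e : Fin k ↪ Fin n) (B : QOp k) : QOp n := fun x y =>
  open Classical in
  if ∀ i, i ∉ Set.range e → x i = y i then B (x ∘ e) (y ∘ e) else 0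

/-- The operator (spectral) norm of an operator on `n` qubits. -/
def opNorm {n : ℕ} (A : QOp n) : ℝ := ‖Matrix.toEuclideanCLM (n := Basis n) (𝕜 := ℂ) A‖

open scoped MatrixOrder in
/-- The normalised trace `Tr(|A| ^ p) / 2 ^ n`, with `|A| = √(A† A)`. -/
def normalizedAbsPowTrace {n : ℕ} (A : QOp n) (p : ℕ) : ℝ :=
  ((CFC.abs A ^ p).trace).re / 2 ^ n

/-! ### Circuits over the gate set Hadamard, phase, CNOT, Toffoli -/

/-- The gates of a standard finite universal gate set (Kitaev's). -/
inductive GateKind : Type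
  | hadamard
  | phase
  | cnot
  | toffoli

def GateKind.arity : GateKind → ℕ
  | .hadamard => 1
  | .phase => 1
  | .cnot => 2
  | .toffoli => 3

/-- The unitary of a gate. In the last two, addition and multiplication of `Fin 2` are
exclusive or and conjunction, and the last qubit is the target. -/
def GateKind.op : (g : GateKind) → QOp g.arity
  | .hadamard => fun (x y : Basis 1) =>
      ((Real.sqrt 2 : ℝ) : ℂ)⁻¹ * (-1) ^ ((x 0 : ℕ) * (y 0 : ℕ))
  | .phase => fun (x y : Basis 1) => if x = y then Complex.I ^ (x 0 : ℕ) else 0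
  | .cnot => fun (x y : Basis 2) => if x = ![y 0, y 1 + y 0] then 1 else 0
  | .toffoli => fun (x y : Basis 3) => if x = ![y 0, y 1, y 2 + y 0 * y 1] then 1 else 0

/-- A gate applied to distinct qubits out of `n`. -/
structure Gate (n : ℕ) where
  kind : GateKind
  wires : Fin kind.arity ↪ Fin n

def Gate.op {n : ℕ} (g : Gate n) : QOp n := embed g.wires g.kind.op

/-- A circuit of the one clean qubit model: qubit `0` is the clean one, and there are `mixed`
further qubits, which start out maximally mixed. The head of `gates` is applied first. -/
structure OneCleanQubitCircuit where
  mixed : ℕ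
  gates : List (Gate (mixed + 1))

namespace OneCleanQubitCircuit

variable (C : OneCleanQubitCircuit)

/-- The unitary implemented by the circuit. -/
def unitary : QOp (C.mixed + 1) := C.gates.foldl (fun U g => g.op * U) 1

/-- `|0⟩⟨0| ⊗ I`, the projection onto the outcome `0` of measuring qubit `0`. -/
def projZero : QOp (C.mixed + 1) := Matrix.diagonal fun x => if x 0 = 0 then 1 else 0

/-- The initial state `|0⟩⟨0| ⊗ I / 2 ^ mixed`. -/
def initialState : QOp (C.mixed + 1) :=
  Matrix.diagonal fun x => if x 0 = 0 then 1 / 2 ^ C.mixed else 0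

/-- The probability of measuring `0` on the first qubit after the circuit has been run. -/
def acceptProb : ℝ :=
  (C.projZero * (C.unitary * C.initialState * C.unitary.conjTranspose)).trace.re

end OneCleanQubitCircuit

/-! ### Encodings as strings -/

/-- A list of bit strings, written as one string with an end marker (`none`) after each. -/
def joinWords (l : List (List Bool)) : List (Option Bool) :=
  l.flatMap fun w => w.map some ++ [none]

/-- `f` is a prefix code. -/
def PrefixInjective {α β : Type} (f : α → List β) : Prop :=
  ∀ a b s t, f a ++ s = f b ++ t → a = b ∧ s = t

theorem PrefixInjective.flatMap_injective {α β : Type} {f : α → List β}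
    (hf : PrefixInjective f) (h0 : ∀ a, f a ≠ []) :
    Function.Injective fun l : List α => l.flatMap f := by
  intro l
  induction l with
  | nil =>
    intro m h
    cases m with
    | nil => rfl
    | cons b m =>
      have h' : [] = f b ++ m.flatMap f := by simpa using h
      exact absurd (List.append_eq_nil_iff.1 h'.symm).1 (h0 b)
  | cons a l ih =>
    intro m h
    cases m with
    | nil =>
      have h' : f a ++ l.flatMap f = [] := by simpa using h
      exact absurd (List.append_eq_nil_iff.1 h').1 (h0 a)
    | cons b m =>
      have h' : f a ++ l.flatMap f = f b ++ m.flatMap f := by simpa using h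
      obtain ⟨rfl, h2⟩ := hf _ _ _ _ h'
      rw [ih h2]

theorem PrefixInjective.ofFn {α β : Type} {f : α → List β} (hf : PrefixInjective f) (n : ℕ) :
    PrefixInjective fun v : Fin n → α => (List.ofFn v).flatMap f := by
  induction n with
  | zero =>
    intro a b s t h
    exact ⟨Subsingleton.elim _ _, by simpa using h⟩
  | succ n ih =>
    intro a b s t h
    simp only [List.ofFn_succ, List.flatMap_cons, List.append_assoc] at h
    obtain ⟨h0, h1⟩ := hf _ _ _ _ h
    obtain ⟨h2, h3⟩ := ih _ _ _ _ h1
    refine ⟨?_, h3⟩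
    funext i
    refine Fin.cases h0 (fun j => congrFun h2 j) i

theorem joinWords_injective : Function.Injective joinWords := by
  refine PrefixInjective.flatMap_injective ?_ (by simp)
  intro a
  induction a with
  | nil =>
    intro b s t h
    cases b with
    | nil => simpa using h
    | cons c b => simp at h
  | cons c a ih =>
    intro b s t h
    cases b with
    | nil => simp at h
    | cons d b =>
      simp only [List.map_cons, List.cons_append, List.cons.injEq, Option.some.injEq] at h
      obtain ⟨rfl, rfl⟩ := ih _ _ _ h.2
      exact ⟨by rw [h.1], rfl⟩

theorem unaryEncodeNat_injective : Function.Injective unaryEncodeNat :=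
  Function.LeftInverse.injective unary_decode_encode_nat

theorem encodeNat_injective : Function.Injective encodeNat :=
  Function.LeftInverse.injective decode_encodeNat

/-- The encoding given by an injective map. -/
def encodingOfInjective {α Γ : Type} (f : α → List Γ) (hf : Function.Injective f) :
    Encoding α Γ where
  encode := f
  decode := Function.partialInv f
  decode_encode x := Function.partialInv_left hf x

def GateKind.tag : GateKind → List Bool
  | .hadamard => [false, false]
  | .phase => [false, true]
  | .cnot => [true, false]
  | .toffoli => [true, true]

theorem GateKind.tag_injective : Function.Injective GateKind.tag := by
  intro a b h
  cases a <;> cases b <;> simp_all [GateKind.tag]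

/-- A list of distinct qubits, each index in unary. -/
def wiresWords {k n : ℕ} (e : Fin k ↪ Fin n) : List (List Bool) :=
  (List.ofFn (e : Fin k → Fin n)).flatMap fun i : Fin n => [unaryEncodeNat (i : ℕ)]

theorem wiresWords_prefixInjective (k n : ℕ) :
    PrefixInjective (wiresWords : (Fin k ↪ Fin n) → List (List Bool)) := by
  intro a b s t h
  have hf : PrefixInjective fun i : Fin n => [unaryEncodeNat (i : ℕ)] := by
    intro i j s t h
    simp only [List.cons_append, List.nil_append, List.cons.injEq] at h
    exact ⟨Fin.ext (unaryEncodeNat_injective h.1), h.2⟩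
  obtain ⟨h1, h2⟩ := hf.ofFn k (a : Fin k → Fin n) (b : Fin k → Fin n) s t h
  exact ⟨DFunLike.coe_injective h1, h2⟩

/-- A gate: its tag, followed by its qubits. -/
def Gate.words {n : ℕ} (g : Gate n) : List (List Bool) := g.kind.tag :: wiresWords g.wires

theorem Gate.words_prefixInjective (n : ℕ) :
    PrefixInjective (Gate.words : Gate n → List (List Bool)) := by
  rintro ⟨a, u⟩ ⟨b, v⟩ s t h
  simp only [Gate.words, List.cons_append, List.cons.injEq] at h
  obtain ⟨h1, h2⟩ := h
  obtain rfl := GateKind.tag_injective h1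
  obtain ⟨rfl, rfl⟩ := wiresWords_prefixInjective _ _ _ _ _ _ h2
  exact ⟨rfl, rfl⟩

/-- A circuit: the number of mixed qubits in unary, followed by the gates. -/
def OneCleanQubitCircuit.words (C : OneCleanQubitCircuit) : List (List Bool) :=
  unaryEncodeNat C.mixed :: C.gates.flatMap Gate.words

theorem OneCleanQubitCircuit.words_injective : Function.Injective OneCleanQubitCircuit.words := by
  rintro ⟨w, g⟩ ⟨w', g'⟩ h
  simp only [OneCleanQubitCircuit.words, List.cons.injEq] at h
  obtain ⟨h1, h2⟩ := h
  obtain rfl := unaryEncodeNat_injective h1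
  obtain rfl := (Gate.words_prefixInjective _).flatMap_injective (by simp [Gate.words]) h2
  rfl

def circuitEncoding : Encoding OneCleanQubitCircuit (Option Bool) :=
  encodingOfInjective (fun C => joinWords C.words)
    (joinWords_injective.comp OneCleanQubitCircuit.words_injective)

/-! ### Promise problems, DQC1, and hardness of an estimation problem -/

/-- A promise problem on bit strings. -/
structure PromiseProblem where
  yes : Set (List Bool)
  no : Set (List Bool)
  disjoint : Disjoint yes no

/-- `f` maps bit strings to encoded objects in polynomial time on a Turing machine. -/
def PolyTimeGenerated {β Γ : Type} (e : Encoding β Γ) (f : List Bool → β) : Prop :=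
  Nonempty (TM2ComputableInPolyTime (encodingList Bool).encode e.encode f)

/-- The class DQC1: from the input `x`, a circuit is written down in classical polynomial time;
run on one clean and polynomially many maximally mixed qubits, it yields the outcome `0` with a
probability that is above, respectively below, `1 / 2` by an inverse polynomial. -/
def InDQC1 (L : PromiseProblem) : Prop :=
  ∃ (C : List Bool → OneCleanQubitCircuit) (q : Polynomial ℕ),
    PolyTimeGenerated circuitEncoding C ∧
    (∀ m, 0 < q.eval m) ∧
    (∀ x ∈ L.yes, 1 / 2 + 1 / ((q.eval x.length : ℕ) : ℝ) ≤ (C x).acceptProb) ∧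
    (∀ x ∈ L.no, (C x).acceptProb ≤ 1 / 2 - 1 / ((q.eval x.length : ℕ) : ℝ))

/-- The problem of estimating a real number up to a given additive accuracy, for the instances
that satisfy the promise `valid`. -/
structure EstimationProblem where
  Inst : Type
  encoding : Encoding Inst (Option Bool)
  valid : Inst → Prop
  value : Inst → ℝ
  accuracy : Inst → ℝ

/-- `y` is a correct answer to the instance `a`. -/
def EstimationProblem.IsEstimate (P : EstimationProblem) (a : P.Inst) (y : ℝ) : Prop :=
  |y - P.value a| ≤ P.accuracy a

/-- A dyadic rational `m / 2 ^ s`, given by `m` in binary and `s` in unary. -/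
def dyadicEncoding : Encoding (ℕ × ℕ) (Option Bool) :=
  encodingOfInjective (fun d => joinWords [encodeNat d.1, unaryEncodeNat d.2]) (by
    intro a b h
    have h' := joinWords_injective h
    simp only [List.cons.injEq, and_true] at h'
    exact Prod.ext (encodeNat_injective h'.1) (unaryEncodeNat_injective h'.2))

/-- Polynomial-time reduction of a promise problem to an estimation problem with one query:
from `x`, an instance and a dyadic threshold are computed in polynomial time, such that every
correct estimate for the instance lies above the threshold on yes-inputs and below it on
no-inputs. -/
def ReducesTo (L : PromiseProblem) (P : EstimationProblem) : Prop :=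
  ∃ f : List Bool → P.Inst × (ℕ × ℕ),
    PolyTimeGenerated (encodingProd P.encoding dyadicEncoding) f ∧
    (∀ x ∈ L.yes, P.valid (f x).1 ∧
      ∀ y, P.IsEstimate (f x).1 y → ((f x).2.1 : ℝ) / 2 ^ (f x).2.2 < y) ∧
    (∀ x ∈ L.no, P.valid (f x).1 ∧
      ∀ y, P.IsEstimate (f x).1 y → y < ((f x).2.1 : ℝ) / 2 ^ (f x).2.2)

def EstimationProblem.IsDQC1Hard (P : EstimationProblem) : Prop :=
  ∀ L : PromiseProblem, InDQC1 L → ReducesTo L P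

/-! ### Local Hamiltonians and the estimation problem -/

/-- The complex number `a + b i` with rational `a`, `b`. -/
def gaussianRat (z : ℚ × ℚ) : ℂ := (z.1 : ℂ) + (z.2 : ℂ) * Complex.I

/-- A `2 ^ k × 2 ^ k` matrix with Gaussian rational entries and the `k` qubits it acts on. -/
structure LocalTerm (n : ℕ) where
  k : ℕ
  qubits : Fin k ↪ Fin n
  mat : Matrix (Basis k) (Basis k) (ℚ × ℚ)

/-- The small matrix of a term. -/
def LocalTerm.localOp {n : ℕ} (t : LocalTerm n) : QOp t.k := t.mat.map gaussianRat

/-- The term as an operator on all `n` qubits. -/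
def LocalTerm.op {n : ℕ} (t : LocalTerm n) : QOp n := embed t.qubits t.localOp

/-- An instance: a Hamiltonian on `n` qubits, given by its terms, the power `p`, and the number
`invEps`, for the accuracy parameter `ε = 1 / invEps`. -/
structure SchattenInstance where
  n : ℕ
  p : ℕ
  invEps : ℕ
  terms : List (LocalTerm n)

namespace SchattenInstance

variable (a : SchattenInstance)

/-- The Hamiltonian `A = ∑ j, A_j`. -/
def hamiltonian : QOp a.n := (a.terms.map LocalTerm.op).sum

/-- The terms are Hermitian, they act on `O(log n)` qubits each, and their number, their norms,
`p` and `1 / ε` are bounded by a polynomial in `n`. -/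
structure IsLogLocal (c : ℕ) : Prop where
  isHermitian : ∀ t ∈ a.terms, t.localOp.IsHermitian
  locality : ∀ t ∈ a.terms, t.k ≤ c * Nat.log 2 a.n + c
  norm_le : ∀ t ∈ a.terms, opNorm t.op ≤ (a.n : ℝ) ^ c + c
  length_le : a.terms.length ≤ a.n ^ c + c
  p_pos : 0 < a.p
  p_le : a.p ≤ a.n ^ c + c
  invEps_pos : 0 < a.invEps
  invEps_le : a.invEps ≤ a.n ^ c + c

end SchattenInstance

/-- A rational number: sign, numerator and denominator, the latter two in binary. -/
def ratWords (r : ℚ) : List (List Bool) :=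
  [[decide (r.num < 0)], encodeNat r.num.natAbs, encodeNat r.den]

theorem ratWords_prefixInjective : PrefixInjective ratWords := by
  intro a b s t h
  simp only [ratWords, List.cons_append, List.nil_append, List.cons.injEq, and_true,
    decide_eq_decide] at h
  obtain ⟨h1, h2, h3, h4⟩ := h
  have h2' := encodeNat_injective h2
  exact ⟨Rat.ext (by omega) (encodeNat_injective h3), h4⟩

def gaussianWords (z : ℚ × ℚ) : List (List Bool) := ratWords z.1 ++ ratWords z.2

theorem gaussianWords_prefixInjective : PrefixInjective gaussianWords := by
  intro a b s t h
  simp only [gaussianWords, List.append_assoc] at h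
  obtain ⟨h1, h2⟩ := ratWords_prefixInjective _ _ _ _ h
  obtain ⟨h3, h4⟩ := ratWords_prefixInjective _ _ _ _ h2
  exact ⟨Prod.ext h1 h3, h4⟩

/-- The basis state of `k` qubits whose number in binary is `r`, qubit `0` being the least
significant bit. -/
def basisState {k : ℕ} (r : Fin (2 ^ k)) : Basis k := finFunctionFinEquiv.symm r

/-- The entries of a matrix, row by row. -/
def matWords {k : ℕ} (B : Matrix (Basis k) (Basis k) (ℚ × ℚ)) : List (List Bool) :=
  (List.ofFn fun r : Fin (2 ^ k) => fun s : Fin (2 ^ k) => B (basisState r) (basisState s)).flatMap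
    fun row => (List.ofFn row).flatMap gaussianWords

theorem matWords_prefixInjective (k : ℕ) :
    PrefixInjective (matWords : Matrix (Basis k) (Basis k) (ℚ × ℚ) → List (List Bool)) := by
  intro a b s t h
  obtain ⟨h1, h2⟩ := (gaussianWords_prefixInjective.ofFn (2 ^ k)).ofFn (2 ^ k) _ _ _ _ h
  refine ⟨?_, h2⟩
  ext1 x y
  have := congrFun (congrFun h1 (finFunctionFinEquiv x)) (finFunctionFinEquiv y)
  simpa [basisState] using this

/-- A term: the number of its qubits in unary, the qubits, the entries of the matrix. -/
def LocalTerm.words {n : ℕ} (t : LocalTerm n) : List (List Bool) :=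
  unaryEncodeNat t.k :: (wiresWords t.qubits ++ matWords t.mat)

theorem LocalTerm.words_prefixInjective (n : ℕ) :
    PrefixInjective (LocalTerm.words : LocalTerm n → List (List Bool)) := by
  rintro ⟨k, e, B⟩ ⟨k', e', B'⟩ s t h
  simp only [LocalTerm.words, List.cons_append, List.append_assoc, List.cons.injEq] at h
  obtain ⟨h1, h2⟩ := h
  obtain rfl := unaryEncodeNat_injective h1
  obtain ⟨rfl, h3⟩ := wiresWords_prefixInjective _ _ _ _ _ _ h2
  obtain ⟨rfl, rfl⟩ := matWords_prefixInjective _ _ _ _ _ h3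
  exact ⟨rfl, rfl⟩

/-- An instance: `n`, `p` and `invEps` in unary, followed by the terms. -/
def SchattenInstance.words (a : SchattenInstance) : List (List Bool) :=
  unaryEncodeNat a.n :: unaryEncodeNat a.p :: unaryEncodeNat a.invEps ::
    a.terms.flatMap LocalTerm.words

theorem SchattenInstance.words_injective : Function.Injective SchattenInstance.words := by
  rintro ⟨n, p, q, l⟩ ⟨n', p', q', l'⟩ h
  simp only [SchattenInstance.words, List.cons.injEq] at h
  obtain ⟨h1, h2, h3, h4⟩ := h
  obtain rfl := unaryEncodeNat_injective h1
  obtain rfl := unaryEncodeNat_injective h2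
  obtain rfl := unaryEncodeNat_injective h3
  obtain rfl := (LocalTerm.words_prefixInjective _).flatMap_injective
    (by simp [LocalTerm.words]) h4
  rfl

def schattenEncoding : Encoding SchattenInstance (Option Bool) :=
  encodingOfInjective (fun a => joinWords a.words)
    (joinWords_injective.comp SchattenInstance.words_injective)

/-- The problem of estimating `Tr(|A| ^ p) / 2 ^ n` for a log-local Hermitian `A` on `n` qubits
up to the additive accuracy `ε (‖A‖ / 2) ^ p`; all the bounds of the promise are those given
by the constant `c`. -/
def schattenEstimation (c : ℕ) : EstimationProblem where
  Inst := SchattenInstance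
  encoding := schattenEncoding
  valid a := a.IsLogLocal c
  value a := normalizedAbsPowTrace a.hamiltonian a.p
  accuracy a := 1 / (a.invEps : ℝ) * (opNorm a.hamiltonian / 2) ^ a.p

end

/-! Let `U` be the unitary of a one clean qubit circuit on `w + 1` qubits and `Z` the Pauli matrix
on the clean qubit. Since `|0⟩⟨0| = (1 + Z) / 2` and both `Z` and `U Z Uᴴ` are traceless, the
acceptance probability is `1/2 + 1/2 * Tr(Z U Z Uᴴ) / 2 ^ (w + 1)` (`acceptProb_eq`). The task is to
make this normalised trace visible in `Tr(|A| ^ p)`.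

A clock with `R = 2 ^ s` positions and a direction qubit together have `2R` states, arranged in a
cycle: up through the positions, turn, down again, turn. Let `W` be the unitary that advances one
step on this cycle and applies the `t`-th gate on the way up, its inverse on the way down and `Z` at
both turns. Put `A = W + Wᴴ`. In this sum the two projections of the direction qubit add up to the
identity, so `A` consists of local terms, `|t+1⟩⟨t| ⊗ G t` plus its adjoint, and one term for the
two ends (`ClockSystem.ham_eq`).

As `W` is unitary, `A ^ (2R)` expands binomially into powers of `W` with exponents between `-2R` and
`2R`. A power has trace zero unless the exponent is a multiple of the cycle length, so only the
constant term and the two full turns remain (`CyclicShift.trace_add_star_pow`). A full turn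
contributes the trace of `Z U Z Uᴴ`, whatever its starting point (`Walk.trace_step_pow_order`,
`ClockSystem.trace_ham_pow`). Hence with the even power `p = 2R` the normalised trace is
`centralBinom R + 4 * (acceptProb - 1/2)` (`value_toInstance`). Moreover `‖A‖ ≤ 2`, so the permitted
error is at most `ε = 1 / R`. With `R ≥ q` this is smaller than the shift of at least `4 / q` that
the DQC1 promise guarantees, and `centralBinom R` is the threshold. Entries in `ℚ(i)` are obtained
by multiplying the Hadamard gate by a phase, which cancels between `U` and `Uᴴ`.

It remains to compute the instance and the threshold in polynomial time on a stack machine. Programs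
are assembled from fragments with proved running times, and `polyTimeGenerated_postprocess` runs
such a program after the machine that writes the circuit; the output of that machine is short
because its running time is. All matrices are written by nested passes over lists of marks on the
clock positions. The threshold is the middle digit of `(1 + 2 ^ (2R)) ^ (2R)` in base `2 ^ (2R)`
(`centralBinom_eq_digit`), so additions and shifts suffice. -/

noncomputable section

/-! ### Program fragments for stack machines -/

namespace StackProg

open Turing.TM2 (Stmt Cfg stepAux)

/-- `StepsTo m c c' n`: the machine `m` passes from `c` to `c'` in exactly `n` steps. -/
inductive StepsTo {K : Type} [DecidableEq K] {Γ : K → Type} {Λ σ : Type}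
    (m : Λ → Stmt Γ Λ σ) : Cfg Γ Λ σ → Cfg Γ Λ σ → ℕ → Prop
  | refl (c) : StepsTo m c c 0
  | head {l v S c n} : StepsTo m (stepAux (m l) v S) c n → StepsTo m ⟨some l, v, S⟩ c (n + 1)

section

variable {K : Type} [DecidableEq K] {Γ : K → Type} {Λ Λ' σ : Type}

theorem StepsTo.trans {m : Λ → Stmt Γ Λ σ} {a b c : Cfg Γ Λ σ} {i j : ℕ}
    (h : StepsTo m a b i) (h' : StepsTo m b c j) : StepsTo m a c (i + j) := by
  induction h with
  | refl => simpa using h'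
  | head _ ih => rw [Nat.succ_add]; exact .head (ih h')

/-- The right side is the form in which evaluations of `TM2` machines are counted. A halted
configuration steps to `none`, which persists, so no iterate equal to `some c` has run past the
halt. -/
theorem stepsTo_iff_iterate {m : Λ → Stmt Γ Λ σ} {a c : Cfg Γ Λ σ} {n : ℕ} :
    StepsTo m a c n ↔ (flip bind (TM2.step m))^[n] (some a) = some c := by
  have hnone : ∀ n : ℕ, (flip bind (TM2.step m))^[n] none = none := by
    intro n
    induction n with
    | zero => rfl
    | succ n ih => rw [Function.iterate_succ_apply]; exact ih
  induction n generalizing a with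
  | zero =>
    constructor
    · intro h; cases h; rfl
    · intro h; obtain rfl : a = c := by simpa using h
      exact .refl _
  | succ n ih =>
    rw [Function.iterate_succ_apply]
    obtain ⟨l, v, S⟩ := a
    cases l with
    | none =>
      refine ⟨fun h => ?_, fun h => ?_⟩
      · cases h
      · exact absurd (h.symm.trans (hnone n)) (by simp)
    | some l =>
      refine ⟨fun h => ?_, fun h => .head (ih.2 h)⟩
      cases h with
      | head h => exact ih.1 h

/-- Translate the labels of a statement; halting becomes a jump to `ex`, if there is one. -/
def relabel (φ : Λ → Λ') (ex : Option Λ') : Stmt Γ Λ σ → Stmt Γ Λ' σ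
  | .push k f q => .push k f (relabel φ ex q)
  | .peek k f q => .peek k f (relabel φ ex q)
  | .pop k f q => .pop k f (relabel φ ex q)
  | .load f q => .load f (relabel φ ex q)
  | .branch f q₁ q₂ => .branch f (relabel φ ex q₁) (relabel φ ex q₂)
  | .goto f => .goto fun v => φ (f v)
  | .halt => match ex with
    | none => .halt
    | some e => .goto fun _ => e

theorem stepAux_relabel (φ : Λ → Λ') (ex : Option Λ') (q : Stmt Γ Λ σ) (v : σ)
    (S : ∀ k, List (Γ k)) :
    stepAux (relabel φ ex q) v S =
      ⟨(stepAux q v S).l.elim ex fun l => some (φ l), (stepAux q v S).var,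
        (stepAux q v S).stk⟩ := by
  induction q generalizing v S with
  | halt => cases ex <;> rfl
  | branch f q₁ q₂ h₁ h₂ =>
    simp only [relabel, TM2.stepAux]
    cases f v
    · exact h₂ v S
    · exact h₁ v S
  | goto f => rfl
  | _ => simp only [relabel, TM2.stepAux, *]

/-- The run has to end in a halted configuration, since it is the halting of `m` that becomes the
jump to `ex`. Sequences, branches and loops of fragments all rest on this. -/
theorem StepsTo.relabel {m : Λ → Stmt Γ Λ σ} {m' : Λ' → Stmt Γ Λ' σ} {φ : Λ → Λ'}
    {ex : Option Λ'} (hm : ∀ l, m' (φ l) = StackProg.relabel φ ex (m l))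
    {a c : Cfg Γ Λ σ} {n : ℕ} (h : StepsTo m a c n) (hc : c.l = none) :
    StepsTo m' ⟨a.l.elim ex fun l => some (φ l), a.var, a.stk⟩ ⟨ex, c.var, c.stk⟩ n := by
  induction h with
  | refl c => rw [hc]; exact .refl _
  | head h ih =>
    have := ih hc
    refine .head ?_
    rw [hm, stepAux_relabel]
    exact this

end

/-- A part of the internal state that holds a letter of `A`; `ok` is the condition on the
rest of the state that holds between fragments. -/
structure Register (σ A : Type) where
  get : σ → Option A
  set : σ → Option A → σ
  ok : σ → Prop
  get_set : ∀ v a, get (set v a) = a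
  ok_set : ∀ v a, ok v → ok (set v a)

/-- A piece of program, which is left by halting. -/
structure Frag {K : Type} (Γ : K → Type) (σ : Type) where
  Λ : Type
  [fin : Fintype Λ]
  main : Λ
  m : Λ → Stmt Γ Λ σ

attribute [instance] Frag.fin

variable {K : Type} [DecidableEq K] {Γ : K → Type} {σ A : Type} (ρ : Register σ A)

/-- `F` transforms the stacks `S` into `S'` in at most `t` steps. -/
def Frag.Run (F : Frag Γ σ) (S S' : ∀ k, List (Γ k)) (t : ℕ) : Prop :=
  ∀ v, ρ.ok v → ∃ v', ρ.ok v' ∧ ∃ n ≤ t, StepsTo F.m ⟨some F.main, v, S⟩ ⟨none, v', S'⟩ n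

variable {ρ}

theorem Frag.Run.mono {F : Frag Γ σ} {S S' : ∀ k, List (Γ k)} {t t' : ℕ}
    (h : F.Run ρ S S' t) (ht : t ≤ t') : F.Run ρ S S' t' := by
  intro v hv
  obtain ⟨v', hv', n, hn, h⟩ := h v hv
  exact ⟨v', hv', n, hn.trans ht, h⟩

theorem Frag.Run.congr {F : Frag Γ σ} {S S' S'' : ∀ k, List (Γ k)} {t t' : ℕ}
    (h : F.Run ρ S S' t) (hS : S' = S'') (ht : t ≤ t') : F.Run ρ S S'' t' :=
  hS ▸ h.mono ht

/-- Push the letters of `l` one after the other. -/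
def emit (k : K) (l : List (Γ k)) : Frag Γ σ where
  Λ := Unit
  main := ()
  m _ := l.foldr (fun a q => .push k (fun _ => a) q) .halt

theorem stepAux_pushes {Λ : Type} (k : K) (l : List (Γ k)) (q : Stmt Γ Λ σ) (v : σ)
    (S : ∀ k, List (Γ k)) :
    stepAux (l.foldr (fun a q => .push k (fun _ => a) q) q) v S =
      stepAux q v (Function.update S k (l.reverse ++ S k)) := by
  induction l generalizing S with
  | nil => simp
  | cons a l ih => simp [ih]

theorem emit_run (k : K) (l : List (Γ k)) (S : ∀ k, List (Γ k)) :
    (emit k l : Frag Γ σ).Run ρ S (Function.update S k (l.reverse ++ S k)) 1 := by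
  intro v hv
  refine ⟨v, hv, 1, le_rfl, .head ?_⟩
  simp only [emit]
  rw [stepAux_pushes]
  exact .refl _

/-- Do nothing. -/
def skip : Frag Γ σ where
  Λ := Unit
  main := ()
  m _ := .halt

theorem skip_run (S : ∀ k, List (Γ k)) : (skip : Frag Γ σ).Run ρ S S 1 :=
  fun v hv => ⟨v, hv, 1, le_rfl, .head (.refl _)⟩

/-- First `F`, then `G`. -/
def seq (F G : Frag Γ σ) : Frag Γ σ where
  Λ := F.Λ ⊕ G.Λ
  main := .inl F.main
  m := Sum.elim (fun l => relabel .inl (some (.inr G.main)) (F.m l))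
    fun l => relabel .inr none (G.m l)

infixr:60 ";;" => seq

theorem seq_run {F G : Frag Γ σ} {S S' S'' : ∀ k, List (Γ k)} {t t' : ℕ}
    (hF : F.Run ρ S S' t) (hG : G.Run ρ S' S'' t') : (F ;; G).Run ρ S S'' (t + t') := by
  intro v hv
  obtain ⟨v', hv', n, hn, h⟩ := hF v hv
  obtain ⟨v'', hv'', n', hn', h'⟩ := hG v' hv'
  refine ⟨v'', hv'', n + n', add_le_add hn hn', ?_⟩
  refine StepsTo.trans (b := ⟨some (Sum.inr G.main), v', S'⟩) ?_ ?_
  · exact h.relabel (m' := (F ;; G).m) (φ := Sum.inl) (fun l => rfl) rfl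
  · exact h'.relabel (m' := (F ;; G).m) (φ := Sum.inr) (fun l => rfl) rfl

variable [Fintype A] (ρ)

/-- Pop from the stack `k` and continue according to the letter found. -/
def popCase (k : K) (code : Γ k → A) (F : Option A → Frag Γ σ) : Frag Γ σ where
  Λ := Unit ⊕ Σ a, (F a).Λ
  main := .inl ()
  m := Sum.elim
    (fun _ => .pop k (fun v x => ρ.set v (x.map code))
      (.goto fun v => .inr ⟨ρ.get v, (F (ρ.get v)).main⟩))
    fun l => relabel (fun l' => .inr ⟨l.1, l'⟩) none ((F l.1).m l.2)

variable {ρ}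

/-- The register holds the letter just long enough to choose the next label. Because `Run`
quantifies over all states that satisfy `ok`, what is left in the register has no influence later
on. -/
theorem popCase_run {k : K} {code : Γ k → A} {F : Option A → Frag Γ σ} {S S' : ∀ k, List (Γ k)}
    {t : ℕ} (h : (F ((S k).head?.map code)).Run ρ (Function.update S k (S k).tail) S' t) :
    (popCase ρ k code F).Run ρ S S' (t + 1) := by
  intro v hv
  obtain ⟨v', hv', n, hn, h⟩ := h _ (ρ.ok_set v ((S k).head?.map code) hv)
  refine ⟨v', hv', n + 1, by omega, .head ?_⟩
  have := h.relabel (m' := (popCase ρ k code F).m) (φ := fun l' => .inr ⟨_, l'⟩) (ex := none)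
    (fun l => rfl) rfl
  -- The type of the label of `F a` depends on the letter, so the value of the register is rewritten
  -- in the complete label.
  have e := congrArg (fun a => (Sum.inr ⟨a, (F a).main⟩ : Unit ⊕ Σ a, (F a).Λ))
    (ρ.get_set v ((S k).head?.map code))
  simp only [popCase, Sum.elim_inl, TM2.stepAux, e]
  exact this

theorem popCase_run_nil {k : K} {code : Γ k → A} {F : Option A → Frag Γ σ}
    {S S' : ∀ k, List (Γ k)} {t : ℕ} (hS : S k = []) (h : (F none).Run ρ S S' t) :
    (popCase ρ k code F).Run ρ S S' (t + 1) := by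
  refine popCase_run ?_
  have : Function.update S k [] = S := by rw [← hS, Function.update_eq_self]
  simpa [hS, this] using h

theorem popCase_run_cons {k : K} {code : Γ k → A} {F : Option A → Frag Γ σ}
    {S S' : ∀ k, List (Γ k)} {t : ℕ} {a : Γ k} {l : List (Γ k)} (hS : S k = a :: l)
    (h : (F (some (code a))).Run ρ (Function.update S k l) S' t) :
    (popCase ρ k code F).Run ρ S S' (t + 1) := by
  refine popCase_run ?_
  simpa [hS] using h

variable (ρ) in
/-- Pop from the stack `k` and run the body for the letter found, until the stack is empty or a
letter that satisfies `last` has been popped. -/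
def loop (k : K) (code : Γ k → A) (last : A → Bool) (F : A → Frag Γ σ) : Frag Γ σ where
  Λ := Bool ⊕ Σ a, (F a).Λ
  main := .inl true
  m := Sum.elim
    (Bool.rec .halt (.pop k (fun v x => ρ.set v (x.map code))
      (.goto fun v => match ρ.get v with
        | none => .inl false
        | some a => if last a then .inl false else .inr ⟨a, (F a).main⟩)))
    fun l => relabel (fun l' => .inr ⟨l.1, l'⟩) (some (.inl true)) ((F l.1).m l.2)

theorem loop_run_nil {k : K} {code : Γ k → A} {last : A → Bool} {F : A → Frag Γ σ}
    {S : ∀ k, List (Γ k)} (hS : S k = []) : (loop ρ k code last F).Run ρ S S 2 := by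
  intro v hv
  refine ⟨_, ρ.ok_set v none hv, 2, le_rfl, .head ?_⟩
  have : Function.update S k [] = S := by rw [← hS, Function.update_eq_self]
  simp only [loop, Sum.elim_inl, TM2.stepAux, ρ.get_set, hS, List.head?_nil, Option.map_none,
    List.tail_nil, this]
  exact .head (.refl _)

theorem loop_run_stop {k : K} {code : Γ k → A} {last : A → Bool} {F : A → Frag Γ σ}
    {S : ∀ k, List (Γ k)} {a : Γ k} {l : List (Γ k)} (hS : S k = a :: l)
    (ha : last (code a) = true) :
    (loop ρ k code last F).Run ρ S (Function.update S k l) 2 := by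
  intro v hv
  refine ⟨_, ρ.ok_set v (some (code a)) hv, 2, le_rfl, .head ?_⟩
  simp only [loop, Sum.elim_inl, TM2.stepAux, ρ.get_set, hS, List.head?_cons, Option.map_some,
    List.tail_cons, ha, if_true]
  exact .head (.refl _)

theorem loop_run_cons {k : K} {code : Γ k → A} {last : A → Bool} {F : A → Frag Γ σ}
    {S S' S'' : ∀ k, List (Γ k)} {t t' : ℕ} {a : Γ k} {l : List (Γ k)} (hS : S k = a :: l)
    (ha : last (code a) = false)
    (h : (F (code a)).Run ρ (Function.update S k l) S' t)
    (h' : (loop ρ k code last F).Run ρ S' S'' t') :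
    (loop ρ k code last F).Run ρ S S'' (t + t' + 1) := by
  intro v hv
  obtain ⟨v', hv', n, hn, h⟩ := h _ (ρ.ok_set v (some (code a)) hv)
  obtain ⟨v'', hv'', n', hn', h'⟩ := h' v' hv'
  refine ⟨v'', hv'', n + n' + 1, by omega, .head ?_⟩
  refine StepsTo.trans (b := ⟨some (Sum.inl true), v', S'⟩) ?_ h'
  have := h.relabel (m' := (loop ρ k code last F).m) (φ := fun l' => .inr ⟨_, l'⟩)
    (ex := some (.inl true)) (fun l => rfl) rfl
  simpa [loop, ρ.get_set, hS, ha] using this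

/-! ### Loops that read a whole stack -/

section

variable {K : Type} [DecidableEq K] {Γ : K → Type} {σ A : Type} [Fintype A] {ρ : Register σ A}

/-- The invariant `I p l` speaks of the letters `p` already read and the letters `l` still on the
stack. Each letter costs one step besides the body, and two steps notice the empty stack. -/
theorem loop_run {k : K} {code : Γ k → A} {F : A → Frag Γ σ} {τ : ℕ} (L : List (Γ k))
    (I : List (Γ k) → List (Γ k) → ∀ k, List (Γ k)) (hI : ∀ p l, I p l k = l)
    (hF : ∀ p a l, p ++ a :: l = L →
      (F (code a)).Run ρ (Function.update (I p (a :: l)) k l) (I (p ++ [a]) l) τ) :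
    (loop ρ k code (fun _ => false) F).Run ρ (I [] L) (I L []) (L.length * (τ + 1) + 2) := by
  suffices H : ∀ l p, p ++ l = L → (loop ρ k code (fun _ => false) F).Run ρ (I p l) (I L [])
      (l.length * (τ + 1) + 2) from H L [] rfl
  intro l
  induction l with
  | nil =>
    intro p hp
    obtain rfl : p = L := by simpa using hp
    simpa using loop_run_nil (hI p [])
  | cons a l ih =>
    intro p hp
    refine (loop_run_cons (hI p _) rfl (hF p a l hp) (ih (p ++ [a]) (by simpa using hp))).mono ?_
    simp only [List.length_cons]
    ring_nf
    omega

end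

/-! ### Lifting programs to a larger set of stacks -/

section

variable {K₁ K₂ : Type} [DecidableEq K₁] [DecidableEq K₂] {Γ₁ : K₁ → Type} {Γ₂ : K₂ → Type}
  {Λ σ₁ σ₂ : Type}

/-- The alphabets of two families of stacks side by side. -/
@[reducible] def sumAlphabet (Γ₁ : K₁ → Type) (Γ₂ : K₂ → Type) : K₁ ⊕ K₂ → Type
  | .inl k => Γ₁ k
  | .inr k => Γ₂ k

/-- Two families of stacks side by side. -/
def join (S₁ : ∀ k, List (Γ₁ k)) (S₂ : ∀ k, List (Γ₂ k)) :
    ∀ k : K₁ ⊕ K₂, List (sumAlphabet Γ₁ Γ₂ k)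
  | .inl k => S₁ k
  | .inr k => S₂ k

theorem update_join_inl (S₁ : ∀ k, List (Γ₁ k)) (S₂ : ∀ k, List (Γ₂ k)) (k : K₁)
    (l : List (Γ₁ k)) :
    Function.update (join S₁ S₂) (.inl k) l = join (Function.update S₁ k l) S₂ := by
  funext j
  rcases j with j | j
  · by_cases h : j = k
    · subst h; simp [join]
    · simp [join, h]
  · simp [join]

theorem update_join_inr (S₁ : ∀ k, List (Γ₁ k)) (S₂ : ∀ k, List (Γ₂ k)) (k : K₂)
    (l : List (Γ₂ k)) :
    Function.update (join S₁ S₂) (.inr k) l = join S₁ (Function.update S₂ k l) := by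
  funext j
  rcases j with j | j
  · simp [join]
  · by_cases h : j = k
    · subst h; simp [join]
    · simp [join, h]

def liftLeft : Stmt Γ₁ Λ σ₁ → Stmt (sumAlphabet Γ₁ Γ₂) Λ (σ₁ × σ₂)
  | .push k f q => .push (.inl k) (fun v => f v.1) (liftLeft q)
  | .peek k f q => .peek (.inl k) (fun v x => (f v.1 x, v.2)) (liftLeft q)
  | .pop k f q => .pop (.inl k) (fun v x => (f v.1 x, v.2)) (liftLeft q)
  | .load f q => .load (fun v => (f v.1, v.2)) (liftLeft q)
  | .branch f q₁ q₂ => .branch (fun v => f v.1) (liftLeft q₁) (liftLeft q₂)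
  | .goto f => .goto fun v => f v.1
  | .halt => .halt

def liftRight : Stmt Γ₂ Λ σ₂ → Stmt (sumAlphabet Γ₁ Γ₂) Λ (σ₁ × σ₂)
  | .push k f q => .push (.inr k) (fun v => f v.2) (liftRight q)
  | .peek k f q => .peek (.inr k) (fun v x => (v.1, f v.2 x)) (liftRight q)
  | .pop k f q => .pop (.inr k) (fun v x => (v.1, f v.2 x)) (liftRight q)
  | .load f q => .load (fun v => (v.1, f v.2)) (liftRight q)
  | .branch f q₁ q₂ => .branch (fun v => f v.2) (liftRight q₁) (liftRight q₂)
  | .goto f => .goto fun v => f v.2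
  | .halt => .halt

theorem stepAux_liftLeft (q : Stmt Γ₁ Λ σ₁) (v : σ₁) (r : σ₂) (S₁ : ∀ k, List (Γ₁ k))
    (S₂ : ∀ k, List (Γ₂ k)) :
    stepAux (liftLeft q) (v, r) (join S₁ S₂) =
      ⟨(stepAux q v S₁).l, ((stepAux q v S₁).var, r), join (stepAux q v S₁).stk S₂⟩ := by
  induction q generalizing v S₁ with
  | branch f q₁ q₂ h₁ h₂ =>
    simp only [liftLeft, TM2.stepAux]
    cases f v
    · exact h₂ v S₁
    · exact h₁ v S₁
  | goto f => rfl
  | halt => rfl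
  | load f q h => exact h _ _
  | peek k f q h => exact h _ _
  | push k f q h =>
    rw [liftLeft, TM2.stepAux, update_join_inl]; exact h _ _
  | pop k f q h =>
    rw [liftLeft, TM2.stepAux, update_join_inl]; exact h _ _

theorem stepAux_liftRight (q : Stmt Γ₂ Λ σ₂) (v : σ₁) (r : σ₂) (S₁ : ∀ k, List (Γ₁ k))
    (S₂ : ∀ k, List (Γ₂ k)) :
    stepAux (liftRight q) (v, r) (join S₁ S₂) =
      ⟨(stepAux q r S₂).l, (v, (stepAux q r S₂).var), join S₁ (stepAux q r S₂).stk⟩ := by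
  induction q generalizing r S₂ with
  | branch f q₁ q₂ h₁ h₂ =>
    simp only [liftRight, TM2.stepAux]
    cases f r
    · exact h₂ r S₂
    · exact h₁ r S₂
  | goto f => rfl
  | halt => rfl
  | load f q h => exact h _ _
  | peek k f q h => exact h _ _
  | push k f q h =>
    rw [liftRight, TM2.stepAux, update_join_inr]; exact h _ _
  | pop k f q h =>
    rw [liftRight, TM2.stepAux, update_join_inr]; exact h _ _

theorem StepsTo.liftLeft {m : Λ → Stmt Γ₁ Λ σ₁} {a c : Cfg Γ₁ Λ σ₁} {n : ℕ}
    (h : StepsTo m a c n) (r : σ₂) (S₂ : ∀ k, List (Γ₂ k)) :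
    StepsTo (fun l => (liftLeft (m l) : Stmt (sumAlphabet Γ₁ Γ₂) Λ (σ₁ × σ₂)))
      ⟨a.l, (a.var, r), join a.stk S₂⟩ ⟨c.l, (c.var, r), join c.stk S₂⟩ n := by
  induction h with
  | refl c => exact .refl _
  | head h ih => exact .head (by rw [stepAux_liftLeft]; exact ih)

theorem StepsTo.liftRight {m : Λ → Stmt Γ₂ Λ σ₂} {a c : Cfg Γ₂ Λ σ₂} {n : ℕ}
    (h : StepsTo m a c n) (v : σ₁) (S₁ : ∀ k, List (Γ₁ k)) :
    StepsTo (fun l => (liftRight (m l) : Stmt (sumAlphabet Γ₁ Γ₂) Λ (σ₁ × σ₂)))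
      ⟨a.l, (v, a.var), join S₁ a.stk⟩ ⟨c.l, (v, c.var), join S₁ c.stk⟩ n := by
  induction h with
  | refl c => exact .refl _
  | head h ih => exact .head (by rw [stepAux_liftRight]; exact ih)

end

/-! ### The length of the output is bounded by the running time -/

section

variable {K : Type} [DecidableEq K] {Γ : K → Type} {Λ σ : Type}

theorem exists_length_stepAux_le (q : Stmt Γ Λ σ) :
    ∃ c : ℕ, ∀ v S k, ((stepAux q v S).stk k).length ≤ (S k).length + c := by
  induction q with
  | push k f q h =>
    obtain ⟨c, hc⟩ := h
    refine ⟨c + 1, fun v S j => (hc v _ j).trans ?_⟩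
    by_cases h : j = k
    · subst h; simp; omega
    · simp [h]
  | pop k f q h =>
    obtain ⟨c, hc⟩ := h
    refine ⟨c, fun v S j => (hc _ _ j).trans ?_⟩
    by_cases h : j = k
    · subst h; simp
    · simp [h]
  | peek k f q h => exact h.imp fun c hc v S j => hc _ _ j
  | load f q h => exact h.imp fun c hc v S j => hc _ _ j
  | branch f q₁ q₂ h₁ h₂ =>
    obtain ⟨c₁, h₁⟩ := h₁
    obtain ⟨c₂, h₂⟩ := h₂
    refine ⟨c₁ + c₂, fun v S j => ?_⟩
    simp only [TM2.stepAux]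
    cases f v
    · exact (h₂ v S j).trans (by omega)
    · exact (h₁ v S j).trans (by omega)
  | goto f => exact ⟨0, fun v S j => le_rfl⟩
  | halt => exact ⟨0, fun v S j => le_rfl⟩

/-- A statement contains a fixed number of pushes and there are finitely many labels. This bounds
the output of a polynomial-time machine polynomially, so that processing it further remains
polynomial. -/
theorem exists_length_stepsTo_le [Fintype Λ] (m : Λ → Stmt Γ Λ σ) :
    ∃ c : ℕ, ∀ a b n, StepsTo m a b n → ∀ k, (b.stk k).length ≤ (a.stk k).length + c * n := by
  choose c hc using fun l => exists_length_stepAux_le (m l)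
  refine ⟨∑ l, c l, fun a b n h k => ?_⟩
  induction h with
  | refl => simp
  | @head l v S b n h ih =>
    refine ih.trans ?_
    have := hc l v S k
    have h2 : c l ≤ ∑ l, c l := Finset.single_le_sum (fun _ _ => Nat.zero_le _) (Finset.mem_univ l)
    rw [Nat.mul_succ]
    simp only
    omega

end

/-! ### Postprocessing the output of a machine, together with its input -/

/-- The register of a program whose internal state is just the register. -/
def plainRegister (A : Type) : Register (Option A) A where
  get := id
  set _ a := a
  ok _ := True
  get_set _ _ := rfl
  ok_set _ _ _ := trivial

/-- The register of a program that has set aside the state `s` of another one. -/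
def sideRegister {σ : Type} (s : σ) (A : Type) : Register (σ × Option A) A where
  get := Prod.snd
  set v a := (v.1, a)
  ok v := v.1 = s
  get_set _ _ := rfl
  ok_set _ _ h := h

theorem initList_stk (tm : FinTM2) (s : List (tm.Γ tm.k₀)) :
    (initList tm s).stk = Function.update (fun _ => []) tm.k₀ s := by
  funext k
  by_cases h : k = tm.k₀
  · subst h; simp [initList]
  · simp [initList, h]

theorem haltList_stk (tm : FinTM2) (s : List (tm.Γ tm.k₁)) :
    (haltList tm s).stk = Function.update (fun _ => []) tm.k₁ s := by
  funext k
  by_cases h : k = tm.k₁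
  · subst h; simp [haltList]
  · simp [haltList, h]

section

variable {J A : Type} [DecidableEq J] [Fintype A]

/-- Copy the input, run the machine `tm`, move its output, and run `F`. -/
def postprocess (tm : FinTM2) (inX : tm.Γ tm.k₀ → A) (outX : A → tm.Γ tm.k₀) (inG : tm.Γ tm.k₁ → A)
    (jx jg jt : J) (F : Frag (fun _ : J => A) (Option A)) :
    Frag (sumAlphabet tm.Γ fun _ : J => A) (tm.σ × Option A) :=
  letI := tm.kFin
  letI := tm.ΛFin
  loop (sideRegister tm.initialState A) (.inl tm.k₀) inX (fun _ => false)
      (fun a => emit (.inr jt) [a]) ;;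
  loop (sideRegister tm.initialState A) (.inr jt) id (fun _ => false)
      (fun a => emit (.inl tm.k₀) [outX a] ;; emit (.inr jx) [a]) ;;
  ({ Λ := tm.Λ, main := tm.main, m := fun l => liftLeft (tm.m l) } :
    Frag (sumAlphabet tm.Γ fun _ : J => A) (tm.σ × Option A)) ;;
  loop (sideRegister tm.initialState A) (.inl tm.k₁) inG (fun _ => false)
      (fun a => emit (.inr jt) [a]) ;;
  loop (sideRegister tm.initialState A) (.inr jt) id (fun _ => false)
      (fun a => emit (.inr jg) [a]) ;;
  { Λ := F.Λ, main := F.main, m := fun l => liftRight (F.m l) }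

/-- Moving a word between stacks reverses it, so the input and the output each pass through `jt`
once. The four transfers cost 2, 3, 2 and 2 steps per letter and 2 steps each; the one with 3
restores the input of `tm` and makes the copy on `jx`. -/
theorem postprocess_run (tm : FinTM2) {inX : tm.Γ tm.k₀ → A} {outX : A → tm.Γ tm.k₀}
    (hX : ∀ s, outX (inX s) = s) (inG : tm.Γ tm.k₁ → A)
    {jx jg jt : J} (hxg : jx ≠ jg) (hxt : jx ≠ jt) (hgt : jg ≠ jt)
    {F : Frag (fun _ : J => A) (Option A)}
    {x : List (tm.Γ tm.k₀)} {y : List (tm.Γ tm.k₁)} {t t' : ℕ} {S : J → List A}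
    (htm : TM2OutputsInTime tm x (some y) t)
    (hF : F.Run (plainRegister A)
      (Function.update (Function.update (fun _ => []) jx (x.map inX)) jg (y.map inG)) S t') :
    (postprocess tm inX outX inG jx jg jt F).Run (sideRegister tm.initialState A)
      (Function.update (fun _ => []) (.inl tm.k₀) x)
      (join (fun _ => []) S)
      (5 * x.length + 4 * y.length + t + t' + 8) := by
  let := tm.kFin
  let := tm.ΛFin
  let Z : J → List A := fun _ => []
  have e0 : (Function.update (fun _ => []) (.inl tm.k₀) x :
      ∀ k, List ((sumAlphabet tm.Γ fun _ : J => A) k)) =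
      join (Function.update (fun _ => []) tm.k₀ x) Z := by
    rw [← update_join_inl]
    congr 1
    funext k
    cases k <;> rfl
  rw [e0]
  have h1 := loop_run (ρ := sideRegister tm.initialState A) (τ := 1)
    (Γ := sumAlphabet tm.Γ fun _ : J => A)
    (k := .inl tm.k₀) (code := inX) (F := fun a => emit (.inr jt) [a]) x
    (fun p l => join (Function.update (fun _ => []) tm.k₀ l)
      (Function.update Z jt (p.map inX).reverse)) (fun p l => by simp [join]) (by
    intro p a l _
    refine (emit_run _ _ _).congr ?_ le_rfl
    rw [update_join_inl, update_join_inr]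
    simp [join])
  have h2 := loop_run (ρ := sideRegister tm.initialState A) (τ := 2)
    (Γ := sumAlphabet tm.Γ fun _ : J => A)
    (k := .inr jt) (code := id)
    (F := fun a => emit (.inl tm.k₀) [outX a] ;; emit (.inr jx) [a]) (x.map inX).reverse
    (fun p l => join (Function.update (fun _ => []) tm.k₀ (p.map outX).reverse)
      (Function.update (Function.update Z jt l) jx p.reverse)) (fun p l => by
        simp [join, hxt.symm]) (by
    intro p a l _
    refine (seq_run (emit_run _ _ _) (emit_run _ _ _)).congr ?_ le_rfl
    rw [update_join_inr, update_join_inl, update_join_inr]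
    simp only [join, Function.update_self, List.reverse_singleton, id, List.singleton_append,
      Function.update_idem, List.map_append, List.reverse_append, List.map_singleton]
    congr 1
    rw [Function.update_comm hxt.symm, Function.update_idem, Function.update_comm hxt.symm,
      Function.update_idem, Function.update_of_ne hxt, Function.update_self,
      Function.update_comm hxt])
  have h4 := loop_run (ρ := sideRegister tm.initialState A) (τ := 1)
    (Γ := sumAlphabet tm.Γ fun _ : J => A)
    (k := .inl tm.k₁) (code := inG) (F := fun a => emit (.inr jt) [a]) y
    (fun p l => join (Function.update (fun _ => []) tm.k₁ l)
      (Function.update (Function.update Z jx (x.map inX)) jt (p.map inG).reverse))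
    (fun p l => by simp [join]) (by
    intro p a l _
    refine (emit_run _ _ _).congr ?_ le_rfl
    rw [update_join_inl, update_join_inr]
    simp [join])
  have h5 := loop_run (ρ := sideRegister tm.initialState A) (τ := 1)
    (Γ := sumAlphabet tm.Γ fun _ : J => A)
    (k := .inr jt) (code := id) (F := fun a => emit (.inr jg) [a]) (y.map inG).reverse
    (fun p l => join (fun _ => [])
      (Function.update (Function.update (Function.update Z jx (x.map inX)) jt l) jg p.reverse))
    (fun p l => by simp [join, hgt.symm]) (by
    intro p a l _
    refine (emit_run _ _ _).congr ?_ le_rfl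
    rw [update_join_inr, update_join_inr]
    simp only [join, List.reverse_singleton, id, List.singleton_append,
      List.reverse_append]
    congr 1
    rw [Function.update_comm hgt.symm, Function.update_idem, Function.update_comm hgt.symm,
      Function.update_idem, Function.update_of_ne hgt, Function.update_self,
      Function.update_comm hgt])
  simp only [List.map_nil, List.reverse_nil, List.map_reverse, List.reverse_reverse, List.map_map,
    List.length_reverse, List.length_map] at h1 h2 h4 h5
  have hid : (outX ∘ inX) = id := funext hX
  rw [hid, List.map_id] at h2
  have c1 : Function.update Z jt [] = Z := by
    funext j; by_cases h : j = jt <;> simp [Z, Function.update_apply]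
  have c2 : Function.update Z jx [] = Z := by
    funext j; by_cases h : j = jx <;> simp [Z, Function.update_apply]
  have c3 : ∀ {k : tm.K}, Function.update (fun _ => [] : ∀ k, List (tm.Γ k)) k [] = fun _ => [] := by
    intro k; funext j; by_cases h : j = k
    · subst h; simp
    · simp [h]
  have c4 : Function.update (Function.update Z jx (x.map inX)) jt [] =
      Function.update Z jx (x.map inX) := by
    rw [Function.update_comm hxt, c1]
  have c5 : Function.update (Function.update (Function.update Z jx (x.map inX)) jt
      (y.map inG).reverse) jg [] = (Function.update (Function.update Z jx (x.map inX)) jt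
      (y.map inG).reverse) := by
    rw [Function.update_eq_self_iff]
    simp [Z, hgt, hxg.symm]
  have c6 : Function.update (Function.update Z jt (x.map inX).reverse) jx [] =
      Function.update Z jt (x.map inX).reverse := by
    rw [Function.update_eq_self_iff]
    simp [Z, hxt]
  rw [c1, c3] at h1
  rw [c3, c6, c1] at h2
  rw [c4, c3] at h4
  rw [c5, c4] at h5
  have h3 : ({ Λ := tm.Λ, main := tm.main, m := fun l => liftLeft (tm.m l) } :
      Frag (sumAlphabet tm.Γ fun _ : J => A) (tm.σ × Option A)).Run (sideRegister tm.initialState A)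
      (join (Function.update (fun _ => []) tm.k₀ x) (Function.update Z jx (x.map inX)))
      (join (Function.update (fun _ => []) tm.k₁ y) (Function.update Z jx (x.map inX))) t := by
    -- The evaluations of `tm` start and end in its initial state, so the condition `ok` of
    -- `sideRegister` survives the run.
    rintro ⟨v, r⟩ (rfl : v = tm.initialState)
    refine ⟨(tm.initialState, r), rfl, htm.steps, htm.steps_le_m, ?_⟩
    have := (stepsTo_iff_iterate (m := tm.m) (a := initList tm x) (c := haltList tm y)).2
      htm.evals_in_steps
    have := this.liftLeft r (Function.update Z jx (x.map inX))
    rw [initList_stk, haltList_stk] at this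
    exact this
  have h6 : ({ Λ := F.Λ, main := F.main, m := fun l => liftRight (F.m l) } :
      Frag (sumAlphabet tm.Γ fun _ : J => A) (tm.σ × Option A)).Run (sideRegister tm.initialState A)
      (join (fun _ => [])
        (Function.update (Function.update Z jx (x.map inX)) jg (y.map inG)))
      (join (fun _ => []) S) t' := by
    rintro ⟨v, r⟩ (rfl : v = tm.initialState)
    obtain ⟨r', _, n, hn, h⟩ := hF r trivial
    exact ⟨(tm.initialState, r'), rfl, n, hn, h.liftRight tm.initialState _⟩
  refine (seq_run h1 <| seq_run h2 <| seq_run h3 <| seq_run h4 <| seq_run h5 h6).mono ?_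
  omega

theorem seq_stepsTo {K : Type} [DecidableEq K] {Γ : K → Type} {σ : Type} {F G : Frag Γ σ}
    {v v' v'' : σ} {S S' S'' : ∀ k, List (Γ k)} {n n' : ℕ}
    (h : StepsTo F.m ⟨some F.main, v, S⟩ ⟨none, v', S'⟩ n)
    (h' : StepsTo G.m ⟨some G.main, v', S'⟩ ⟨none, v'', S''⟩ n') :
    StepsTo (F ;; G).m ⟨some (F ;; G).main, v, S⟩ ⟨none, v'', S''⟩ (n + n') := by
  refine StepsTo.trans (b := ⟨some (Sum.inr G.main), v', S'⟩) ?_ ?_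
  · exact h.relabel (m' := (F ;; G).m) (φ := Sum.inl) (fun l => rfl) rfl
  · exact h'.relabel (m' := (F ;; G).m) (φ := Sum.inr) (fun l => rfl) rfl

theorem eval_mono (p : Polynomial ℕ) : Monotone fun n => p.eval n := by
  intro a b hab
  simp only [Polynomial.eval_eq_sum_range]
  gcongr

/-- A program that clears the register. -/
def resetState {K : Type} {Γ : K → Type} {σ : Type} (s : σ) : Frag Γ σ where
  Λ := Unit
  main := ()
  m _ := .load (fun _ => s) .halt

/-- Composition of polynomial-time computations, in the form in which the second one sees both `x`
and the code of `f x`. The bound `T` may involve the length of that code, as the running time of the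
first machine controls it. -/
theorem polyTimeGenerated_postprocess [Fintype J] {β γ Γ₁ : Type} {e : Encoding β Γ₁} {e' : Encoding γ A}
    {f : List Bool → β} (hf : PolyTimeGenerated e f) (g : List Bool → γ)
    (inX : Bool → A) (hX : Function.Injective inX) (inG : Γ₁ → A)
    {jx jg jt jo : J} (hxg : jx ≠ jg) (hxt : jx ≠ jt) (hgt : jg ≠ jt)
    (F : Frag (fun _ : J => A) (Option A)) (T : Polynomial ℕ)
    (hF : ∀ x, F.Run (plainRegister A)
      (Function.update (Function.update (fun _ => []) jx (x.map inX)) jg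
        ((e.encode (f x)).map inG))
      (Function.update (fun _ => []) jo (e'.encode (g x)))
      (T.eval (x.length + (e.encode (f x)).length))) :
    PolyTimeGenerated e' g := by
  obtain ⟨⟨⟨tm, α, ω⟩, time, out⟩⟩ := hf
  dsimp only at out
  let := tm.kFin
  let := tm.ΛFin
  let := tm.σFin
  let := tm.Γk₀Fin
  obtain ⟨c, hc⟩ := exists_length_stepsTo_le tm.m
  let inX' : tm.Γ tm.k₀ → A := fun s => inX (α s)
  let outX : A → tm.Γ tm.k₀ := fun a => α.symm (Function.invFun inX a)
  let P := postprocess tm inX' outX (fun s => inG (ω s)) jx jg jt F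
  -- A final configuration is required to have the initial internal state, so the register has to be
  -- cleared at the end.
  let P' := P ;; resetState (tm.initialState, none)
  let tm' : FinTM2 :=
    { K := tm.K ⊕ J
      k₀ := .inl tm.k₀
      k₁ := .inr jo
      Γ := sumAlphabet tm.Γ fun _ : J => A
      Λ := P'.Λ
      main := P'.main
      σ := tm.σ × Option A
      initialState := (tm.initialState, none)
      Γk₀Fin := tm.Γk₀Fin
      m := P'.m }
  -- The output is at most as long as the input plus a constant for each step of `tm`.
  let L : Polynomial ℕ := Polynomial.X + Polynomial.C c * time
  refine ⟨{
    tm := tm'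
    inputAlphabet := α
    outputAlphabet := Equiv.refl A
    time := 5 * Polynomial.X + 4 * L + time + T.comp (Polynomial.X + L) + 9
    outputsFun := fun x => Nonempty.some ?_ }⟩
  set y := e.encode (f x) with hy
  have hyl : y.length ≤ L.eval x.length := by
    have := hc _ _ _ ((stepsTo_iff_iterate (m := tm.m)).2 (out x).evals_in_steps) tm.k₁
    rw [initList_stk, haltList_stk] at this
    simp only [Function.update_self, List.length_map] at this
    refine this.trans ?_
    have h1 : ((Function.update (fun _ => []) tm.k₀
        (List.map α.invFun ((encodingList Bool).encode x)) : ∀ k, List (tm.Γ k)) tm.k₁).length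
        ≤ x.length := by
      -- The input and the output stack may coincide, in which case the output stack is not empty at
      -- the start.
      by_cases h : tm.k₁ = tm.k₀
      · generalize tm.k₁ = k at h
        subst h
        simp [encodingList]
      · simp [h]
    have h2 : (out x).steps ≤ time.eval x.length := (out x).steps_le_m
    simp only [L, Polynomial.eval_add, Polynomial.eval_X, Polynomial.eval_mul, Polynomial.eval_C]
    exact add_le_add h1 (Nat.mul_le_mul_left c h2)
  have hrun := postprocess_run tm (inX := inX') (outX := outX) (fun s => by
    simp only [inX', outX]
    rw [Function.leftInverse_invFun hX, α.symm_apply_apply]) (fun s => inG (ω s)) hxg hxt hgt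
    (out x) (F := F) (S := Function.update (fun _ => []) jo (e'.encode (g x)))
    (t' := T.eval (x.length + y.length)) (by
      convert hF x using 2
      · rw [List.map_map]
        congr 1
        · congr 1
          simp [inX', Function.comp_def]
      · rw [List.map_map, ← hy]
        simp [Function.comp_def])
  obtain ⟨⟨v1, v2⟩, hv, n, hn, h⟩ := hrun (tm.initialState, none) rfl
  obtain rfl : v1 = tm.initialState := hv
  have hreset : StepsTo (resetState (tm.initialState, none) :
      Frag (sumAlphabet tm.Γ fun _ : J => A) (tm.σ × Option A)).m
      ⟨some (), (tm.initialState, v2), join (fun _ => [])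
        (Function.update (fun _ => []) jo (e'.encode (g x)))⟩
      ⟨none, (tm.initialState, none), join (fun _ => [])
        (Function.update (fun _ => []) jo (e'.encode (g x)))⟩ 1 := .head (.refl _)
  have hall := seq_stepsTo h hreset
  have h0 : (initList tm' (List.map α.invFun ((encodingList Bool).encode x))) =
      ⟨some P'.main, (tm.initialState, none), Function.update (fun _ => []) (.inl tm.k₀)
        (List.map α.invFun ((encodingList Bool).encode x))⟩ := by
    have := initList_stk tm' (List.map α.invFun ((encodingList Bool).encode x))
    exact congrArg (TM2.Cfg.mk (some P'.main) (tm.initialState, none)) this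
  have h1 : (haltList tm' (List.map (Equiv.refl A).invFun (e'.encode (g x)))) =
      ⟨none, (tm.initialState, none), join (fun _ => [])
        (Function.update (fun _ => []) jo (e'.encode (g x)))⟩ := by
    have := haltList_stk tm' (List.map (Equiv.refl A).invFun (e'.encode (g x)))
    refine (congrArg (TM2.Cfg.mk none (tm.initialState, none)) this).trans ?_
    congr 1
    rw [← update_join_inr]
    have : (List.map (Equiv.refl A).invFun (e'.encode (g x))) = e'.encode (g x) := by
      simp
    rw [this]
    congr 1
    funext k
    cases k <;> rfl
  refine ⟨⟨⟨n + 1, ?_⟩, ?_⟩⟩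
  · rw [h0]
    refine ((stepsTo_iff_iterate (m := P'.m)).1 hall).trans ?_
    rw [← h1]
    rfl
  · have h3 : T.eval (x.length + y.length) ≤ T.eval (x.length + L.eval x.length) :=
      eval_mono T (by omega)
    simp only [List.length_map, encodingList, id] at hn
    simp only [encodingList, id, Polynomial.eval_add, Polynomial.eval_mul, Polynomial.eval_ofNat,
      Polynomial.eval_X, Polynomial.eval_comp]
    rw [← hy] at hn
    omega

end

end StackProg

/-! ### Moments of the sum of a cyclic shift and its adjoint -/

namespace CyclicShift

open Matrix

variable {N ι : Type} [Fintype N] [DecidableEq N] [Fintype ι] [DecidableEq ι]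

/-- A system of matrix units together with unitaries that commute with them, attached to the
steps of a walk around a cyclic group. -/
structure Walk (N ι : Type) [Fintype N] [DecidableEq N] [Fintype ι] [DecidableEq ι] where
  E : ι → ι → Matrix N N ℂ
  V : ι → Matrix N N ℂ
  mul_E : ∀ a b c d, E a b * E c d = if b = c then E a d else 0
  sum_E : ∑ a, E a a = 1
  star_E : ∀ a b, (E a b)ᴴ = E b a
  comm : ∀ a b c, E a b * V c = V c * E a b
  star_mul_V : ∀ c, (V c)ᴴ * V c = 1

variable (w : Walk N ι)

namespace Walk

theorem comm_star (a b c : ι) : w.E a b * (w.V c)ᴴ = (w.V c)ᴴ * w.E a b := by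
  have := congrArg conjTranspose (w.comm b a c)
  simpa [conjTranspose_mul, w.star_E] using this.symm

/-- Write `E a b = E a b * E b b`. Cyclicity and the commutation with `X` bring `E b b` in front of
`E a b`, and this product vanishes. -/
theorem trace_E_mul_of_ne {a b : ι} (h : a ≠ b) (X : Matrix N N ℂ)
    (hX : ∀ a b, w.E a b * X = X * w.E a b) : (w.E a b * X).trace = 0 := by
  have : w.E a b = w.E a b * w.E b b := by rw [w.mul_E, if_pos rfl]
  rw [this, mul_assoc, trace_mul_comm, mul_assoc, ← hX, ← mul_assoc, w.mul_E, if_neg h.symm]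
  simp

theorem trace_E_mul (a b : ι) (X : Matrix N N ℂ)
    (hX : ∀ a b, w.E a b * X = X * w.E a b) : (w.E a a * X).trace = (w.E b b * X).trace := by
  have h1 : w.E a a = w.E a b * w.E b a := by rw [w.mul_E, if_pos rfl]
  rw [h1, mul_assoc, trace_mul_comm, mul_assoc, ← hX, ← mul_assoc, w.mul_E, if_pos rfl]

variable [AddCommGroup ι] (g : ι)

/-- The unitary that moves one step ahead. -/
def step : Matrix N N ℂ := ∑ c, w.E (c + g) c * w.V c

/-- The product of the unitaries that are met in the first `m` steps from `c`. -/
def path (c : ι) : ℕ → Matrix N N ℂ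
  | 0 => 1
  | m + 1 => w.V (c + m • g) * path c m

theorem comm_path (a b c : ι) (m : ℕ) :
    w.E a b * w.path g c m = w.path g c m * w.E a b := by
  induction m with
  | zero => simp [path]
  | succ m ih => rw [path, ← mul_assoc, w.comm, mul_assoc, ih, mul_assoc]

/-- Only one summand of `step g` can follow a path that has arrived at `d + m • g`; the unitaries
met on the way commute with the matrix units and collect in `path`. -/
theorem step_pow (m : ℕ) : w.step g ^ m = ∑ c, w.E (c + m • g) c * w.path g c m := by
  induction m with
  | zero => simp [path, w.sum_E]
  | succ m ih =>
    rw [pow_succ', ih, step, Finset.sum_mul]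
    have : ∀ c, w.E (c + g) c * w.V c * ∑ d, w.E (d + m • g) d * w.path g d m =
        ∑ d, if c = d + m • g then w.E (d + (m + 1) • g) d * w.path g d (m + 1) else 0 := by
      intro c
      rw [Finset.mul_sum]
      refine Finset.sum_congr rfl fun d _ => ?_
      rw [mul_assoc, ← mul_assoc (w.V c), ← w.comm, mul_assoc, ← mul_assoc, w.mul_E]
      split_ifs with h
      · subst h
        rw [path, add_assoc, succ_nsmul]
      · simp
    rw [Finset.sum_congr rfl fun c _ => this c, Finset.sum_comm]
    refine Finset.sum_congr rfl fun d _ => ?_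
    simp

theorem star_step_mul_step : (w.step g)ᴴ * w.step g = 1 := by
  rw [step, conjTranspose_sum, Finset.sum_mul, ← w.sum_E]
  refine Finset.sum_congr rfl fun c _ => ?_
  rw [Finset.mul_sum, Finset.sum_eq_single c]
  · rw [conjTranspose_mul, w.star_E, ← w.comm_star, mul_assoc, ← mul_assoc _ (w.E _ _),
      ← w.comm_star, mul_assoc, w.star_mul_V, mul_one, w.mul_E, if_pos rfl]
  · intro d _ hd
    rw [conjTranspose_mul, w.star_E, mul_assoc, ← mul_assoc (w.E _ _), w.mul_E, if_neg]
    · simp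
    · intro h
      exact hd (add_right_cancel h).symm
  · simp

theorem trace_step_pow_of_ne {m : ℕ} (h : m • g ≠ 0) : (w.step g ^ m).trace = 0 := by
  rw [step_pow, trace_sum]
  refine Finset.sum_eq_zero fun c _ => w.trace_E_mul_of_ne (by simpa using h) _ ?_
  intro a b
  exact w.comm_path g a b c m

theorem path_succ' (c : ι) (m : ℕ) : w.path g c (m + 1) = w.path g (c + g) m * w.V c := by
  induction m with
  | zero => simp [path]
  | succ m ih =>
    rw [path, ih, path, mul_assoc, add_assoc, succ_nsmul']

/-- Starting one step later on a closed path moves `V c` from the first unitary applied to the last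
one, which cyclicity of the trace does not notice. -/
theorem trace_path_shift (c : ι) {m : ℕ} (h : m • g = 0) (hm : 0 < m) :
    (w.E c c * w.path g c m).trace = (w.E (c + g) (c + g) * w.path g (c + g) m).trace := by
  obtain ⟨m, rfl⟩ := Nat.exists_eq_succ_of_ne_zero hm.ne'
  rw [Nat.succ_eq_add_one, path_succ', ← mul_assoc, trace_mul_comm, ← mul_assoc, ← w.comm,
    mul_assoc]
  have : w.path g (c + g) (m + 1) = w.V c * w.path g (c + g) m := by
    rw [path, add_assoc, ← succ_nsmul', h, add_zero]
  rw [← this]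
  exact w.trace_E_mul _ _ _ fun a b => w.comm_path g a b _ _

/-- All starting points contribute equally by `trace_path_shift`, and so do all the blocks `E c c`
of the single path from `0`. Replacing each starting point by `0` lets the blocks sum to the
identity. -/
theorem trace_step_pow_order {m : ℕ} (h : m • g = 0) (hm : 0 < m)
    (hg : ∀ c, ∃ k : ℕ, c = k • g) : (w.step g ^ m).trace = (w.path g 0 m).trace := by
  have key : ∀ k : ℕ, (w.E (k • g) (k • g) * w.path g (k • g) m).trace =
      (w.E 0 0 * w.path g 0 m).trace := by
    intro k
    induction k with
    | zero => simp
    | succ k ih => rw [succ_nsmul, ← w.trace_path_shift g _ h hm, ih]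
  rw [step_pow, trace_sum, ← one_mul (w.path g 0 m), ← w.sum_E, Finset.sum_mul, trace_sum]
  refine Finset.sum_congr rfl fun c _ => ?_
  rw [h, add_zero]
  obtain ⟨k, rfl⟩ := hg c
  rw [key, w.trace_E_mul 0 (k • g) _ fun a b => w.comm_path g a b _ _]

end Walk

/-- `W` commutes with `Wᴴ`, and `W ^ j * Wᴴ ^ (2R - j)` is `W ^ (2j - 2R)` or, for `j < R`, the
adjoint of `W ^ (2R - 2j)`. By `h0` only `j = 0`, `j = R` and `j = 2R` have a trace that need not
vanish. -/
theorem trace_add_star_pow {W : Matrix N N ℂ} (hW : Wᴴ * W = 1) {R : ℕ} (hR : 0 < R)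
    (h0 : ∀ m, 0 < m → m < 2 * R → (W ^ m).trace = 0) :
    ((W + Wᴴ) ^ (2 * R)).trace =
      R.centralBinom * Fintype.card N + 2 * ((W ^ (2 * R)).trace.re : ℂ) := by
  have hW' : W * Wᴴ = 1 := mul_eq_one_comm.1 hW
  have hc : Commute W Wᴴ := by rw [Commute, SemiconjBy, hW, hW']
  have hpow : ∀ a b, W ^ (a + b) * Wᴴ ^ b = W ^ a := by
    intro a b
    rw [pow_add, mul_assoc, ← hc.mul_pow, hW', one_pow, mul_one]
  have hpow' : ∀ a b, W ^ b * Wᴴ ^ (b + a) = (W ^ a)ᴴ := by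
    intro a b
    rw [pow_add, ← mul_assoc, ← hc.mul_pow, hW', one_pow, one_mul, conjTranspose_pow]
  rw [hc.add_pow, trace_sum]
  have hsub : ({0, R, 2 * R} : Finset ℕ) ⊆ Finset.range (2 * R + 1) := by
    intro j hj
    simp only [Finset.mem_insert, Finset.mem_singleton] at hj
    rw [Finset.mem_range]
    omega
  rw [← Finset.sum_subset hsub]
  · rw [Finset.sum_insert, Finset.sum_insert, Finset.sum_singleton]
    · have e1 : W ^ R * Wᴴ ^ (2 * R - R) = 1 := by
        rw [show 2 * R - R = R by omega]
        simpa using hpow 0 R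
      simp only [e1, pow_zero, one_mul, Nat.sub_zero, Nat.choose_zero_right, Nat.cast_one, mul_one,
        Nat.choose_self, Nat.sub_self]
      rw [← conjTranspose_pow, trace_conjTranspose, ← Nat.centralBinom_eq_two_mul_choose]
      have e2 : (R.centralBinom : Matrix N N ℂ).trace = R.centralBinom * Fintype.card N := by
        rw [← nsmul_one, trace_smul, trace_one, nsmul_eq_mul]
      rw [e2]
      have e3 := Complex.add_conj (W ^ (2 * R)).trace
      rw [show star (W ^ (2 * R)).trace = (starRingEnd ℂ) (W ^ (2 * R)).trace from rfl]
      push_cast at e3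
      linear_combination e3
    · simp; omega
    · simp; omega
  · intro j hj hj'
    simp only [Finset.mem_insert, Finset.mem_singleton, Finset.mem_range, not_or] at hj hj'
    rw [← nsmul_eq_mul', trace_smul]
    rcases Nat.lt_or_ge j R with h | h
    · have : 2 * R - j = j + (2 * R - 2 * j) := by omega
      rw [this, hpow', trace_conjTranspose, h0 _ (by omega) (by omega)]
      simp
    · have : W ^ j * Wᴴ ^ (2 * R - j) = W ^ (2 * j - 2 * R) := by
        rw [← hpow (2 * j - 2 * R) (2 * R - j)]
        congr 2
        omega
      rw [this, h0 _ (by omega) (by omega)]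
      simp

end CyclicShift

section

open Matrix

/-! ### Operators that act on some of the qubits -/

theorem embed_apply {k n : ℕ} (e : Fin k ↪ Fin n) (B : QOp k) (x y : Basis n) :
    embed e B x y =
      open Classical in if ∀ i, i ∉ Set.range e → x i = y i then B (x ∘ e) (y ∘ e) else 0 := rfl

theorem embed_add {k n : ℕ} (e : Fin k ↪ Fin n) (A B : QOp k) :
    embed e (A + B) = embed e A + embed e B := by
  ext x y
  simp only [embed_apply, Matrix.add_apply]
  split_ifs <;> simp

theorem embed_smul {k n : ℕ} (e : Fin k ↪ Fin n) (z : ℂ) (B : QOp k) :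
    embed e (z • B) = z • embed e B := by
  ext x y
  simp only [embed_apply, Matrix.smul_apply]
  split_ifs <;> simp

theorem embed_sum {ι : Type} {k n : ℕ} (e : Fin k ↪ Fin n) (s : Finset ι) (B : ι → QOp k) :
    embed e (∑ i ∈ s, B i) = ∑ i ∈ s, embed e (B i) := by
  ext x y
  simp only [embed_apply, Matrix.sum_apply]
  split_ifs <;> simp

theorem embed_one {k n : ℕ} (e : Fin k ↪ Fin n) : embed e (1 : QOp k) = 1 := by
  ext x y
  simp only [embed_apply, Matrix.one_apply]
  by_cases h : x = y
  · subst h; simp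
  · rw [if_neg h]
    split_ifs with h1 h2
    · refine absurd (funext fun i => ?_) h
      by_cases hi : i ∈ Set.range e
      · obtain ⟨j, rfl⟩ := hi
        exact congrFun h2 j
      · exact h1 i hi
    · rfl
    · rfl

theorem embed_zero {k n : ℕ} (e : Fin k ↪ Fin n) : embed e (0 : QOp k) = 0 := by
  ext x y
  simp [embed_apply]

theorem embed_conjTranspose {k n : ℕ} (e : Fin k ↪ Fin n) (B : QOp k) :
    embed e Bᴴ = (embed e B)ᴴ := by
  ext x y
  simp only [embed_apply, Matrix.conjTranspose_apply]
  by_cases h : ∀ i, i ∉ Set.range e → x i = y i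
  · rw [if_pos h, if_pos fun i hi => (h i hi).symm]
  · rw [if_neg h, if_neg fun h' => h fun i hi => (h' i hi).symm, star_zero]

/-- An intermediate basis state contributes only if it agrees with `x` off the range of `e`. These
states are the `Function.extend e u x`, one for each state `u` of the `k` qubits. -/
theorem embed_mul {k n : ℕ} (e : Fin k ↪ Fin n) (A B : QOp k) :
    embed e (A * B) = embed e A * embed e B := by
  classical
  ext x y
  rw [Matrix.mul_apply, embed_apply]
  have hcomp : ∀ u : Basis k, Function.extend e u x ∘ e = u := fun u =>
    Function.extend_comp e.injective u x
  have hinj : Function.Injective fun u : Basis k => Function.extend e u x := by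
    intro u v h
    rw [← hcomp u, ← hcomp v]
    simp only at h
    rw [h]
  rw [← Fintype.sum_of_injective (fun u : Basis k => Function.extend e u x) hinj
    (fun u => embed e A x (Function.extend e u x) * embed e B (Function.extend e u x) y)]
  · have h1 : ∀ u : Basis k, embed e A x (Function.extend e u x) = A (x ∘ e) u := by
      intro u
      rw [embed_apply, if_pos, hcomp]
      intro i hi
      rw [Function.extend_apply' _ _ _ hi]
    have h2 : ∀ u : Basis k, embed e B (Function.extend e u x) y =
        if ∀ i, i ∉ Set.range e → x i = y i then B u (y ∘ e) else 0 := by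
      intro u
      rw [embed_apply, hcomp]
      refine if_congr (forall₂_congr fun i hi => ?_) rfl rfl
      rw [Function.extend_apply' _ _ _ hi]
    simp only [h1, h2]
    split_ifs
    · rw [Matrix.mul_apply]
    · simp
  · intro z hz
    rw [embed_apply, if_neg, zero_mul]
    intro h
    refine hz ⟨z ∘ e, funext fun i => ?_⟩
    by_cases hi : i ∈ Set.range e
    · obtain ⟨j, rfl⟩ := hi
      exact e.injective.extend_apply _ _ j
    · exact (Function.extend_apply' _ _ _ hi).trans (h i hi)
  · intro u; rfl

theorem embed_trans {a k n : ℕ} (f : Fin a ↪ Fin k) (e : Fin k ↪ Fin n) (B : QOp a) :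
    embed (f.trans e) B = embed e (embed f B) := by
  ext x y
  simp only [embed_apply]
  by_cases h : ∀ i, i ∉ Set.range e → x i = y i
  · rw [if_pos h]
    refine if_congr ⟨fun h' j hj => h' (e j) ?_, fun h' i hi => ?_⟩ rfl rfl
    · rintro ⟨l, hl⟩
      exact hj ⟨l, e.injective hl⟩
    · by_cases hi' : i ∈ Set.range e
      · obtain ⟨j, rfl⟩ := hi'
        refine h' j ?_
        rintro ⟨l, rfl⟩
        exact hi ⟨l, rfl⟩
      · exact h i hi'
  · rw [if_neg h, if_neg]
    intro h'
    refine h fun i hi => h' i ?_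
    rintro ⟨l, rfl⟩
    exact hi ⟨f l, rfl⟩

/-- A single intermediate state contributes: that of `y` on the qubits of `f`, and that of `x`
elsewhere. -/
theorem embed_mul_embed_apply {a b n : ℕ} (f : Fin a ↪ Fin n) (g : Fin b ↪ Fin n)
    (hfg : Disjoint (Set.range f) (Set.range g)) (A : QOp a) (B : QOp b) (x y : Basis n) :
    (embed f A * embed g B) x y =
      open Classical in if ∀ i, i ∉ Set.range f → i ∉ Set.range g → x i = y i then
        A (x ∘ f) (y ∘ f) * B (x ∘ g) (y ∘ g) else 0 := by
  classical
  rw [Matrix.mul_apply, Finset.sum_eq_single fun i => if i ∈ Set.range f then y i else x i]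
  · rw [embed_apply, embed_apply, if_pos]
    · have h1 : (fun i => if i ∈ Set.range f then y i else x i) ∘ f = y ∘ f := by
        funext i; simp
      have h2 : (fun i => if i ∈ Set.range f then y i else x i) ∘ g = x ∘ g := by
        funext i
        have : g i ∉ Set.range f := fun h => Set.disjoint_left.1 hfg h ⟨i, rfl⟩
        rw [Function.comp_apply, if_neg this]
        rfl
      rw [h1, h2]
      by_cases h : ∀ i, i ∉ Set.range f → i ∉ Set.range g → x i = y i
      · rw [if_pos h, if_pos]
        intro i hi
        split_ifs with hi'
        · rfl
        · exact h i hi' hi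
      · rw [if_neg h, if_neg, mul_zero]
        intro h'
        refine h fun i hi hi' => ?_
        simpa [hi] using h' i hi'
    · intro i hi
      rw [if_neg hi]
  · intro z _ hz
    rw [embed_apply, embed_apply]
    split_ifs with h1 h2
    · refine absurd (funext fun i => ?_) hz
      by_cases hi : i ∈ Set.range f
      · rw [if_pos hi]
        exact h2 i fun h => Set.disjoint_left.1 hfg hi h
      · rw [if_neg hi]
        exact (h1 i hi).symm
    all_goals simp
  · simp

theorem embed_comm {a b n : ℕ} (f : Fin a ↪ Fin n) (g : Fin b ↪ Fin n)
    (hfg : Disjoint (Set.range f) (Set.range g)) (A : QOp a) (B : QOp b) :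
    embed f A * embed g B = embed g B * embed f A := by
  ext x y
  rw [embed_mul_embed_apply f g hfg, embed_mul_embed_apply g f hfg.symm]
  exact if_congr ⟨fun h i hi hi' => h i hi' hi, fun h i hi hi' => h i hi' hi⟩ (mul_comm _ _) rfl

/-- The tensor product of operators on two groups of qubits. -/
def tensor {a b : ℕ} (A : QOp a) (B : QOp b) : QOp (a + b) := fun x y =>
  A (x ∘ Fin.castAdd b) (y ∘ Fin.castAdd b) * B (x ∘ Fin.natAdd a) (y ∘ Fin.natAdd a)

theorem embed_tensor {a b n : ℕ} (e : Fin (a + b) ↪ Fin n) (A : QOp a) (B : QOp b) :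
    embed e (tensor A B) =
      embed ((Fin.castAddEmb b).trans e) A * embed ((Fin.natAddEmb a).trans e) B := by
  rw [embed_trans, embed_trans, ← embed_mul]
  congr 1
  ext x y
  rw [embed_mul_embed_apply, if_pos]
  · rfl
  · intro i h1 h2
    refine Fin.addCases (fun j h1 _ => ?_) (fun j _ h2 => ?_) i h1 h2
    · exact absurd ⟨j, rfl⟩ h1
    · exact absurd ⟨j, rfl⟩ h2
  · rw [Set.disjoint_left]
    rintro _ ⟨i, rfl⟩ ⟨j, h⟩
    have := congrArg Fin.val h
    simp at this
    omega

/-- A diagonal entry of `embed e B` depends only on the state of the `k` qubits, so every diagonal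
entry of `B` is repeated once for each state of the others. Idle qubits therefore do not affect
normalised traces. -/
theorem trace_embed {k n : ℕ} (e : Fin k ↪ Fin n) (B : QOp k) :
    (embed e B).trace / 2 ^ n = B.trace / 2 ^ k := by
  classical
  let p : Fin n → Prop := fun i => i ∈ Set.range e
  let φ : Basis n ≃ Basis k × ({i // ¬ p i} → Fin 2) :=
    (Equiv.piEquivPiSubtypeProd p fun _ => Fin 2).trans
      (Equiv.prodCongr (Equiv.arrowCongr (Equiv.ofInjective e e.injective).symm (Equiv.refl _))
        (Equiv.refl _))
  have hφ : ∀ x, (φ x).1 = x ∘ e := fun x => rfl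
  have h1 : (embed e B).trace = ∑ x : Basis n, B (φ x).1 (φ x).1 := by
    refine Finset.sum_congr rfl fun x _ => ?_
    rw [Matrix.diag_apply, embed_apply, if_pos fun _ _ => rfl, hφ]
  have hcard : (2 : ℂ) ^ n = 2 ^ k * Fintype.card ({i // ¬ p i} → Fin 2) := by
    have := Fintype.card_congr φ
    rw [Fintype.card_prod, Fintype.card_fun, Fintype.card_fun, Fintype.card_fin, Fintype.card_fin,
      Fintype.card_fin] at this
    exact_mod_cast this
  rw [h1, Equiv.sum_comp φ (fun z => B z.1 z.1), Fintype.sum_prod_type, hcard]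
  simp only [Finset.sum_const, Finset.card_univ, nsmul_eq_mul]
  rw [← Finset.mul_sum, mul_comm (2 ^ k : ℂ), mul_div_mul_left]
  · rfl
  · exact_mod_cast Fintype.card_ne_zero

/-! ### The operator norm -/

section opNorm

variable {n : ℕ}

theorem opNorm_add_le (A B : QOp n) : opNorm (A + B) ≤ opNorm A + opNorm B := by
  unfold opNorm
  rw [map_add]
  exact norm_add_le _ _

theorem opNorm_mul_le (A B : QOp n) : opNorm (A * B) ≤ opNorm A * opNorm B := by
  unfold opNorm
  rw [map_mul]
  exact norm_mul_le _ _

theorem opNorm_nonneg (A : QOp n) : 0 ≤ opNorm A := norm_nonneg _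

theorem opNorm_conjTranspose (A : QOp n) : opNorm Aᴴ = opNorm A := by
  unfold opNorm
  rw [← Matrix.star_eq_conjTranspose, map_star]
  exact norm_star (Matrix.toEuclideanCLM (n := Basis n) (𝕜 := ℂ) A)

theorem opNorm_conjTranspose_mul_self (A : QOp n) : opNorm (Aᴴ * A) = opNorm A * opNorm A := by
  unfold opNorm
  rw [← Matrix.star_eq_conjTranspose, map_mul, map_star]
  exact CStarRing.norm_star_mul_self (x := Matrix.toEuclideanCLM (n := Basis n) (𝕜 := ℂ) A)

/-- By the C⋆-identity the norm of the projection `Aᴴ * A` is its own square, hence at most one.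
This covers both unitaries and matrix units. -/
theorem opNorm_le_one_of_proj {A : QOp n} (h : (Aᴴ * A) * (Aᴴ * A) = Aᴴ * A) :
    opNorm A ≤ 1 := by
  have hP : opNorm (Aᴴ * A) * opNorm (Aᴴ * A) = opNorm (Aᴴ * A) := by
    rw [← opNorm_conjTranspose_mul_self, Matrix.conjTranspose_mul, Matrix.conjTranspose_conjTranspose,
      h]
  have h1 : opNorm (Aᴴ * A) ≤ 1 := by
    by_contra hlt
    nlinarith
  rw [opNorm_conjTranspose_mul_self] at h1
  nlinarith [opNorm_nonneg A]

theorem opNorm_le_one_of_unitary {A : QOp n} (h : Aᴴ * A = 1) : opNorm A ≤ 1 :=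
  opNorm_le_one_of_proj (by rw [h, one_mul])

end opNorm

/-- The even power removes the absolute value, since `|A| ^ 2 = Aᴴ * A = A ^ 2`. -/
theorem normalizedAbsPowTrace_of_isHermitian {n : ℕ} {A : QOp n} (hA : Aᴴ = A) (R : ℕ) :
    normalizedAbsPowTrace A (2 * R) = ((A ^ (2 * R)).trace).re / 2 ^ n := by
  unfold normalizedAbsPowTrace
  congr 3
  rw [pow_mul, pow_mul, pow_two, pow_two]
  open scoped MatrixOrder in
  rw [CFC.abs_mul_abs, Matrix.star_eq_conjTranspose, hA]

/-! ### A clock that runs forwards through a circuit and then backwards -/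

/-- Matrix units `K` of a clock with `R` positions and `D` of a direction qubit, unitaries `G` for
the steps of the clock and a reflection `Z` for its two ends. -/
structure ClockSystem (N : Type) [Fintype N] [DecidableEq N] (R : ℕ) where
  K : ℕ → ℕ → Matrix N N ℂ
  D : Fin 2 → Fin 2 → Matrix N N ℂ
  G : ℕ → Matrix N N ℂ
  Z : Matrix N N ℂ
  mul_K : ∀ a b c d, b < R → K a b * K c d = if b = c then K a d else 0
  sum_K : ∑ a ∈ Finset.range R, K a a = 1
  star_K : ∀ a b, (K a b)ᴴ = K b a
  mul_D : ∀ a b c d, D a b * D c d = if b = c then D a d else 0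
  sum_D : D 0 0 + D 1 1 = 1
  star_D : ∀ a b, (D a b)ᴴ = D b a
  K_comm_D : ∀ a b c d, K a b * D c d = D c d * K a b
  K_comm_G : ∀ a b t, K a b * G t = G t * K a b
  D_comm_G : ∀ a b t, D a b * G t = G t * D a b
  K_comm_Z : ∀ a b, K a b * Z = Z * K a b
  D_comm_Z : ∀ a b, D a b * Z = Z * D a b
  star_mul_G : ∀ t, (G t)ᴴ * G t = 1
  star_Z : Zᴴ = Z
  Z_mul_Z : Z * Z = 1

theorem sum_zmod_val {M : ℕ} [NeZero M] {β : Type} [AddCommMonoid β] (f : ℕ → β) :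
    ∑ c : ZMod M, f c.val = ∑ i ∈ Finset.range M, f i := by
  cases M with
  | zero => exact absurd rfl (NeZero.ne 0)
  | succ m => exact Fin.sum_univ_eq_sum_range f (m + 1)

namespace ClockSystem

variable {N : Type} [Fintype N] [DecidableEq N] {R : ℕ} (C : ClockSystem N R)

theorem K_comm_star_G (a b t : ℕ) : C.K a b * (C.G t)ᴴ = (C.G t)ᴴ * C.K a b := by
  have := congrArg conjTranspose (C.K_comm_G b a t)
  simpa [conjTranspose_mul, C.star_K] using this.symm

theorem D_comm_star_G (a b : Fin 2) (t : ℕ) : C.D a b * (C.G t)ᴴ = (C.G t)ᴴ * C.D a b := by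
  have := congrArg conjTranspose (C.D_comm_G b a t)
  simpa [conjTranspose_mul, C.star_D] using this.symm

theorem mul_star_G (t : ℕ) : C.G t * (C.G t)ᴴ = 1 := mul_eq_one_comm.1 (C.star_mul_G t)

/-- The Hamiltonian of the clock. -/
def ham : Matrix N N ℂ :=
  ∑ t ∈ Finset.range (R - 1), (C.K (t + 1) t * C.G t + C.K t (t + 1) * (C.G t)ᴴ) +
    (C.K 0 0 + C.K (R - 1) (R - 1)) * ((C.D 1 0 + C.D 0 1) * C.Z)

/-- The product of the first `t` unitaries. -/
def prefixProd : ℕ → Matrix N N ℂ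
  | 0 => 1
  | t + 1 => C.G t * prefixProd t

theorem star_prefixProd_mul (t : ℕ) : (C.prefixProd t)ᴴ * C.prefixProd t = 1 := by
  induction t with
  | zero => simp [prefixProd]
  | succ t ih =>
    rw [prefixProd, conjTranspose_mul, mul_assoc, ← mul_assoc _ (C.G t), C.star_mul_G, one_mul, ih]

theorem prefixProd_mul_star (t : ℕ) : C.prefixProd t * (C.prefixProd t)ᴴ = 1 :=
  mul_eq_one_comm.1 (C.star_prefixProd_mul t)

/-- The position of the clock after `v` steps of a round trip. -/
def clockPos (R v : ℕ) : ℕ := if v < R then v else 2 * R - 1 - v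

/-- The direction of the clock after `v` steps of a round trip. -/
def dirPos (R v : ℕ) : Fin 2 := if v < R then 0 else 1

/-- The unitary of step `v` of a round trip. -/
def roundStep (v : ℕ) : Matrix N N ℂ :=
  if v < R - 1 then C.G v else if v = R - 1 ∨ v = 2 * R - 1 then C.Z else (C.G (2 * R - 2 - v))ᴴ

theorem K_comm_roundStep (a b v : ℕ) : C.K a b * C.roundStep v = C.roundStep v * C.K a b := by
  unfold roundStep
  split_ifs
  · exact C.K_comm_G _ _ _
  · exact C.K_comm_Z _ _
  · exact C.K_comm_star_G _ _ _

theorem D_comm_roundStep (a b : Fin 2) (v : ℕ) :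
    C.D a b * C.roundStep v = C.roundStep v * C.D a b := by
  unfold roundStep
  split_ifs
  · exact C.D_comm_G _ _ _
  · exact C.D_comm_Z _ _
  · exact C.D_comm_star_G _ _ _

/-- The pairs of a position and a direction are numbered by the steps of the round trip: positions
ascend with direction `0` and descend with direction `1`. -/
def unit (a b : ℕ) : Matrix N N ℂ :=
  C.K (clockPos R a) (clockPos R b) * C.D (dirPos R a) (dirPos R b)

theorem sum_range_two_mul {β : Type} [AddCommMonoid β] (f : ℕ → β) :
    ∑ v ∈ Finset.range (2 * R), f v =
      ∑ v ∈ Finset.range R, f v + ∑ v ∈ Finset.range R, f (2 * R - 1 - v) := by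
  rw [two_mul, Finset.sum_range_add, ← Finset.sum_range_reflect (fun v => f (R + v))]
  congr 1
  refine Finset.sum_congr rfl fun v hv => ?_
  rw [Finset.mem_range] at hv
  congr 1
  omega

theorem val_one_eq (hR : 2 ≤ R) : (1 : ZMod (2 * R)).val = 1 := by
  have : Fact (1 < 2 * R) := ⟨by omega⟩
  exact ZMod.val_one _

variable [NeZero R]

instance : NeZero (2 * R) := ⟨Nat.mul_ne_zero two_ne_zero (NeZero.ne R)⟩

/-- The round trip of the clock as a walk around a cycle of length `2 * R`. -/
def walk : CyclicShift.Walk N (ZMod (2 * R)) where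
  E a b := C.unit a.val b.val
  V c := C.roundStep c.val
  mul_E a b c d := by
    have hb := ZMod.val_lt b
    have hc := ZMod.val_lt c
    have h1 : clockPos R b.val < R := by unfold clockPos; split_ifs <;> omega
    simp only [unit]
    rw [mul_assoc, ← mul_assoc (C.D _ _), ← C.K_comm_D, mul_assoc, ← mul_assoc, C.mul_D,
      C.mul_K _ _ _ _ h1]
    by_cases h : b = c
    · subst h; simp
    · rw [if_neg h]
      have h2 : b.val ≠ c.val := fun h' => h (ZMod.val_injective _ h')
      split_ifs with h3 h4
      -- Position and direction together determine the number of the step.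
      · exfalso
        unfold clockPos at h3
        unfold dirPos at h4
        split_ifs at h3 h4 <;> omega
      all_goals simp
  sum_E := by
    rw [sum_zmod_val (fun v => C.unit v v), sum_range_two_mul]
    have h1 : ∀ v ∈ Finset.range R, C.unit v v = C.K v v * C.D 0 0 := by
      intro v hv
      rw [Finset.mem_range] at hv
      simp [unit, clockPos, dirPos, hv]
    have h2 : ∀ v ∈ Finset.range R, C.unit (2 * R - 1 - v) (2 * R - 1 - v) =
        C.K v v * C.D 1 1 := by
      intro v hv
      rw [Finset.mem_range] at hv
      have h3 : ¬ 2 * R - 1 - v < R := by omega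
      have h4 : 2 * R - 1 - (2 * R - 1 - v) = v := by omega
      simp [unit, clockPos, dirPos, h3, h4]
    rw [Finset.sum_congr rfl h1, Finset.sum_congr rfl h2, ← Finset.sum_mul, ← Finset.sum_mul,
      C.sum_K, one_mul, one_mul, C.sum_D]
  star_E a b := by
    rw [unit, conjTranspose_mul, C.star_K, C.star_D, ← C.K_comm_D]; rfl
  comm a b c := by
    rw [unit, mul_assoc, C.D_comm_roundStep, ← mul_assoc, C.K_comm_roundStep, mul_assoc]
  star_mul_V c := by
    unfold roundStep
    split_ifs
    · exact C.star_mul_G _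
    · rw [C.star_Z, C.Z_mul_Z]
    · rw [conjTranspose_conjTranspose, C.mul_star_G]

theorem step_eq (hR : 2 ≤ R) : C.walk.step 1 =
    ∑ t ∈ Finset.range (R - 1), (C.K (t + 1) t * C.D 0 0 * C.G t +
      C.K t (t + 1) * C.D 1 1 * (C.G t)ᴴ) +
      (C.K (R - 1) (R - 1) * C.D 1 0 * C.Z + C.K 0 0 * C.D 0 1 * C.Z) := by
  have h0 : C.walk.step 1 = ∑ v ∈ Finset.range (2 * R),
      C.unit ((v + 1) % (2 * R)) v * C.roundStep v := by
    rw [← sum_zmod_val (M := 2 * R)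
      (fun v => C.unit ((v + 1) % (2 * R)) v * C.roundStep v)]
    refine Finset.sum_congr rfl fun c _ => ?_
    simp only [walk]
    rw [ZMod.val_add, val_one_eq hR]
  rw [h0, sum_range_two_mul]
  obtain ⟨r, rfl⟩ : ∃ r, R = r + 1 := ⟨R - 1, by omega⟩
  -- The two turns are split off: `v = R - 1` is the last term of the first half, and `v = 2 * R -
  -- 1` is the term of index `0` in the reflected second half.
  rw [Finset.sum_range_succ, Finset.sum_range_succ', Finset.sum_add_distrib]
  simp only [Nat.add_sub_cancel]
  have h1 : ∀ v ∈ Finset.range r, C.unit ((v + 1) % (2 * (r + 1))) v * C.roundStep v =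
      C.K (v + 1) v * C.D 0 0 * C.G v := by
    intro v hv
    rw [Finset.mem_range] at hv
    rw [Nat.mod_eq_of_lt (by omega)]
    simp [unit, clockPos, dirPos, roundStep, hv, show v < r + 1 by omega]
  have h2 : ∀ v ∈ Finset.range r,
      C.unit ((2 * (r + 1) - 1 - (v + 1) + 1) % (2 * (r + 1))) (2 * (r + 1) - 1 - (v + 1)) *
        C.roundStep (2 * (r + 1) - 1 - (v + 1)) = C.K v (v + 1) * C.D 1 1 * (C.G v)ᴴ := by
    intro v hv
    rw [Finset.mem_range] at hv
    rw [Nat.mod_eq_of_lt (by omega)]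
    have e1 : ¬ 2 * (r + 1) - 1 - (v + 1) + 1 < r + 1 := by omega
    have e2 : ¬ 2 * (r + 1) - 1 - (v + 1) < r + 1 := by omega
    have e3 : ¬ 2 * (r + 1) - 1 - (v + 1) < r := by omega
    have e4 : 2 * (r + 1) - 1 - (2 * (r + 1) - 1 - (v + 1) + 1) = v := by omega
    have e5 : 2 * (r + 1) - 1 - (2 * (r + 1) - 1 - (v + 1)) = v + 1 := by omega
    have e6 : 2 * (r + 1) - 2 - (2 * (r + 1) - 1 - (v + 1)) = v := by omega
    have e7 : ¬ (2 * (r + 1) - 1 - (v + 1) = r ∨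
      2 * (r + 1) - 1 - (v + 1) = 2 * (r + 1) - 1) := by omega
    simp only [unit, clockPos, dirPos, roundStep, Nat.add_sub_cancel, if_neg e1, if_neg e2,
      if_neg e3, e4, e5, e6, if_neg e7]
  have h3 : C.unit ((r + 1) % (2 * (r + 1))) r * C.roundStep r = C.K r r * C.D 1 0 * C.Z := by
    rw [Nat.mod_eq_of_lt (by omega)]
    have e4 : 2 * (r + 1) - 1 - (r + 1) = r := by omega
    simp [unit, clockPos, dirPos, roundStep, e4]
  have h4 : C.unit ((2 * (r + 1) - 1 - 0 + 1) % (2 * (r + 1))) (2 * (r + 1) - 1 - 0) *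
      C.roundStep (2 * (r + 1) - 1 - 0) = C.K 0 0 * C.D 0 1 * C.Z := by
    rw [show 2 * (r + 1) - 1 - 0 + 1 = 2 * (r + 1) by omega, Nat.mod_self]
    have e1 : ¬ 2 * (r + 1) - 1 < r + 1 := by omega
    have e2 : ¬ 2 * (r + 1) - 1 < r := by omega
    simp [unit, clockPos, dirPos, roundStep, e1, e2]
  rw [Finset.sum_congr rfl h1, Finset.sum_congr rfl h2, h3, h4]
  abel

/-- The forward part of the step has the direction factor `D 0 0`. The adjoint of its backward part
has the same clock and gate factors with `D 1 1`. As `D 0 0 + D 1 1 = 1`, the direction qubit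
disappears from all terms except those at the two ends. -/
theorem ham_eq (hR : 2 ≤ R) : C.ham = C.walk.step 1 + (C.walk.step 1)ᴴ := by
  have hs : ∀ (X Y W : Matrix N N ℂ), X * Y = Y * X → X * W = W * X → Y * W = W * Y →
      W * (Y * X) = X * Y * W := by
    intro X Y W h1 h2 h3
    rw [← mul_assoc, ← h3, mul_assoc, ← h2, ← mul_assoc, h1]
  rw [step_eq C hR, conjTranspose_add, conjTranspose_sum, conjTranspose_add]
  simp only [conjTranspose_add, conjTranspose_mul, C.star_K, C.star_D, C.star_Z,
    conjTranspose_conjTranspose]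
  rw [hs _ _ _ (C.K_comm_D _ _ _ _) (C.K_comm_Z _ _) (C.D_comm_Z _ _),
    hs _ _ _ (C.K_comm_D _ _ _ _) (C.K_comm_Z _ _) (C.D_comm_Z _ _)]
  simp only [hs _ _ _ (C.K_comm_D _ _ _ _) (C.K_comm_G _ _ _) (C.D_comm_G _ _ _),
    hs _ _ _ (C.K_comm_D _ _ _ _) (C.K_comm_star_G _ _ _) (C.D_comm_star_G _ _ _)]
  rw [ham, add_add_add_comm, ← Finset.sum_add_distrib]
  congr 1
  · refine Finset.sum_congr rfl fun t _ => ?_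
    rw [← mul_one (C.K (t + 1) t * C.G t), ← mul_one (C.K t (t + 1) * (C.G t)ᴴ)]
    have e1 : C.K (t + 1) t * C.G t * 1 = C.K (t + 1) t * (C.D 0 0 + C.D 1 1) * C.G t := by
      rw [C.sum_D, mul_one, mul_one]
    have e2 : C.K t (t + 1) * (C.G t)ᴴ * 1 = C.K t (t + 1) * (C.D 0 0 + C.D 1 1) * (C.G t)ᴴ := by
      rw [C.sum_D, mul_one, mul_one]
    rw [e1, e2]
    noncomm_ring
  · noncomm_ring

theorem path_eq_of_lt {m : ℕ} (hm : m ≤ R - 1) :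
    C.walk.path 1 0 m = C.prefixProd m := by
  induction m with
  | zero => rfl
  | succ m ih =>
    rw [CyclicShift.Walk.path, ih (by omega), prefixProd]
    congr 1
    have : (0 + m • 1 : ZMod (2 * R)).val = m := by
      rw [zero_add, nsmul_one, ZMod.val_cast_of_lt (by omega)]
    simp only [walk, this, roundStep]
    rw [if_pos (by omega)]

/-- On the way back each step peels one gate off: `(G t)ᴴ` cancels the last factor of the remaining
`prefixProd`. The factor `(prefixProd (R - 1))ᴴ` keeps the intermediate products in closed form; it
cancels at `j = 0` and is all that is left at `j = R - 1`. -/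
theorem path_back {j : ℕ} (hj : j ≤ R - 1) :
    C.walk.path 1 0 (R + j) = C.prefixProd (R - 1 - j) * (C.prefixProd (R - 1))ᴴ *
      (C.Z * C.prefixProd (R - 1)) := by
  have hR : 0 < R := Nat.pos_of_ne_zero (NeZero.ne R)
  have hval : ∀ m, m < 2 * R → (0 + m • 1 : ZMod (2 * R)).val = m := fun m hm => by
    rw [zero_add, nsmul_one, ZMod.val_cast_of_lt hm]
  induction j with
  | zero =>
    obtain ⟨r, hr⟩ : ∃ r, R = r + 1 := ⟨R - 1, by omega⟩
    have h1 : R + 0 = (R - 1) + 1 := by omega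
    rw [h1, CyclicShift.Walk.path, C.path_eq_of_lt le_rfl, Nat.sub_zero, C.prefixProd_mul_star,
      one_mul]
    congr 1
    simp only [walk, hval _ (show R - 1 < 2 * R by omega), roundStep]
    simp
  | succ j ih =>
    rw [← add_assoc, CyclicShift.Walk.path, ih (by omega)]
    have h1 : R - 1 - j = (R - 1 - (j + 1)) + 1 := by omega
    have h2 : (C.walk.V (0 + (R + j) • 1)) = (C.G (R - 1 - (j + 1)))ᴴ := by
      simp only [walk, hval _ (show R + j < 2 * R by omega), roundStep]
      rw [if_neg (by omega), if_neg (by omega)]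
      congr 2
      omega
    rw [h1, prefixProd, h2, mul_assoc, mul_assoc, ← mul_assoc _ (C.G _), C.star_mul_G, one_mul,
      ← mul_assoc]

theorem path_round : C.walk.path 1 0 (2 * R) =
    C.Z * (C.prefixProd (R - 1))ᴴ * (C.Z * C.prefixProd (R - 1)) := by
  have hR : 0 < R := Nat.pos_of_ne_zero (NeZero.ne R)
  suffices H : ∀ m, m = R + (R - 1) + 1 → C.walk.path 1 0 m =
      C.Z * (C.prefixProd (R - 1))ᴴ * (C.Z * C.prefixProd (R - 1)) from H _ (by omega)
  rintro _ rfl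
  rw [CyclicShift.Walk.path, C.path_back le_rfl, Nat.sub_self]
  have : (0 + (R + (R - 1)) • 1 : ZMod (2 * R)).val = R + (R - 1) := by
    rw [zero_add, nsmul_one, ZMod.val_cast_of_lt (by omega)]
  have h2 : C.walk.V (0 + (R + (R - 1)) • 1) = C.Z := by
    simp only [walk, this, roundStep]
    rw [if_neg (by omega), if_pos (by omega)]
  rw [h2, prefixProd, one_mul, mul_assoc]

/-- The generator `1` of `ZMod (2 * R)` has order exactly `2 * R`, so shorter powers of the step
have trace zero, and the full turn is evaluated by `path_round`. -/
theorem trace_ham_pow (hR : 2 ≤ R) : (C.ham ^ (2 * R)).trace =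
    R.centralBinom * Fintype.card N +
      2 * ((C.Z * C.prefixProd (R - 1) * C.Z * (C.prefixProd (R - 1))ᴴ).trace.re : ℂ) := by
  rw [C.ham_eq hR, CyclicShift.trace_add_star_pow (C.walk.star_step_mul_step 1) (by omega),
    C.walk.trace_step_pow_order 1 _ (by omega), path_round, trace_mul_comm, ← mul_assoc]
  · intro c
    exact ⟨c.val, by rw [nsmul_one, ZMod.natCast_rightInverse]⟩
  · rw [nsmul_one, ZMod.natCast_self]
  · intro m h0 hm
    refine C.walk.trace_step_pow_of_ne 1 ?_
    rw [nsmul_one, Ne, ZMod.natCast_eq_zero_iff]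
    exact Nat.not_dvd_of_pos_of_lt h0 hm

end ClockSystem

/-! ### Gates with Gaussian rational entries -/

theorem inv_sqrt_two_mul_self : ((Real.sqrt 2 : ℝ) : ℂ)⁻¹ * ((Real.sqrt 2 : ℝ) : ℂ)⁻¹ = 1 / 2 := by
  rw [← mul_inv, ← Complex.ofReal_mul, Real.mul_self_sqrt (by norm_num)]
  norm_num

theorem sum_basis_one {β : Type} [AddCommMonoid β] (f : Basis 1 → β) :
    ∑ z : Basis 1, f z = f (fun _ => 0) + f (fun _ => 1) := by
  rw [← (Equiv.funUnique (Fin 1) (Fin 2)).symm.sum_comp, Fin.sum_univ_two]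
  rfl

theorem star_mul_self_of_perm {k : ℕ} (f : Basis k → Basis k) (A : QOp k)
    (hA : ∀ x y, A x y = if x = f y then 1 else 0) (hf : Function.Injective f) : Aᴴ * A = 1 := by
  ext x y
  rw [Matrix.mul_apply, Finset.sum_eq_single (f y)]
  · rw [conjTranspose_apply, hA, hA, if_pos rfl, Matrix.one_apply, mul_one]
    by_cases h : x = y
    · subst h; simp
    · rw [if_neg h, if_neg fun h' => h (hf h').symm, star_zero]
  · intro z _ hz
    rw [hA z y, if_neg hz, mul_zero]
  · simp

theorem basis_one_cases (x : Basis 1) : x = (fun _ => 0) ∨ x = fun _ => 1 := by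
  revert x; decide

theorem star_mul_self_of_hadamard (A : QOp 1)
    (hA : ∀ x y, A x y = ((Real.sqrt 2 : ℝ) : ℂ)⁻¹ * (-1) ^ ((x 0 : ℕ) * (y 0 : ℕ))) :
    Aᴴ * A = 1 := by
  have h01 : ((fun _ => 0 : Basis 1) = fun _ => 1) ↔ False := by simp [funext_iff]
  have h10 : ((fun _ => 1 : Basis 1) = fun _ => 0) ↔ False := by simp [funext_iff]
  ext x y
  rw [Matrix.mul_apply, sum_basis_one]
  rcases basis_one_cases x with rfl | rfl <;> rcases basis_one_cases y with rfl | rfl <;>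
    simp [hA, conjTranspose_apply, inv_sqrt_two_mul_self, Complex.conj_ofReal,
      h01, h10] <;> norm_num

theorem star_mul_self_of_phase (A : QOp 1)
    (hA : ∀ x y, A x y = if x = y then Complex.I ^ (x 0 : ℕ) else 0) : Aᴴ * A = 1 := by
  have h01 : ((fun _ => 0 : Basis 1) = fun _ => 1) ↔ False := by simp [funext_iff]
  have h10 : ((fun _ => 1 : Basis 1) = fun _ => 0) ↔ False := by simp [funext_iff]
  ext x y
  rw [Matrix.mul_apply, sum_basis_one]
  rcases basis_one_cases x with rfl | rfl <;> rcases basis_one_cases y with rfl | rfl <;>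
    simp [hA, conjTranspose_apply, h01, h10]

theorem GateKind.star_mul_op (g : GateKind) : g.opᴴ * g.op = 1 := by
  cases g with
  | hadamard => exact star_mul_self_of_hadamard _ fun x y => rfl
  | phase => exact star_mul_self_of_phase _ fun x y => rfl
  | cnot =>
    refine star_mul_self_of_perm (fun y : Basis 2 => ![y 0, y 1 + y 0]) _ (fun x y => rfl) ?_
    decide
  | toffoli =>
    refine star_mul_self_of_perm (fun y : Basis 3 => ![y 0, y 1, y 2 + y 0 * y 1]) _
      (fun x y => rfl) ?_
    decide

/-- A gate with Gaussian rational entries that agrees with the given one up to a phase. -/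
def GateKind.ratMat : (g : GateKind) → Matrix (Basis g.arity) (Basis g.arity) (ℚ × ℚ)
  | .hadamard => fun (x y : Basis 1) => if x 0 = 1 ∧ y 0 = 1 then (-1 / 2, -1 / 2) else (1 / 2, 1 / 2)
  | .phase => fun (x y : Basis 1) => if x = y then (if x 0 = 0 then (1, 0) else (0, 1)) else 0
  | .cnot => fun (x y : Basis 2) => if x = ![y 0, y 1 + y 0] then (1, 0) else 0
  | .toffoli => fun (x y : Basis 3) => if x = ![y 0, y 1, y 2 + y 0 * y 1] then (1, 0) else 0

/-- The phase by which the rational version of a gate differs from it. -/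
def GateKind.twist : GateKind → ℂ
  | .hadamard => ((Real.sqrt 2 : ℝ) : ℂ)⁻¹ * (1 + Complex.I)
  | _ => 1

theorem GateKind.star_mul_twist (g : GateKind) : star g.twist * g.twist = 1 := by
  cases g with
  | hadamard =>
    have hsq := inv_sqrt_two_mul_self
    simp only [twist, star_mul', star_inv₀, star_add, star_one, RCLike.star_def, Complex.conj_ofReal,
      Complex.conj_I]
    linear_combination (1 - Complex.I ^ 2) * hsq - 1 / 2 * Complex.I_sq
  | _ => simp [twist]

theorem gaussianRat_zero : gaussianRat 0 = 0 := by simp [gaussianRat]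

theorem gaussianRat_hadamard (x y : Basis 1) :
    gaussianRat (if x 0 = 1 ∧ y 0 = 1 then (-1 / 2, -1 / 2) else (1 / 2, 1 / 2)) =
      ((Real.sqrt 2 : ℝ) : ℂ)⁻¹ * (1 + Complex.I) *
        (((Real.sqrt 2 : ℝ) : ℂ)⁻¹ * (-1) ^ ((x 0 : ℕ) * (y 0 : ℕ))) := by
  have hsq := inv_sqrt_two_mul_self
  rcases basis_one_cases x with rfl | rfl <;> rcases basis_one_cases y with rfl | rfl <;>
    simp [gaussianRat] <;>
    first
    | linear_combination (-1 - Complex.I) * hsq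
    | linear_combination (1 + Complex.I) * hsq

theorem gaussianRat_phase (x y : Basis 1) :
    gaussianRat (if x = y then (if x 0 = 0 then (1, 0) else (0, 1)) else 0) =
      1 * if x = y then Complex.I ^ (x 0 : ℕ) else 0 := by
  split_ifs with h1 h2
  · simp [h2, gaussianRat]
  · have : x 0 = 1 := by
      have h : ∀ a : Fin 2, a ≠ 0 → a = 1 := by decide
      exact h _ h2
    simp [this, gaussianRat]
  · simp [gaussianRat_zero]

theorem gaussianRat_ite (p : Prop) [Decidable p] :
    gaussianRat (if p then (1, 0) else 0) = 1 * if p then 1 else 0 := by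
  split_ifs <;> simp [gaussianRat]

theorem gaussianRat_cnot (x y : Basis 2) :
    gaussianRat (if x = ![y 0, y 1 + y 0] then (1, 0) else 0) =
      1 * if x = ![y 0, y 1 + y 0] then 1 else 0 := gaussianRat_ite _

theorem gaussianRat_toffoli (x y : Basis 3) :
    gaussianRat (if x = ![y 0, y 1, y 2 + y 0 * y 1] then (1, 0) else 0) =
      1 * if x = ![y 0, y 1, y 2 + y 0 * y 1] then 1 else 0 := gaussianRat_ite _

/-- Only the Hadamard gate needs a phase: `(1 + i) / √2` turns its entries into `±(1 + i) / 2`. -/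
theorem GateKind.map_ratMat (g : GateKind) : g.ratMat.map gaussianRat = g.twist • g.op := by
  ext x y
  rw [Matrix.map_apply, Matrix.smul_apply, smul_eq_mul]
  cases g with
  | hadamard => exact gaussianRat_hadamard x y
  | phase => exact gaussianRat_phase x y
  | cnot => exact gaussianRat_cnot x y
  | toffoli => exact gaussianRat_toffoli x y

theorem GateKind.star_mul_ratMat (g : GateKind) :
    (g.ratMat.map gaussianRat)ᴴ * g.ratMat.map gaussianRat = 1 := by
  rw [map_ratMat, conjTranspose_smul, Matrix.smul_mul, Matrix.mul_smul, smul_smul, star_mul_op,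
    star_mul_twist, one_smul]

/-! ### The acceptance probability as a trace of reflections -/

/-- The Pauli matrix `Z`. -/
def pauliZ : QOp 1 := Matrix.diagonal fun x => if x 0 = 0 then 1 else -1

theorem pauliZ_conjTranspose : pauliZᴴ = pauliZ := by
  rw [pauliZ, diagonal_conjTranspose]
  congr 1
  funext x
  rw [Pi.star_apply]
  split_ifs <;> simp

theorem pauliZ_mul_self : pauliZ * pauliZ = 1 := by
  rw [pauliZ, diagonal_mul_diagonal, ← diagonal_one]
  congr 1
  funext x
  split_ifs <;> simp

/-- The embedding that selects one qubit. -/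
def qubit {n : ℕ} (i : Fin n) : Fin 1 ↪ Fin n := ⟨fun _ => i, fun _ _ _ => Subsingleton.elim _ _⟩

theorem embed_qubit_pauliZ {n : ℕ} (i : Fin n) :
    embed (qubit i) pauliZ = Matrix.diagonal fun x => if x i = 0 then 1 else -1 := by
  ext x y
  rw [embed_apply]
  by_cases h : x = y
  · subst h
    rw [if_pos fun _ _ => rfl, pauliZ, diagonal_apply_eq, diagonal_apply_eq]
    rfl
  · rw [Matrix.diagonal_apply_ne _ h]
    split_ifs with h1
    · refine Matrix.diagonal_apply_ne _ fun h2 => h (funext fun j => ?_)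
      by_cases hj : j = i
      · subst hj; exact congrFun h2 0
      · refine h1 j ?_
        rintro ⟨_, rfl⟩
        exact hj rfl
    · rfl

namespace OneCleanQubitCircuit

variable (C : OneCleanQubitCircuit)

theorem star_mul_gateOp {n : ℕ} (g : Gate n) : g.opᴴ * g.op = 1 := by
  rw [Gate.op, ← embed_conjTranspose, ← embed_mul, g.kind.star_mul_op, embed_one]

theorem star_mul_foldl {n : ℕ} (l : List (Gate n)) (U : QOp n) (hU : Uᴴ * U = 1) :
    (l.foldl (fun U g => g.op * U) U)ᴴ * l.foldl (fun U g => g.op * U) U = 1 := by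
  induction l generalizing U with
  | nil => exact hU
  | cons g l ih =>
    refine ih _ ?_
    rw [conjTranspose_mul, Matrix.mul_assoc, ← Matrix.mul_assoc _ g.op, star_mul_gateOp,
      Matrix.one_mul, hU]

theorem star_mul_unitary : C.unitaryᴴ * C.unitary = 1 :=
  star_mul_foldl C.gates 1 (by simp)

theorem trace_pauliZ : (embed (qubit (0 : Fin (C.mixed + 1))) pauliZ).trace = 0 := by
  have h := trace_embed (qubit (0 : Fin (C.mixed + 1))) pauliZ
  have h2 : pauliZ.trace = 0 := by
    rw [pauliZ, trace_diagonal, sum_basis_one]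
    simp
  rw [h2, zero_div, div_eq_zero_iff] at h
  exact h.resolve_right (pow_ne_zero _ two_ne_zero)

/-- The measured projection is `(1 + Z) / 2`, and the initial state is a multiple of the same
projection. After expansion, the terms with a single `Z` are traceless, which leaves the identity
and `Z U Z Uᴴ`. -/
theorem acceptProb_eq : C.acceptProb = 1 / 2 + 1 / 2 *
    ((embed (qubit 0) pauliZ * C.unitary * embed (qubit 0) pauliZ * C.unitaryᴴ).trace.re /
      2 ^ (C.mixed + 1)) := by
  set Z := embed (qubit (0 : Fin (C.mixed + 1))) pauliZ with hZ
  set U := C.unitary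
  have hU := C.star_mul_unitary
  have hU' : U * Uᴴ = 1 := mul_eq_one_comm.1 hU
  have h1 : C.projZero = (1 / 2 : ℂ) • (1 + Z) := by
    rw [hZ, embed_qubit_pauliZ, ← diagonal_one, diagonal_add, ← diagonal_smul, projZero]
    congr 1
    funext x
    simp only [Pi.smul_apply, smul_eq_mul]
    split_ifs <;> norm_num
  have h2 : C.initialState = (1 / 2 ^ C.mixed : ℂ) • C.projZero := by
    rw [projZero, ← diagonal_smul, initialState]
    congr 1
    funext x
    simp only [Pi.smul_apply, smul_eq_mul]
    split_ifs <;> simp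
  have h3 : (C.projZero * (U * C.initialState * Uᴴ)).trace = (1 / 2 ^ C.mixed : ℂ) * (1 / 4) *
      ((2 : ℂ) ^ (C.mixed + 1) + (Z * U * Z * Uᴴ).trace) := by
    have e1 : (1 + Z) * (U * (1 + Z) * Uᴴ) = 1 + Z + U * Z * Uᴴ + Z * U * Z * Uᴴ := by
      have : (1 + Z) * (U * (1 + Z) * Uᴴ) =
          U * Uᴴ + Z * (U * Uᴴ) + U * Z * Uᴴ + Z * U * Z * Uᴴ := by noncomm_ring
      rw [this, hU', mul_one]
    have e3 : Z.trace = 0 := C.trace_pauliZ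
    have e2 : (U * Z * Uᴴ).trace = 0 := by
      rw [trace_mul_comm, ← mul_assoc, hU, one_mul, e3]
    rw [h2, h1]
    simp only [Matrix.mul_smul, Matrix.smul_mul]
    rw [trace_smul, trace_smul, trace_smul, e1]
    simp only [trace_add, e2, e3]
    rw [trace_one, Fintype.card_fun, Fintype.card_fin, Fintype.card_fin]
    simp only [smul_eq_mul]
    push_cast
    ring
  have h4 : (1 / 2 ^ C.mixed : ℂ) * (1 / 4) *
      ((2 : ℂ) ^ (C.mixed + 1) + (Z * U * Z * Uᴴ).trace) =
      (1 / 2 : ℝ) + (1 / 2 / 2 ^ (C.mixed + 1) : ℝ) * (Z * U * Z * Uᴴ).trace := by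
    push_cast
    field_simp
    ring
  rw [acceptProb, h3, h4, Complex.add_re, Complex.ofReal_re, Complex.re_ofReal_mul]
  ring

end OneCleanQubitCircuit

/-! ### The terms of the Hamiltonian -/

/-- What happens in a step of the clock: a gate, nothing, or the change of direction. -/
inductive StepKind : Type
  | gate (g : GateKind)
  | idle
  | ends

def StepKind.arity : StepKind → ℕ
  | .gate g => g.arity
  | .idle => 0
  | .ends => 2

def StepKind.mat : (κ : StepKind) → Matrix (Basis κ.arity) (Basis κ.arity) (ℚ × ℚ)
  | .gate g => g.ratMat
  | .idle => fun _ _ => (1, 0)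
  | .ends => fun (x y : Basis 2) =>
      if x 0 = y 0 ∧ x 1 ≠ y 1 then (if x 0 = 0 then (1, 0) else (-1, 0)) else 0

def StepKind.isEnds : StepKind → Bool
  | .ends => true
  | _ => false

/-- The complex conjugate. -/
def conjRat (z : ℚ × ℚ) : ℚ × ℚ := (z.1, -z.2)

/-- The block of a term at two positions of the clock that carry the given marks. -/
def StepKind.entry (κ : StepKind) (u v : Option Bool) (a b : Basis κ.arity) : ℚ × ℚ :=
  if κ.isEnds then
    if u = v ∧ u ≠ none then κ.mat a b else 0
  else if u = some true ∧ v = some false then κ.mat a b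
  else if u = some false ∧ v = some true then conjRat (κ.mat b a)
  else 0

/-- The number in binary that the qubits of the clock show. -/
def clockVal {s : ℕ} (x : Basis s) : ℕ := (finFunctionFinEquiv x : ℕ)

/-- The marks for the step from `t` to `t + 1`. -/
def stepMark (t i : ℕ) : Option Bool :=
  if i = t then some false else if i = t + 1 then some true else none

/-- The marks of the two ends of the clock. -/
def endMark (R i : ℕ) : Option Bool :=
  if i = 0 then some false else if i = R - 1 then some true else none

/-- Two disjoint lists of qubits, one after the other. -/
def appendEmb {a b n : ℕ} (f : Fin a ↪ Fin n) (g : Fin b ↪ Fin n) (h : ∀ i j, f i ≠ g j) :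
    Fin (a + b) ↪ Fin n :=
  ⟨Fin.append f g, by
    intro i j
    refine Fin.addCases (fun i => ?_) (fun i => ?_) i <;>
      refine Fin.addCases (fun j => ?_) (fun j => ?_) j <;> intro hij
    · rw [Fin.append_left, Fin.append_left] at hij
      rw [f.injective hij]
    · rw [Fin.append_left, Fin.append_right] at hij
      exact absurd hij (h i j)
    · rw [Fin.append_left, Fin.append_right] at hij
      exact absurd hij.symm (h j i)
    · rw [Fin.append_right, Fin.append_right] at hij
      rw [g.injective hij]⟩

theorem castAdd_trans_appendEmb {a b n : ℕ} (f : Fin a ↪ Fin n) (g : Fin b ↪ Fin n)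
    (h : ∀ i j, f i ≠ g j) : (Fin.castAddEmb b).trans (appendEmb f g h) = f := by
  ext i
  exact congrArg Fin.val (Fin.append_left f g i)

theorem natAdd_trans_appendEmb {a b n : ℕ} (f : Fin a ↪ Fin n) (g : Fin b ↪ Fin n)
    (h : ∀ i j, f i ≠ g j) : (Fin.natAddEmb a).trans (appendEmb f g h) = g := by
  ext i
  exact congrArg Fin.val (Fin.append_right f g i)

theorem disjoint_range_of_ne {a b n : ℕ} {f : Fin a ↪ Fin n} {g : Fin b ↪ Fin n}
    (h : ∀ i j, f i ≠ g j) : Disjoint (Set.range f) (Set.range g) := by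
  rw [Set.disjoint_left]
  rintro _ ⟨i, rfl⟩ ⟨j, hj⟩
  exact h i j hj.symm

/-- The matrix of the term of a step; the qubits of the clock are the last ones. -/
def stepMat (κ : StepKind) (s : ℕ) (μ : ℕ → Option Bool) :
    Matrix (Basis (κ.arity + s)) (Basis (κ.arity + s)) (ℚ × ℚ) := fun x y =>
  κ.entry (μ (clockVal (x ∘ Fin.natAdd κ.arity))) (μ (clockVal (y ∘ Fin.natAdd κ.arity)))
    (x ∘ Fin.castAdd s) (y ∘ Fin.castAdd s)

/-- The term of a step, with the clock on the qubits `clk`. -/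
def LocalTerm.ofStep {n s : ℕ} (κ : StepKind) (wires : Fin κ.arity ↪ Fin n) (clk : Fin s ↪ Fin n)
    (h : ∀ i j, wires i ≠ clk j) (μ : ℕ → Option Bool) : LocalTerm n where
  k := κ.arity + s
  qubits := appendEmb wires clk h
  mat := stepMat κ s μ

/-- The matrix unit of the clock at the positions `a` and `b`. -/
def clockUnit (s a b : ℕ) : QOp s := fun x y => if clockVal x = a ∧ clockVal y = b then 1 else 0

/-- The matrix of a step. -/
def StepKind.op (κ : StepKind) : QOp κ.arity := κ.mat.map gaussianRat

theorem gaussianRat_conjRat (z : ℚ × ℚ) : gaussianRat (conjRat z) = star (gaussianRat z) := by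
  simp [gaussianRat, conjRat, ← sub_eq_add_neg]

/-- The marks `false` and `true` single out the positions `t` and `t + 1`, so the four cases of
`entry` are the two off-diagonal blocks, adjoint to each other, and zeros. The program that writes
the matrix then needs only the marks. -/
theorem map_stepMat_stepMark {κ : StepKind} (hκ : κ.isEnds = false) (s t : ℕ) :
    (stepMat κ s (stepMark t)).map gaussianRat =
      tensor κ.op (clockUnit s (t + 1) t) + tensor κ.opᴴ (clockUnit s t (t + 1)) := by
  ext x y
  have e1 : ∀ i, stepMark t i = some true ↔ i = t + 1 := by
    intro i; unfold stepMark; split_ifs <;> simp <;> omega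
  have e2 : ∀ i, stepMark t i = some false ↔ i = t := by
    intro i; unfold stepMark; split_ifs <;> simp <;> omega
  rw [Matrix.add_apply, Matrix.map_apply]
  simp only [stepMat, tensor, StepKind.entry, hκ, e1, e2, clockUnit, conjTranspose_apply,
    StepKind.op, Matrix.map_apply, Bool.false_eq_true, if_false]
  split_ifs <;> first
    | omega
    | simp [gaussianRat_zero, gaussianRat_conjRat]

/-- For `R ≥ 2` the two ends carry different marks, so two equal marks other than `none` occur only
on the diagonal. -/
theorem map_stepMat_endMark {R : ℕ} (hR : 2 ≤ R) {κ : StepKind} (hκ : κ.isEnds = true) (s : ℕ) :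
    (stepMat κ s (endMark R)).map gaussianRat =
      tensor κ.op (clockUnit s 0 0 + clockUnit s (R - 1) (R - 1)) := by
  ext x y
  have e1 : ∀ i j, (endMark R i = endMark R j ∧ endMark R i ≠ none) ↔
      (i = 0 ∧ j = 0 ∨ i = R - 1 ∧ j = R - 1) := by
    intro i j; unfold endMark; split_ifs <;> simp <;> omega
  rw [Matrix.map_apply]
  simp only [stepMat, tensor, StepKind.entry, hκ, e1, clockUnit, Matrix.add_apply, StepKind.op,
    if_true, Matrix.map_apply]
  split_ifs <;> first
    | omega
    | simp [gaussianRat_zero]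

theorem op_ofStep_stepMark {n s : ℕ} {κ : StepKind} (hκ : κ.isEnds = false)
    (wires : Fin κ.arity ↪ Fin n) (clk : Fin s ↪ Fin n) (h : ∀ i j, wires i ≠ clk j) (t : ℕ) :
    (LocalTerm.ofStep κ wires clk h (stepMark t)).op =
      embed clk (clockUnit s (t + 1) t) * embed wires κ.op +
        embed clk (clockUnit s t (t + 1)) * (embed wires κ.op)ᴴ := by
  have hd := disjoint_range_of_ne h
  change embed (appendEmb wires clk h) ((stepMat κ s (stepMark t)).map gaussianRat) = _
  rw [map_stepMat_stepMark hκ, embed_add, embed_tensor, embed_tensor, castAdd_trans_appendEmb,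
    natAdd_trans_appendEmb, embed_comm _ _ hd, embed_comm _ _ hd, embed_conjTranspose]

theorem op_ofStep_endMark {n s R : ℕ} (hR : 2 ≤ R) {κ : StepKind} (hκ : κ.isEnds = true)
    (wires : Fin κ.arity ↪ Fin n) (clk : Fin s ↪ Fin n) (h : ∀ i j, wires i ≠ clk j) :
    (LocalTerm.ofStep κ wires clk h (endMark R)).op =
      (embed clk (clockUnit s 0 0) + embed clk (clockUnit s (R - 1) (R - 1))) *
        embed wires κ.op := by
  have hd := disjoint_range_of_ne h
  change embed (appendEmb wires clk h) ((stepMat κ s (endMark R)).map gaussianRat) = _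
  rw [map_stepMat_endMark hR hκ, embed_tensor, castAdd_trans_appendEmb, natAdd_trans_appendEmb,
    embed_comm _ _ hd, embed_add]

/-! ### Matrix units -/

/-- The bound on `b` provides an intermediate clock state; for a value the clock cannot show the
product would be zero. -/
theorem clockUnit_mul {s a b c d : ℕ} (hb : b < 2 ^ s) :
    clockUnit s a b * clockUnit s c d = if b = c then clockUnit s a d else 0 := by
  ext x y
  rw [Matrix.mul_apply, Finset.sum_eq_single (finFunctionFinEquiv.symm ⟨b, hb⟩)]
  · have : clockVal (finFunctionFinEquiv.symm (⟨b, hb⟩ : Fin (2 ^ s))) = b := by simp [clockVal]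
    simp only [clockUnit, this]
    by_cases h : b = c
    · subst h
      by_cases h1 : clockVal x = a <;> simp [clockUnit, h1]
    · simp [h]
  · intro z _ hz
    have : clockVal z ≠ b := by
      rintro rfl
      exact hz ((Equiv.eq_symm_apply _).2 rfl)
    simp [clockUnit, this]
  · simp

theorem clockUnit_sum (s : ℕ) : ∑ a ∈ Finset.range (2 ^ s), clockUnit s a a = 1 := by
  ext x y
  rw [Matrix.sum_apply, Finset.sum_eq_single (clockVal x)]
  · have : clockVal y = clockVal x ↔ x = y := by
      simp only [clockVal, Fin.val_inj, Equiv.apply_eq_iff_eq]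
      exact eq_comm
    simp [clockUnit, this, Matrix.one_apply]
  · intro a _ ha
    simp [clockUnit, ha.symm]
  · intro h
    exact absurd (Finset.mem_range.2 (finFunctionFinEquiv x).isLt) h

theorem clockUnit_conjTranspose (s a b : ℕ) : (clockUnit s a b)ᴴ = clockUnit s b a := by
  ext x y
  simp only [conjTranspose_apply, clockUnit]
  rw [apply_ite star, star_one, star_zero]
  exact if_congr and_comm rfl rfl

/-- A matrix unit of a single qubit. -/
def dirUnit (a b : Fin 2) : QOp 1 := fun x y => if x 0 = a ∧ y 0 = b then 1 else 0

theorem dirUnit_mul (a b c d : Fin 2) :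
    dirUnit a b * dirUnit c d = if b = c then dirUnit a d else 0 := by
  ext x y
  rw [Matrix.mul_apply, sum_basis_one]
  fin_cases b <;> fin_cases c <;> by_cases h : x 0 = a <;> simp [dirUnit, h]

theorem dirUnit_sum : dirUnit 0 0 + dirUnit 1 1 = 1 := by
  have h01 : ((fun _ => 0 : Basis 1) = fun _ => 1) ↔ False := by simp [funext_iff]
  have h10 : ((fun _ => 1 : Basis 1) = fun _ => 0) ↔ False := by simp [funext_iff]
  ext x y
  rcases basis_one_cases x with rfl | rfl <;> rcases basis_one_cases y with rfl | rfl <;>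
    simp [dirUnit, h01, h10]

theorem dirUnit_conjTranspose (a b : Fin 2) : (dirUnit a b)ᴴ = dirUnit b a := by
  ext x y
  simp only [conjTranspose_apply, dirUnit]
  rw [apply_ite star, star_one, star_zero]
  exact if_congr and_comm rfl rfl

theorem gaussianRat_ends (x y : Basis 2) :
    gaussianRat (if x 0 = y 0 ∧ x 1 ≠ y 1 then (if x 0 = 0 then (1, 0) else (-1, 0)) else 0) =
      tensor pauliZ (dirUnit 1 0 + dirUnit 0 1) x y := by
  have h1 : tensor pauliZ (dirUnit 1 0 + dirUnit 0 1) x y =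
      (if x 0 = y 0 then (if x 0 = 0 then 1 else -1) else 0) *
      ((if x 1 = 1 ∧ y 1 = 0 then 1 else 0) + (if x 1 = 0 ∧ y 1 = 1 then 1 else 0)) := by
    have hxy : x ∘ Fin.castAdd 1 = y ∘ Fin.castAdd 1 ↔ x 0 = y 0 := by
      refine ⟨fun h => congrFun h 0, fun h => funext fun i => ?_⟩
      rw [Subsingleton.elim i 0]
      exact h
    rw [tensor, pauliZ, diagonal_apply]
    congr 1
    exact if_congr hxy rfl rfl
  rw [h1]
  generalize x 0 = a
  generalize y 0 = b
  generalize x 1 = c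
  generalize y 1 = d
  fin_cases a <;> fin_cases b <;> fin_cases c <;> fin_cases d <;> simp [gaussianRat]

theorem ends_op : StepKind.ends.op = tensor pauliZ (dirUnit 1 0 + dirUnit 0 1) :=
  funext fun x => funext fun y => gaussianRat_ends x y

/-! ### The Hamiltonian of a circuit -/

/-- What the clock does in a step, given the gate, if there is one left. -/
def stepKind {m : ℕ} : Option (Gate m) → StepKind
  | some g => .gate g.kind
  | none => .idle

def stepWires {m : ℕ} : (o : Option (Gate m)) → Fin (stepKind o).arity ↪ Fin m
  | some g => g.wires
  | none => ⟨fun i => Fin.elim0 i, fun i => Fin.elim0 i⟩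

theorem isEnds_stepKind {m : ℕ} (o : Option (Gate m)) : (stepKind o).isEnds = false := by
  cases o <;> rfl

theorem idle_op : StepKind.idle.op = (1 : QOp 0) := by
  have h : ∀ x y : Basis 0, gaussianRat (1, 0) = (1 : QOp 0) x y := by
    intro x y
    rw [Subsingleton.elim x y, Matrix.one_apply_eq]
    simp [gaussianRat]
  exact funext fun x => funext fun y => h x y

theorem star_mul_stepKind_op {m : ℕ} (o : Option (Gate m)) :
    (stepKind o).opᴴ * (stepKind o).op = 1 := by
  cases o with
  | none =>
    have h : ∀ A : QOp 0, A = 1 → Aᴴ * A = 1 := by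
      rintro _ rfl
      simp
    exact h _ idle_op
  | some g => exact g.kind.star_mul_ratMat

theorem embed_stepWires_none {m : ℕ} :
    embed (stepWires (none : Option (Gate m))) (stepKind (none : Option (Gate m))).op = 1 := by
  change embed (stepWires (none : Option (Gate m))) (StepKind.idle.op : QOp 0) = 1
  rw [idle_op]
  exact embed_one _

theorem embed_stepWires_some {m : ℕ} (g : Gate m) :
    embed (stepWires (some g)) (stepKind (some g)).op = g.kind.twist • g.op := by
  change embed g.wires (g.kind.ratMat.map gaussianRat) = _
  rw [GateKind.map_ratMat, embed_smul, Gate.op]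

namespace OneCleanQubitCircuit

variable (C : OneCleanQubitCircuit) {s : ℕ} (hs : C.mixed + 2 + s ≤ 4 * 2 ^ s)

/-- The qubits of the circuit come first. -/
def circuitWire : Fin (C.mixed + 1) ↪ Fin (4 * 2 ^ s) := Fin.castLEEmb (by omega)

/-- The direction qubit comes after them. -/
def dirWire : Fin (4 * 2 ^ s) := ⟨C.mixed + 1, by omega⟩

/-- The clock is the last group of qubits. -/
def clockWire : Fin s ↪ Fin (4 * 2 ^ s) :=
  ⟨fun i => ⟨C.mixed + 2 + i, by omega⟩, fun i j h => Fin.ext (by simpa using h)⟩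

theorem trans_circuitWire_ne_clockWire {k : ℕ} (f : Fin k ↪ Fin (C.mixed + 1)) (i : Fin k)
    (j : Fin s) : (f.trans (C.circuitWire hs)) i ≠ C.clockWire hs j := by
  intro h
  have h1 : ((f i : ℕ)) = C.mixed + 2 + (j : ℕ) := congrArg Fin.val h
  have h2 := (f i).isLt
  omega

theorem trans_circuitWire_ne_dirWire {k : ℕ} (f : Fin k ↪ Fin (C.mixed + 1)) (i : Fin k)
    (j : Fin 1) : (f.trans (C.circuitWire hs)) i ≠ qubit (C.dirWire hs) j := by
  intro h
  have h1 : ((f i : ℕ)) = C.mixed + 1 := congrArg Fin.val h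
  have h2 := (f i).isLt
  omega

theorem dirWire_ne_clockWire (i : Fin 1) (j : Fin s) :
    qubit (C.dirWire hs) i ≠ C.clockWire hs j := by
  intro h
  have h1 : C.mixed + 1 = C.mixed + 2 + (j : ℕ) := congrArg Fin.val h
  omega

/-- The output qubit and the direction qubit. -/
def endWires : Fin StepKind.ends.arity ↪ Fin (4 * 2 ^ s) :=
  appendEmb (a := 1) (b := 1) ((qubit 0).trans (C.circuitWire hs)) (qubit (C.dirWire hs))
    (C.trans_circuitWire_ne_dirWire hs _)

theorem endWires_ne_clockWire (i : Fin StepKind.ends.arity) (j : Fin s) :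
    C.endWires hs i ≠ C.clockWire hs j := by
  change Fin (1 + 1) at i
  change Fin.append (α := Fin (4 * 2 ^ s)) _ _ i ≠ _
  refine Fin.addCases (fun i => ?_) (fun i => ?_) i
  · rw [Fin.append_left]
    exact C.trans_circuitWire_ne_clockWire hs _ _ _
  · rw [Fin.append_right]
    exact C.dirWire_ne_clockWire hs _ _

/-- The term of step `t`. -/
def stepTerm (t : ℕ) : LocalTerm (4 * 2 ^ s) :=
  LocalTerm.ofStep (stepKind C.gates[t]?) ((stepWires C.gates[t]?).trans (C.circuitWire hs))
    (C.clockWire hs) (C.trans_circuitWire_ne_clockWire hs _) (stepMark t)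

/-- The term of the two ends of the clock. -/
def endTerm : LocalTerm (4 * 2 ^ s) :=
  LocalTerm.ofStep .ends (C.endWires hs) (C.clockWire hs) (C.endWires_ne_clockWire hs)
    (endMark (2 ^ s))

/-- The instance of the estimation problem for a circuit, with a clock of `s` qubits. -/
def toInstance : SchattenInstance where
  n := 4 * 2 ^ s
  p := 2 * 2 ^ s
  invEps := 2 ^ s
  terms := C.endTerm hs :: (List.range (2 ^ s - 1)).map (C.stepTerm hs)

/-- The clock system of a circuit. -/
def clockSystem : ClockSystem (Basis (4 * 2 ^ s)) (2 ^ s) where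
  K a b := embed (C.clockWire hs) (clockUnit s a b)
  D a b := embed (qubit (C.dirWire hs)) (dirUnit a b)
  G t := embed ((stepWires C.gates[t]?).trans (C.circuitWire hs)) (stepKind C.gates[t]?).op
  Z := embed ((qubit 0).trans (C.circuitWire hs)) pauliZ
  mul_K a b c d hb := by
    rw [← embed_mul, clockUnit_mul hb]
    split_ifs
    · rfl
    · exact embed_zero _
  sum_K := by rw [← embed_sum, clockUnit_sum, embed_one]
  star_K a b := by rw [← embed_conjTranspose, clockUnit_conjTranspose]
  mul_D a b c d := by
    rw [← embed_mul, dirUnit_mul]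
    split_ifs
    · rfl
    · exact embed_zero _
  sum_D := by rw [← embed_add, dirUnit_sum, embed_one]
  star_D a b := by rw [← embed_conjTranspose, dirUnit_conjTranspose]
  K_comm_D a b c d :=
    (embed_comm _ _ (disjoint_range_of_ne (C.dirWire_ne_clockWire hs)) _ _).symm
  K_comm_G a b t :=
    (embed_comm _ _ (disjoint_range_of_ne (C.trans_circuitWire_ne_clockWire hs _)) _ _).symm
  D_comm_G a b t :=
    (embed_comm _ _ (disjoint_range_of_ne (C.trans_circuitWire_ne_dirWire hs _)) _ _).symm
  K_comm_Z a b :=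
    (embed_comm _ _ (disjoint_range_of_ne (C.trans_circuitWire_ne_clockWire hs _)) _ _).symm
  D_comm_Z a b :=
    (embed_comm _ _ (disjoint_range_of_ne (C.trans_circuitWire_ne_dirWire hs _)) _ _).symm
  star_mul_G t := by
    rw [← embed_conjTranspose, ← embed_mul, star_mul_stepKind_op, embed_one]
  star_Z := by rw [← embed_conjTranspose, pauliZ_conjTranspose]
  Z_mul_Z := by rw [← embed_mul, pauliZ_mul_self, embed_one]

theorem op_stepTerm (t : ℕ) : (C.stepTerm hs t).op =
    (C.clockSystem hs).K (t + 1) t * (C.clockSystem hs).G t +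
      (C.clockSystem hs).K t (t + 1) * ((C.clockSystem hs).G t)ᴴ :=
  op_ofStep_stepMark (isEnds_stepKind _) _ _ _ _

theorem op_endTerm (h1 : 1 ≤ s) : (C.endTerm hs).op =
    ((C.clockSystem hs).K 0 0 + (C.clockSystem hs).K (2 ^ s - 1) (2 ^ s - 1)) *
      (((C.clockSystem hs).D 1 0 + (C.clockSystem hs).D 0 1) * (C.clockSystem hs).Z) := by
  have hR : 2 ≤ 2 ^ s := by simpa using Nat.pow_le_pow_right two_pos h1
  refine (op_ofStep_endMark hR rfl _ _ _).trans ?_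
  change _ * embed (appendEmb (a := 1) (b := 1) _ _ _) StepKind.ends.op = _
  rw [ends_op, embed_tensor, castAdd_trans_appendEmb, natAdd_trans_appendEmb, embed_add,
    add_mul ((C.clockSystem hs).D 1 0), (C.clockSystem hs).D_comm_Z,
    (C.clockSystem hs).D_comm_Z, ← mul_add ((C.clockSystem hs).Z)]
  rfl

theorem hamiltonian_toInstance (h1 : 1 ≤ s) :
    (C.toInstance hs).hamiltonian = (C.clockSystem hs).ham := by
  have h : ((C.toInstance hs).terms.map LocalTerm.op).sum = (C.endTerm hs).op +
      ((List.range (2 ^ s - 1)).map fun t => (C.stepTerm hs t).op).sum := by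
    change ((C.endTerm hs :: (List.range (2 ^ s - 1)).map (C.stepTerm hs)).map
      LocalTerm.op).sum = _
    rw [List.map_cons, List.sum_cons, List.map_map]
    rfl
  refine h.trans ?_
  rw [C.op_endTerm hs h1, ClockSystem.ham, add_comm]
  congr 1
  rw [← List.sum_toFinset _ List.nodup_range, List.toFinset_range]
  exact Finset.sum_congr rfl fun t _ => C.op_stepTerm hs t

/-- Each gate contributes its phase to `ζ`. Steps after the last gate are idle, in agreement with
`List.take` beyond the end of the list. -/
theorem prefixProd_eq (t : ℕ) : ∃ ζ : ℂ, star ζ * ζ = 1 ∧ (C.clockSystem hs).prefixProd t =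
    ζ • embed (C.circuitWire hs) ((C.gates.take t).foldl (fun U g => g.op * U) 1) := by
  induction t with
  | zero => exact ⟨1, by simp, by simp [ClockSystem.prefixProd, embed_one]⟩
  | succ t ih =>
    obtain ⟨ζ, hζ, ih⟩ := ih
    have hG : (C.clockSystem hs).G t = embed (C.circuitWire hs)
        (embed (stepWires C.gates[t]?) (stepKind C.gates[t]?).op) := embed_trans _ _ _
    rw [ClockSystem.prefixProd, hG, ih]
    rcases h : C.gates[t]? with _ | g
    · refine ⟨ζ, hζ, ?_⟩
      rw [embed_stepWires_none, embed_one, one_mul, List.take_add_one, h]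
      simp
    · refine ⟨ζ * g.kind.twist, ?_, ?_⟩
      · rw [star_mul']
        linear_combination (star g.kind.twist * g.kind.twist) * hζ + g.kind.star_mul_twist
      · rw [embed_stepWires_some, embed_smul, Matrix.smul_mul, Matrix.mul_smul, smul_smul,
          ← embed_mul, List.take_add_one, h, mul_comm ζ]
        simp

/-- The phase cancels between `prefixProd` and its adjoint, and `trace_embed` removes the clock, the
direction qubit and the padding. The factor 4 is the 2 in front of the full turn times the 2 from
solving `acceptProb_eq` for the trace. -/
theorem value_toInstance (h1 : 1 ≤ s) (hT : C.gates.length ≤ 2 ^ s - 1) :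
    normalizedAbsPowTrace (C.toInstance hs).hamiltonian (C.toInstance hs).p =
      (2 ^ s).centralBinom + 4 * (C.acceptProb - 1 / 2) := by
  have hR : 2 ≤ 2 ^ s := by simpa using Nat.pow_le_pow_right two_pos h1
  have : NeZero (2 ^ s) := ⟨by positivity⟩
  set S := C.clockSystem hs with hS
  have hherm : S.hamᴴ = S.ham := by
    rw [S.ham_eq hR, conjTranspose_add, conjTranspose_conjTranspose, add_comm]
  have htr := S.trace_ham_pow hR
  obtain ⟨ζ, hζ, hP⟩ := C.prefixProd_eq hs (2 ^ s - 1)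
  -- The clock takes `R - 1` gate steps in one direction, which is enough for the whole circuit.
  rw [List.take_of_length_le hT] at hP
  have hZ : S.Z = embed (C.circuitWire hs) (embed (qubit 0) pauliZ) := embed_trans _ _ _
  have hprod : S.Z * S.prefixProd (2 ^ s - 1) * S.Z * (S.prefixProd (2 ^ s - 1))ᴴ =
      embed (C.circuitWire hs) (embed (qubit 0) pauliZ * C.unitary * embed (qubit 0) pauliZ *
        C.unitaryᴴ) := by
    rw [hP, hZ, conjTranspose_smul, Matrix.mul_smul, Matrix.mul_smul, Matrix.smul_mul,
      Matrix.smul_mul, smul_smul, hζ, one_smul, embed_mul, embed_mul, embed_mul,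
      embed_conjTranspose]
    rfl
  have htrace := trace_embed (C.circuitWire hs) (embed (qubit 0) pauliZ * C.unitary *
    embed (qubit 0) pauliZ * C.unitaryᴴ)
  rw [C.hamiltonian_toInstance hs h1]
  change normalizedAbsPowTrace S.ham (2 * 2 ^ s) = _
  rw [normalizedAbsPowTrace_of_isHermitian hherm, C.acceptProb_eq, htr, hprod]
  have hre := congrArg Complex.re htrace
  have hdiv : ∀ (z : ℂ) (k : ℕ), (z / 2 ^ k).re = z.re / 2 ^ k := by
    intro z k
    have : z / 2 ^ k = z / ((2 ^ k : ℝ) : ℂ) := by push_cast; rfl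
    rw [this, Complex.div_ofReal_re]
  rw [hdiv, hdiv] at hre
  rw [← hre]
  have hcard : Fintype.card (Basis (4 * 2 ^ s)) = 2 ^ (4 * 2 ^ s) := by simp
  rw [hcard]
  have h2 : ((2 : ℝ) ^ (4 * 2 ^ s)) ≠ 0 := by positivity
  have hsplit : ((((2 ^ s).centralBinom : ℂ) * ((2 ^ (4 * 2 ^ s) : ℕ) : ℂ) + 2 *
      ((embed (C.circuitWire hs) (embed (qubit 0) pauliZ * C.unitary * embed (qubit 0) pauliZ *
        C.unitaryᴴ)).trace.re : ℂ))).re = ((2 ^ s).centralBinom : ℝ) * 2 ^ (4 * 2 ^ s) +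
      2 * (embed (C.circuitWire hs) (embed (qubit 0) pauliZ * C.unitary *
        embed (qubit 0) pauliZ * C.unitaryᴴ)).trace.re := by
    rw [← Complex.ofReal_re (_ + _)]
    congr 1
    push_cast
    rfl
  rw [hsplit]
  field_simp
  ring

/-- The Hamiltonian is the sum of a unitary and its adjoint. -/
theorem opNorm_hamiltonian_toInstance (h1 : 1 ≤ s) :
    opNorm (C.toInstance hs).hamiltonian ≤ 2 := by
  have hR : 2 ≤ 2 ^ s := by simpa using Nat.pow_le_pow_right two_pos h1
  have : NeZero (2 ^ s) := ⟨by positivity⟩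
  rw [C.hamiltonian_toInstance hs h1, (C.clockSystem hs).ham_eq hR]
  refine (opNorm_add_le (n := 4 * 2 ^ s) _ _).trans ?_
  rw [opNorm_conjTranspose]
  have := opNorm_le_one_of_unitary (n := 4 * 2 ^ s)
    ((C.clockSystem hs).walk.star_step_mul_step 1)
  linarith

end OneCleanQubitCircuit

/-! ### The instance of a circuit satisfies the promise -/

theorem tensor_conjTranspose {a b : ℕ} (A : QOp a) (B : QOp b) :
    (tensor A B)ᴴ = tensor Aᴴ Bᴴ := by
  ext x y
  simp [tensor, conjTranspose_apply]

theorem LocalTerm.isHermitian_ofStep_stepMark {n s : ℕ} {κ : StepKind} (hκ : κ.isEnds = false)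
    (wires : Fin κ.arity ↪ Fin n) (clk : Fin s ↪ Fin n) (h : ∀ i j, wires i ≠ clk j) (t : ℕ) :
    (LocalTerm.ofStep κ wires clk h (stepMark t)).localOp.IsHermitian := by
  change ((stepMat κ s (stepMark t)).map gaussianRat)ᴴ = (stepMat κ s (stepMark t)).map gaussianRat
  rw [map_stepMat_stepMark hκ, conjTranspose_add, tensor_conjTranspose, tensor_conjTranspose,
    conjTranspose_conjTranspose, clockUnit_conjTranspose, clockUnit_conjTranspose]
  exact add_comm _ _

theorem ends_op_conjTranspose : StepKind.ends.opᴴ = StepKind.ends.op := by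
  rw [ends_op]
  refine (tensor_conjTranspose (a := 1) (b := 1) _ _).trans ?_
  rw [pauliZ_conjTranspose, conjTranspose_add, dirUnit_conjTranspose, dirUnit_conjTranspose]
  exact congrArg (tensor (a := 1) (b := 1) pauliZ) (add_comm _ _)

theorem LocalTerm.isHermitian_ofStep_endMark {n s R : ℕ} (hR : 2 ≤ R)
    (wires : Fin StepKind.ends.arity ↪ Fin n) (clk : Fin s ↪ Fin n)
    (h : ∀ i j, wires i ≠ clk j) :
    (LocalTerm.ofStep .ends wires clk h (endMark R)).localOp.IsHermitian := by
  change ((stepMat .ends s (endMark R)).map gaussianRat)ᴴ = (stepMat .ends s (endMark R)).map gaussianRat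
  rw [map_stepMat_endMark hR rfl, tensor_conjTranspose, ends_op_conjTranspose, conjTranspose_add,
    clockUnit_conjTranspose, clockUnit_conjTranspose]

theorem StepKind.arity_le (κ : StepKind) : κ.arity ≤ 3 := by
  rcases κ with g | _ | _
  · cases g <;> decide
  · decide
  · decide

namespace ClockSystem

variable {n R : ℕ} (S : ClockSystem (Basis n) R)

theorem opNorm_K_le {a b : ℕ} (ha : a < R) (hb : b < R) : opNorm (n := n) (S.K a b) ≤ 1 := by
  refine opNorm_le_one_of_proj ?_
  rw [S.star_K, S.mul_K _ _ _ _ ha, if_pos rfl, S.mul_K _ _ _ _ hb, if_pos rfl]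

theorem opNorm_step_le {t : ℕ} (ht : t + 1 < R) :
    opNorm (n := n) (S.K (t + 1) t * S.G t + S.K t (t + 1) * (S.G t)ᴴ) ≤ 2 := by
  have hG : opNorm (n := n) (S.G t) ≤ 1 := opNorm_le_one_of_unitary (S.star_mul_G t)
  have h1 := S.opNorm_K_le ht (show t < R by omega)
  have h2 := S.opNorm_K_le (show t < R by omega) ht
  have h3 := opNorm_mul_le (n := n) (S.K (t + 1) t) (S.G t)
  have h4 := opNorm_mul_le (n := n) (S.K t (t + 1)) (S.G t)ᴴ
  rw [opNorm_conjTranspose] at h4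
  have h5 := mul_le_one₀ h1 (opNorm_nonneg _) hG
  have h6 := mul_le_one₀ h2 (opNorm_nonneg _) hG
  have h7 := opNorm_add_le (n := n) (S.K (t + 1) t * S.G t) (S.K t (t + 1) * (S.G t)ᴴ)
  linarith

theorem opNorm_end_le (hR : 0 < R) :
    opNorm (n := n) ((S.K 0 0 + S.K (R - 1) (R - 1)) * ((S.D 1 0 + S.D 0 1) * S.Z)) ≤ 2 := by
  have hZ : opNorm (n := n) S.Z ≤ 1 :=
    opNorm_le_one_of_unitary (by rw [S.star_Z, S.Z_mul_Z])
  have hD : opNorm (n := n) (S.D 1 0 + S.D 0 1) ≤ 1 := by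
    refine opNorm_le_one_of_unitary ?_
    rw [conjTranspose_add, S.star_D, S.star_D, mul_add, add_mul, add_mul, S.mul_D, S.mul_D,
      S.mul_D, S.mul_D]
    simp [S.sum_D]
  have h1 := S.opNorm_K_le hR hR
  have h2 := S.opNorm_K_le (show R - 1 < R by omega) (show R - 1 < R by omega)
  have h3 := opNorm_add_le (n := n) (S.K 0 0) (S.K (R - 1) (R - 1))
  have h4 := (opNorm_mul_le (n := n) (S.D 1 0 + S.D 0 1) S.Z).trans
    (mul_le_one₀ hD (opNorm_nonneg _) hZ)
  refine (opNorm_mul_le (n := n) _ _).trans ?_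
  have h5 := mul_le_mul (h3.trans (add_le_add h1 h2)) h4 (opNorm_nonneg _) (by norm_num)
  linarith

end ClockSystem

namespace OneCleanQubitCircuit

variable (C : OneCleanQubitCircuit) {s : ℕ} (hs : C.mixed + 2 + s ≤ 4 * 2 ^ s)

/-- With `n = 2 ^ (s + 2)` the logarithm is exactly `s + 2`, so the at most `3 + s` qubits of a term
satisfy the bound with `c = 1`. There are `2 ^ s` terms of norm at most 2; their number, `p = 2 * 2
^ s` and `1 / ε = 2 ^ s` are all below `n = 4 * 2 ^ s`. -/
theorem isLogLocal_toInstance (h1 : 1 ≤ s) : (C.toInstance hs).IsLogLocal 1 := by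
  have hR : 2 ≤ 2 ^ s := by simpa using Nat.pow_le_pow_right two_pos h1
  have hlog : Nat.log 2 (4 * 2 ^ s) = s + 2 := by
    rw [show 4 * 2 ^ s = 2 ^ (s + 2) by ring, Nat.log_pow one_lt_two]
  have hn : (2 : ℝ) ≤ (((4 * 2 ^ s : ℕ) : ℝ)) ^ 1 + (1 : ℕ) := by
    have : (2 : ℝ) ≤ ((4 * 2 ^ s : ℕ) : ℝ) := by exact_mod_cast (by omega : 2 ≤ 4 * 2 ^ s)
    push_cast at this ⊢
    linarith
  have key : ∀ P : LocalTerm (4 * 2 ^ s) → Prop, P (C.endTerm hs) →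
      (∀ t < 2 ^ s - 1, P (C.stepTerm hs t)) → ∀ t ∈ (C.toInstance hs).terms, P t := by
    intro P h h' t ht
    rcases List.mem_cons.1 ht with rfl | hu
    · exact h
    · obtain ⟨u, hv, rfl⟩ := List.mem_map.1 hu
      exact h' u (List.mem_range.1 hv)
  constructor
  · exact key _ (LocalTerm.isHermitian_ofStep_endMark hR _ _ _)
      fun t _ => LocalTerm.isHermitian_ofStep_stepMark (isEnds_stepKind _) _ _ _ _
  · refine key (fun t => t.k ≤ 1 * Nat.log 2 (4 * 2 ^ s) + 1) ?_ fun t _ => ?_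
    · change StepKind.ends.arity + s ≤ _
      have := StepKind.ends.arity_le
      omega
    · change (stepKind C.gates[t]?).arity + s ≤ _
      have := (stepKind C.gates[t]?).arity_le
      omega
  · refine key (fun t => opNorm t.op ≤ ((4 * 2 ^ s : ℕ) : ℝ) ^ 1 + (1 : ℕ)) ?_ fun t ht => ?_
    · refine le_trans ?_ hn
      rw [C.op_endTerm hs h1]
      exact (C.clockSystem hs).opNorm_end_le (by omega)
    · refine le_trans ?_ hn
      rw [C.op_stepTerm hs t]
      exact (C.clockSystem hs).opNorm_step_le (by omega)
  · change (C.endTerm hs :: (List.range (2 ^ s - 1)).map (C.stepTerm hs)).length ≤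
      (4 * 2 ^ s) ^ 1 + 1
    simp only [List.length_cons, List.length_map, List.length_range]
    rw [pow_one]
    omega
  · change 0 < 2 * 2 ^ s
    omega
  · change 2 * 2 ^ s ≤ (4 * 2 ^ s) ^ 1 + 1
    rw [pow_one]
    omega
  · change 0 < 2 ^ s
    omega
  · change 2 ^ s ≤ (4 * 2 ^ s) ^ 1 + 1
    rw [pow_one]
    omega

/-- Since `‖A‖ / 2 ≤ 1`, its power in the accuracy can be dropped, which leaves `ε = 1 / 2 ^ s`. -/
theorem abs_sub_le_of_isEstimate (h1 : 1 ≤ s) (hT : C.gates.length ≤ 2 ^ s - 1) {c : ℕ} {y : ℝ}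
    (hy : (schattenEstimation c).IsEstimate (C.toInstance hs) y) :
    |y - ((2 ^ s).centralBinom + 4 * (C.acceptProb - 1 / 2))| ≤ 1 / (2 ^ s : ℕ) := by
  rw [← C.value_toInstance hs h1 hT]
  refine le_trans hy ?_
  change 1 / ((2 ^ s : ℕ) : ℝ) * (opNorm (C.toInstance hs).hamiltonian / 2) ^ (2 * 2 ^ s) ≤ _
  refine mul_le_of_le_one_right (by positivity) (pow_le_one₀ ?_ ?_)
  · exact div_nonneg (opNorm_nonneg _) (by norm_num)
  · have := C.opNorm_hamiltonian_toInstance hs h1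
    linarith

/-- The value exceeds the central binomial coefficient by at least `4 / q`, while the error is at
most `1 / 2 ^ s ≤ 1 / q`. -/
theorem lt_of_isEstimate (h1 : 1 ≤ s) (hT : C.gates.length ≤ 2 ^ s - 1) {c q : ℕ} {y : ℝ}
    (hq : 0 < q) (hqs : q ≤ 2 ^ s) (hp : 1 / 2 + 1 / (q : ℝ) ≤ C.acceptProb)
    (hy : (schattenEstimation c).IsEstimate (C.toInstance hs) y) :
    ((2 ^ s).centralBinom : ℝ) < y := by
  have h := abs_le.1 (C.abs_sub_le_of_isEstimate hs h1 hT hy)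
  have hq' : (0 : ℝ) < 1 / q := by positivity
  have : 1 / ((2 ^ s : ℕ) : ℝ) ≤ 1 / q :=
    one_div_le_one_div_of_le (by positivity) (by exact_mod_cast hqs)
  linarith [h.1]

theorem isEstimate_lt (h1 : 1 ≤ s) (hT : C.gates.length ≤ 2 ^ s - 1) {c q : ℕ} {y : ℝ}
    (hq : 0 < q) (hqs : q ≤ 2 ^ s) (hp : C.acceptProb ≤ 1 / 2 - 1 / (q : ℝ))
    (hy : (schattenEstimation c).IsEstimate (C.toInstance hs) y) :
    y < ((2 ^ s).centralBinom : ℝ) := by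
  have h := abs_le.1 (C.abs_sub_le_of_isEstimate hs h1 hT hy)
  have hq' : (0 : ℝ) < 1 / q := by positivity
  have : 1 / ((2 ^ s : ℕ) : ℝ) ≤ 1 / q :=
    one_div_le_one_div_of_le (by positivity) (by exact_mod_cast hqs)
  linarith [h.2]

end OneCleanQubitCircuit

end

namespace StackProg

/-! ### The stacks of the reduction -/

/-- The letters on the stacks; they are those of the output. -/
abbrev Letter : Type := Option Bool ⊕ Option Bool

/-- The names of the stacks. -/
inductive Tape : Type
  | x | g | o | out | n | r | r2 | s | w | l | l2 | c | t1 | t2 | t3 | y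
  deriving DecidableEq

instance : Fintype Tape where
  elems := {.x, .g, .o, .out, .n, .r, .r2, .s, .w, .l, .l2, .c, .t1, .t2, .t3, .y}
  complete t := by cases t <;> decide

/-- The contents of the stacks. -/
@[ext] structure Tapes where
  x : List Letter := []
  g : List Letter := []
  o : List Letter := []
  out : List Letter := []
  n : List Letter := []
  r : List Letter := []
  r2 : List Letter := []
  s : List Letter := []
  w : List Letter := []
  l : List Letter := []
  l2 : List Letter := []
  c : List Letter := []
  t1 : List Letter := []
  t2 : List Letter := []
  t3 : List Letter := []
  y : List Letter := []

/-- With the stacks as fields of a record, updates of explicit stacks compute, so most comparisons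
of contents hold by `rfl`; `get` passes to the family of stacks that a machine has. -/
def Tapes.get (s : Tapes) : Tape → List Letter
  | .x => s.x
  | .g => s.g
  | .o => s.o
  | .out => s.out
  | .n => s.n
  | .r => s.r
  | .r2 => s.r2
  | .s => s.s
  | .w => s.w
  | .l => s.l
  | .l2 => s.l2
  | .c => s.c
  | .t1 => s.t1
  | .t2 => s.t2
  | .t3 => s.t3
  | .y => s.y

def Tapes.set (s : Tapes) : Tape → List Letter → Tapes
  | .x, a => { s with x := a }
  | .g, a => { s with g := a }
  | .o, a => { s with o := a }
  | .out, a => { s with out := a }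
  | .n, a => { s with n := a }
  | .r, a => { s with r := a }
  | .r2, a => { s with r2 := a }
  | .s, a => { s with s := a }
  | .w, a => { s with w := a }
  | .l, a => { s with l := a }
  | .l2, a => { s with l2 := a }
  | .c, a => { s with c := a }
  | .t1, a => { s with t1 := a }
  | .t2, a => { s with t2 := a }
  | .t3, a => { s with t3 := a }
  | .y, a => { s with y := a }

namespace Tapes

variable {s : Tapes} {i j k : Tape} {a b : List Letter}

theorem get_injective : Function.Injective get := by
  intro s t h
  exact Tapes.ext (congrFun h .x) (congrFun h .g) (congrFun h .o) (congrFun h .out)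
    (congrFun h .n) (congrFun h .r) (congrFun h .r2) (congrFun h .s) (congrFun h .w)
    (congrFun h .l) (congrFun h .l2) (congrFun h .c) (congrFun h .t1) (congrFun h .t2)
    (congrFun h .t3) (congrFun h .y)

@[simp] theorem get_set_self : (s.set j a).get j = a := by cases j <;> rfl

theorem get_set_of_ne (h : i ≠ j) : (s.set j a).get i = s.get i := by
  cases j <;> cases i <;> first | rfl | exact absurd rfl h

theorem get_set (s : Tapes) (j : Tape) (a : List Letter) :
    (s.set j a).get = Function.update s.get j a := by
  funext i
  by_cases h : i = j
  · subst h; simp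
  · rw [get_set_of_ne h, Function.update_of_ne h]

@[simp] theorem set_set : (s.set j a).set j b = s.set j b := by cases j <;> rfl

theorem set_comm (h : i ≠ j) : (s.set i a).set j b = (s.set j b).set i a := by
  apply get_injective
  simp only [get_set]
  exact Function.update_comm h _ _ _

@[simp] theorem set_get (s : Tapes) (j : Tape) : s.set j (s.get j) = s := by cases j <;> rfl

/-- Append a word to the output. -/
def write (s : Tapes) (v : List Letter) : Tapes := { s with o := v.reverse ++ s.o }

theorem write_write (s : Tapes) (v v' : List Letter) :
    (s.write v).write v' = s.write (v ++ v') := by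
  simp [write]

@[simp] theorem write_nil (s : Tapes) : s.write [] = s := rfl

theorem write_set (h : j ≠ .o) (s : Tapes) (v a : List Letter) :
    (s.write v).set j a = (s.set j a).write v := by
  cases j <;> first | rfl | exact absurd rfl h

theorem get_write (h : j ≠ .o) (s : Tapes) (v : List Letter) :
    (s.write v).get j = s.get j := by
  cases j <;> first | rfl | exact absurd rfl h

end Tapes

/-- Programs on the stacks of the reduction. -/
abbrev Prog : Type 1 := Frag (fun _ : Tape => Letter) (Option Letter)

/-- `F` transforms the contents `s` of the stacks into `s'` in at most `t` steps. -/
def Prog.Runs (F : Prog) (s s' : Tapes) (t : ℕ) : Prop :=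
  Frag.Run (plainRegister Letter) F s.get s'.get t

theorem Prog.Runs.to {F : Prog} {s s' u u' : Tapes} {t t' : ℕ} (h : F.Runs s s' t)
    (hs : s = u) (hs' : s' = u') (ht : t ≤ t') : F.Runs u u' t' := by
  subst hs hs'
  exact h.mono ht

theorem runs_seq {F G : Prog} {s s' s'' : Tapes} {t t' : ℕ} (h : F.Runs s s' t)
    (h' : G.Runs s' s'' t') : Prog.Runs (F ;; G) s s'' (t + t') := seq_run h h'

theorem runs_skip (s : Tapes) : Prog.Runs skip s s 1 := skip_run _

theorem runs_emit (k : Tape) (v : List Letter) (s : Tapes) :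
    Prog.Runs (emit k v) s (s.set k (v.reverse ++ s.get k)) 1 := by
  rw [Prog.Runs, Tapes.get_set]
  exact emit_run _ _ _

theorem runs_emit_o (v : List Letter) (s : Tapes) :
    Prog.Runs (emit .o v) s (s.write v) 1 := runs_emit .o v s

/-- Pop a letter and branch. -/
def pop (k : Tape) (F : Option Letter → Prog) : Prog := popCase (plainRegister Letter) k id F

theorem runs_pop_nil {k : Tape} {F : Option Letter → Prog} {s s' : Tapes} {t : ℕ}
    (hk : s.get k = []) (h : (F none).Runs s s' t) : (pop k F).Runs s s' (t + 1) :=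
  popCase_run_nil hk h

theorem runs_pop_cons {k : Tape} {F : Option Letter → Prog} {s s' : Tapes} {t : ℕ} {a : Letter}
    {l : List Letter} (hk : s.get k = a :: l) (h : (F (some a)).Runs (s.set k l) s' t) :
    (pop k F).Runs s s' (t + 1) := by
  refine popCase_run_cons hk ?_
  rw [Prog.Runs, Tapes.get_set] at h
  exact h

/-- Empty a stack letter by letter. -/
def consume (k : Tape) (F : Letter → Prog) : Prog :=
  loop (plainRegister Letter) k id (fun _ => false) F

theorem runs_consume {k : Tape} {F : Letter → Prog} {τ : ℕ} (L : List Letter)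
    (I : List Letter → List Letter → Tapes) (hI : ∀ p l, (I p l).get k = l)
    (hF : ∀ p a l, p ++ a :: l = L → (F a).Runs ((I p (a :: l)).set k l) (I (p ++ [a]) l) τ) :
    (consume k F).Runs (I [] L) (I L []) (L.length * (τ + 1) + 2) := by
  refine loop_run (ρ := plainRegister Letter) L (fun p l => (I p l).get) hI fun p a l h => ?_
  have := hF p a l h
  rw [Prog.Runs, Tapes.get_set] at this
  exact this

/-- Read a stack until the end of a word. -/
def readWord (k : Tape) (F : Letter → Prog) : Prog :=
  loop (plainRegister Letter) k id (fun a => a = .inl none) F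

theorem runs_readWord {k : Tape} {F : Letter → Prog} {τ : ℕ} (L rest : List Letter)
    (hL : ∀ a ∈ L, a ≠ .inl none) (I : List Letter → List Letter → Tapes)
    (hI : ∀ p l, (I p l).get k = l)
    (hF : ∀ p a l, p ++ a :: l = L →
      (F a).Runs ((I p (a :: l ++ .inl none :: rest)).set k (l ++ .inl none :: rest))
        (I (p ++ [a]) (l ++ .inl none :: rest)) τ) :
    (readWord k F).Runs (I [] (L ++ .inl none :: rest)) ((I L (.inl none :: rest)).set k rest)
      (L.length * (τ + 1) + 2) := by
  suffices H : ∀ l p, p ++ l = L → (readWord k F).Runs (I p (l ++ .inl none :: rest))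
      ((I L (.inl none :: rest)).set k rest) (l.length * (τ + 1) + 2) from H L [] rfl
  intro l
  induction l with
  | nil =>
    intro p hp
    obtain rfl : p = L := by simpa using hp
    have := loop_run_stop (ρ := plainRegister Letter) (k := k) (code := id)
      (last := fun a => a = .inl none) (F := F) (hI p (.inl none :: rest)) (by simp)
    rw [← Tapes.get_set] at this
    exact this.mono (by simp)
  | cons a l ih =>
    intro p hp
    have ha : a ≠ .inl none := hL a (by rw [← hp]; simp)
    have h := hF p a l hp
    rw [Prog.Runs, Tapes.get_set] at h
    have := loop_run_cons (ρ := plainRegister Letter) (k := k) (code := id)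
      (last := fun a => a = .inl none) (F := F) (hI p (a :: l ++ .inl none :: rest))
      (by simpa using ha) h (ih (p ++ [a]) (by simpa using hp))
    refine this.mono ?_
    simp only [List.length_cons]
    ring_nf
    omega

/-- Throw away the contents of a stack. -/
def clear (k : Tape) : Prog := consume k fun _ => skip

theorem runs_clear (k : Tape) (s : Tapes) :
    (clear k).Runs s (s.set k []) ((s.get k).length * 2 + 2) := by
  refine (runs_consume (τ := 1) (s.get k) (fun _ l => s.set k l) (by simp) ?_).to (by simp) rfl
    le_rfl
  intro p a l _
  simp only [Tapes.set_set]
  exact runs_skip _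

/-- Move a stack onto another one, in reverse order. -/
def move (k k' : Tape) : Prog := consume k fun a => emit k' [a]

theorem runs_move {k k' : Tape} (h : k ≠ k') (s : Tapes) :
    (move k k').Runs s ((s.set k []).set k' ((s.get k).reverse ++ s.get k'))
      ((s.get k).length * 2 + 2) := by
  refine (runs_consume (τ := 1) (s.get k)
    (fun p l => (s.set k l).set k' (p.reverse ++ s.get k')) ?_ ?_).to ?_ rfl le_rfl
  · intro p l
    rw [Tapes.get_set_of_ne h, Tapes.get_set_self]
  · intro p a l _
    refine (runs_emit _ _ _).to rfl ?_ le_rfl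
    rw [Tapes.get_set_of_ne h.symm, Tapes.get_set_self, Tapes.set_comm h.symm, Tapes.set_set,
      Tapes.set_set]
    simp
  · rw [List.reverse_nil, List.nil_append, Tapes.set_get]
    conv_lhs => rw [← Tapes.get_set_of_ne (s := s) (a := s.get k) h.symm]
    rw [Tapes.set_get, Tapes.set_get]

/-- Run through a stack without changing it. -/
def each (k tmp : Tape) (F : Letter → Prog) : Prog :=
  consume k (fun a => emit tmp [a] ;; F a) ;; move tmp k

/-- While the body runs, the letters read so far lie reversed on `tmp`, and the final move restores
`k`. Besides the body, a letter costs four steps: the pop, the push onto `tmp` and two for moving it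
back. -/
theorem runs_each {k tmp : Tape} (h : k ≠ tmp) {F : Letter → Prog} {τ : ℕ} (L : List Letter)
    (I : List Letter → Tapes)
    (hF : ∀ p a l, p ++ a :: l = L →
      (F a).Runs (((I p).set k l).set tmp (a :: p.reverse))
        (((I (p ++ [a])).set k l).set tmp (a :: p.reverse)) τ) :
    (each k tmp F).Runs (((I []).set k L).set tmp []) (((I L).set k L).set tmp [])
      (L.length * (τ + 4) + 4) := by
  have h1 := runs_consume (τ := 1 + τ) (F := fun a => emit tmp [a] ;; F a) (k := k) L
    (fun p l => ((I p).set k l).set tmp p.reverse)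
    (fun p l => by rw [Tapes.get_set_of_ne h, Tapes.get_set_self]) (by
      intro p a l hp
      refine runs_seq (runs_emit _ _ _) ((hF p a l hp).to ?_ ?_ le_rfl)
      · rw [Tapes.get_set_of_ne h.symm, Tapes.get_set_self, Tapes.set_comm h.symm, Tapes.set_set,
          Tapes.set_set]
        simp
      · simp)
  refine (runs_seq h1 (runs_move h.symm _)).to rfl ?_ ?_
  · rw [Tapes.get_set_self, Tapes.get_set_of_ne h, Tapes.get_set_self, Tapes.set_set,
      Tapes.set_comm h.symm, Tapes.set_set]
    simp
  · rw [Tapes.get_set_self, List.length_reverse]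
    ring_nf
    omega

/-- A loop whose body only writes to the output only writes to the output. -/
theorem runs_each_write {k tmp : Tape} (h : k ≠ tmp) (hk : k ≠ .o) (ht : tmp ≠ .o)
    {F : Letter → Prog} {f : Letter → List Letter} {τ : ℕ} {s : Tapes} (hs : s.get tmp = [])
    (hF : ∀ a ∈ s.get k, ∀ v l t, (F a).Runs (((s.write v).set k l).set tmp t)
      ((((s.write v).set k l).set tmp t).write (f a)) τ) :
    (each k tmp F).Runs s (s.write ((s.get k).flatMap f)) ((s.get k).length * (τ + 4) + 4) := by
  refine (runs_each (τ := τ) h (s.get k) (fun p => s.write (p.flatMap f)) fun p a l hp => ?_).to ?_ ?_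
    le_rfl
  · refine (hF a (by rw [← hp]; simp) _ _ _).to rfl ?_ le_rfl
    rw [← Tapes.write_set ht, ← Tapes.write_set hk, Tapes.write_write, List.flatMap_append]
    simp
  · rw [List.flatMap_nil, Tapes.write_nil, Tapes.set_get, ← hs, Tapes.set_get]
  · have h1 := Tapes.set_get (s.write ((s.get k).flatMap f)) k
    have h2 := Tapes.set_get (s.write ((s.get k).flatMap f)) tmp
    rw [Tapes.get_write hk] at h1
    rw [Tapes.get_write ht, hs] at h2
    rw [h1, h2]

/-- One program after the other. -/
def seqMap {ι : Type} (l : List ι) (F : ι → Prog) : Prog := l.foldr (fun i G => F i ;; G) skip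

theorem runs_seqMap_write {ι : Type} (l : List ι) {F : ι → Prog} {f : ι → List Letter} {τ : ℕ}
    {s : Tapes} (hF : ∀ i ∈ l, ∀ v, (F i).Runs (s.write v) ((s.write v).write (f i)) τ) :
    (seqMap l F).Runs s (s.write (l.flatMap f)) (l.length * τ + 1) := by
  suffices H : ∀ v, (seqMap l F).Runs (s.write v) ((s.write v).write (l.flatMap f))
      (l.length * τ + 1) from H []
  induction l with
  | nil => exact fun v => (runs_skip _).to rfl (by simp) (by omega)
  | cons i l ih =>
    intro v
    have h1 := hF i (by simp) v
    rw [Tapes.write_write] at h1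
    refine (runs_seq h1 (ih (fun j hj => hF j (by simp [hj])) (v ++ f i))).to rfl ?_ ?_
    · simp [Tapes.write_write]
    · simp only [List.length_cons]
      ring_nf
      omega

end StackProg

/-! ### The words of a term -/

theorem joinWords_append (a b : List (List Bool)) :
    joinWords (a ++ b) = joinWords a ++ joinWords b := List.flatMap_append

theorem joinWords_flatMap {ι : Type} (l : List ι) (f : ι → List (List Bool)) :
    joinWords (l.flatMap f) = l.flatMap fun i => joinWords (f i) := List.flatMap_assoc

/-- The state of `k` qubits that shows the last `k` binary digits of `r`. -/
def bitsOf (k r : ℕ) : Basis k := fun i => ⟨r / 2 ^ (i : ℕ) % 2, Nat.mod_lt _ two_pos⟩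

theorem basisState_eq_bitsOf {k : ℕ} (r : Fin (2 ^ k)) : basisState r = bitsOf k r := by
  funext i
  apply Fin.ext
  simp [basisState, bitsOf, finFunctionFinEquiv]

theorem clockVal_bitsOf {s i : ℕ} (hi : i < 2 ^ s) : clockVal (bitsOf s i) = i := by
  have := basisState_eq_bitsOf (⟨i, hi⟩ : Fin (2 ^ s))
  rw [clockVal, ← this, basisState, Equiv.apply_symm_apply]

/-- The qubits of the gate come first and so carry the low digits of a row number; those of the
clock carry the high digits. -/
theorem bitsOf_comp_castAdd {m a : ℕ} (s i : ℕ) :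
    bitsOf (m + s) (a + 2 ^ m * i) ∘ Fin.castAdd s = bitsOf m a := by
  funext j
  apply Fin.ext
  change (a + 2 ^ m * i) / 2 ^ (j : ℕ) % 2 = a / 2 ^ (j : ℕ) % 2
  have hm : 2 ^ m = 2 ^ (j : ℕ) * (2 * 2 ^ (m - j - 1)) := by
    rw [← pow_succ', ← pow_add]
    congr 1
    omega
  rw [hm, mul_assoc, Nat.add_mul_div_left _ _ (by positivity), mul_assoc, Nat.add_mul_mod_self_left]

theorem bitsOf_comp_natAdd {m a : ℕ} (ha : a < 2 ^ m) (s i : ℕ) :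
    bitsOf (m + s) (a + 2 ^ m * i) ∘ Fin.natAdd m = bitsOf s i := by
  funext j
  apply Fin.ext
  change (a + 2 ^ m * i) / 2 ^ (m + (j : ℕ)) % 2 = i / 2 ^ (j : ℕ) % 2
  rw [pow_add, ← Nat.div_div_eq_div_mul, Nat.add_mul_div_left _ _ (by positivity),
    Nat.div_eq_of_lt ha, zero_add]

theorem flatMap_range_mul {β : Type} (f : ℕ → List β) (a b : ℕ) :
    (List.range (a * b)).flatMap f =
      (List.range b).flatMap fun i => (List.range a).flatMap fun j => f (j + a * i) := by
  induction b with
  | zero => simp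
  | succ b ih =>
    rw [Nat.mul_succ, List.range_add, List.flatMap_append, ih, List.range_succ,
      List.flatMap_append, List.flatMap_map]
    simp [add_comm]

theorem flatMap_finRange {β : Type} (f : ℕ → List β) (n : ℕ) :
    (List.finRange n).flatMap (fun i : Fin n => f i) = (List.range n).flatMap f := by
  rw [← List.map_coe_finRange_eq_range, List.flatMap_map]

theorem matWords_eq {k : ℕ} (B : Matrix (Basis k) (Basis k) (ℚ × ℚ)) :
    matWords B = (List.range (2 ^ k)).flatMap fun r => (List.range (2 ^ k)).flatMap fun c =>
      gaussianWords (B (bitsOf k r) (bitsOf k c)) := by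
  rw [← flatMap_finRange]
  simp only [← flatMap_finRange]
  simp only [matWords, List.ofFn_eq_map, List.flatMap_map, basisState_eq_bitsOf]

/-- The clock holds the high digits of both indices, so the order of the entries is that of four
nested loops: clock and gate for the row, clock and gate for the column. A program can write it by
passing over the marks, without arithmetic on positions. -/
theorem matWords_stepMat (κ : StepKind) (s : ℕ) (μ : ℕ → Option Bool) :
    matWords (stepMat κ s μ) = (List.range (2 ^ s)).flatMap fun i =>
      (List.range (2 ^ κ.arity)).flatMap fun a => (List.range (2 ^ s)).flatMap fun j =>
        (List.range (2 ^ κ.arity)).flatMap fun b =>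
          gaussianWords (κ.entry (μ i) (μ j) (bitsOf κ.arity a) (bitsOf κ.arity b)) := by
  rw [matWords_eq, pow_add, flatMap_range_mul]
  simp only [flatMap_range_mul]
  refine List.flatMap_congr fun i hi => List.flatMap_congr fun a ha =>
    List.flatMap_congr fun j hj => List.flatMap_congr fun b hb => ?_
  rw [List.mem_range] at hi ha hj hb
  simp only [stepMat]
  rw [bitsOf_comp_castAdd, bitsOf_comp_castAdd, bitsOf_comp_natAdd ha, bitsOf_comp_natAdd hb,
    clockVal_bitsOf hi, clockVal_bitsOf hj]

theorem wiresWords_eq {k n : ℕ} (e : Fin k ↪ Fin n) :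
    wiresWords e = (List.ofFn fun i => (e i : ℕ)).map unaryEncodeNat := by
  rw [wiresWords, ← List.map_eq_flatMap, List.ofFn_eq_map, List.ofFn_eq_map, List.map_map,
    List.map_map]
  rfl

namespace StackProg

/-- A list of words, as letters of the first part of the output. -/
def enc (ws : List (List Bool)) : List Letter := (joinWords ws).map .inl

theorem enc_append (a b : List (List Bool)) : enc (a ++ b) = enc a ++ enc b := by
  rw [enc, joinWords_append, List.map_append, enc, enc]

theorem enc_flatMap {ι : Type} (l : List ι) (f : ι → List (List Bool)) :
    enc (l.flatMap f) = l.flatMap fun i => enc (f i) := by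
  rw [enc, joinWords_flatMap, List.map_flatMap]
  rfl

theorem enc_cons (a : List Bool) (l : List (List Bool)) :
    enc (a :: l) = a.map (fun b => .inl (some b)) ++ .inl none :: enc l := by
  simp [enc, joinWords]

@[simp] theorem enc_nil : enc [] = [] := rfl

/-- `n` copies of the letter that stands for one. -/
def ones (n : ℕ) : List Letter := List.replicate n (.inl (some true))

@[simp] theorem length_ones (n : ℕ) : (ones n).length = n := List.length_replicate

theorem ones_add (m n : ℕ) : ones (m + n) = ones m ++ ones n := List.replicate_add _ _ _

theorem ones_succ (n : ℕ) : ones (n + 1) = .inl (some true) :: ones n := List.replicate_succ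

@[simp] theorem reverse_ones (n : ℕ) : (ones n).reverse = ones n := List.reverse_replicate

theorem enc_unary (n : ℕ) : enc [unaryEncodeNat n] = ones n ++ [.inl none] := by
  rw [enc_cons]
  congr 1
  induction n with
  | zero => rfl
  | succ n ih => rw [ones_succ, ← ih]; rfl

theorem flatMap_ones (n c : ℕ) : ((ones n).flatMap fun _ => ones c) = ones (n * c) := by
  induction n with
  | zero => simp [ones]
  | succ n ih => rw [ones_succ, List.flatMap_cons, ih, ← ones_add, Nat.succ_mul, add_comm]

/-! ### Programs that write a term -/

theorem runs_each_emit {k tmp : Tape} (h : k ≠ tmp) (hk : k ≠ .o) (ht : tmp ≠ .o)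
    (v : List Letter) {s : Tapes} (hs : s.get tmp = []) :
    (each k tmp fun _ => emit .o v).Runs s (s.write ((s.get k).flatMap fun _ => v))
      ((s.get k).length * 5 + 4) :=
  runs_each_write h hk ht hs fun _ _ _ _ _ => runs_emit_o _ _

theorem runs_each_emit_ones {k tmp : Tape} (h : k ≠ tmp) (hk : k ≠ .o) (ht : tmp ≠ .o)
    (c : ℕ) {n : ℕ} {s : Tapes} (hn : s.get k = ones n) (hs : s.get tmp = []) :
    (each k tmp fun _ => emit .o (ones c)).Runs s (s.write (ones (n * c))) (n * 5 + 4) := by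
  have := runs_each_emit h hk ht (ones c) hs
  rw [hn, flatMap_ones, length_ones] at this
  exact this

/-- Copy a word from the circuit to the output. -/
def copyWord : Prog := readWord .g (fun a => emit .o [a]) ;; emit .o [.inl none]

theorem runs_copyWord (v : List Bool) (rest : List Letter) {s : Tapes}
    (hs : s.g = enc [v] ++ rest) :
    copyWord.Runs s ({ s with g := rest }.write (enc [v])) ((enc [v]).length * 3) := by
  have e : enc [v] = v.map (fun b => .inl (some b)) ++ [.inl none] := by
    rw [enc_cons, enc_nil]
  have h := runs_readWord (k := .g) (F := fun a => emit .o [a]) (τ := 1)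
    (v.map fun b => .inl (some b)) rest (by
      intro a ha
      obtain ⟨b, -, rfl⟩ := List.mem_map.1 ha
      simp) (fun p l => { s.write p with g := l })
    (fun _ _ => rfl) (by
      intro p a l _
      refine (runs_emit_o _ _).to rfl ?_ le_rfl
      simp [Tapes.write, Tapes.set])
  refine (runs_seq h (runs_emit_o _ _)).to ?_ ?_ ?_
  · simp only [Tapes.write_nil]
    rw [e, List.append_assoc] at hs
    simp only [List.singleton_append] at hs
    rw [← hs]
  · rw [e, ← Tapes.write_write]
    rfl
  · rw [e]
    simp
    omega

/-- Copy several words from the circuit to the output. -/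
def copyWords : ℕ → Prog
  | 0 => skip
  | n + 1 => copyWord ;; copyWords n

theorem runs_copyWords (ws : List (List Bool)) (rest : List Letter) {s : Tapes}
    (hs : s.g = enc ws ++ rest) :
    (copyWords ws.length).Runs s ({ s with g := rest }.write (enc ws))
      ((enc ws).length * 3 + 1) := by
  induction ws generalizing s with
  | nil => exact (runs_skip s).to rfl (by rw [show rest = s.g from hs.symm]; rfl) (by simp)
  | cons v ws ih =>
    have e : enc (v :: ws) = enc [v] ++ enc ws := enc_append [v] ws
    rw [e, List.append_assoc] at hs
    refine (runs_seq (runs_copyWord v _ hs) (ih (by rfl))).to rfl ?_ ?_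
    · rw [e, ← Tapes.write_write]
      rfl
    · rw [e, List.length_append]
      omega

/-- Write the qubits of the clock. -/
def clockWords : Prog :=
  each .s .t1 (fun _ => emit .w (ones 1) ;; each .w .t2 (fun _ => emit .o (ones 1)) ;;
    emit .o [.inl none]) ;;
  each .s .t1 fun _ => pop .w fun _ => skip

/-- Pass `i` lengthens `w` by one letter before copying it, so it writes `m + 1 + i`; the second
loop removes the added letters. As in the lemmas below, `τ` is chosen before all the data, so the
bound is uniform in the circuit and the step. -/
theorem runs_clockWords : ∃ τ : Polynomial ℕ, ∀ M σ m (s : Tapes), s.s = ones σ → s.w = ones m →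
    s.t1 = [] → s.t2 = [] → σ ≤ M → m ≤ M →
    clockWords.Runs s (s.write (enc ((List.range σ).map fun i => unaryEncodeNat (m + 1 + i))))
      (τ.eval M) := by
  refine ⟨(Polynomial.X * (Polynomial.X * 10 + 21) + 8), ?_⟩
  intro M σ m s hS hw h1 h2 hσ hm
  let f : ℕ → List Letter := fun n => enc ((List.range n).map fun i => unaryEncodeNat (m + 1 + i))
  have hf : ∀ n, f (n + 1) = f n ++ ones (m + n + 1) ++ [.inl none] := by
    intro n
    simp only [f, List.range_succ, List.map_append, enc_append, List.map_singleton, enc_unary]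
    rw [add_right_comm]
    simp
  have ha := runs_each (k := .s) (tmp := .t1) (by decide) (F := fun _ => emit .w (ones 1) ;;
    each .w .t2 (fun _ => emit .o (ones 1)) ;; emit .o [.inl none]) (τ := M * 10 + 11) (ones σ)
    (fun p => { s.write (f p.length) with w := ones (m + p.length) }) (by
      intro p a l hp
      have hpl : p.length + 1 ≤ σ := by
        have := congrArg List.length hp
        simp at this
        omega
      refine (runs_seq (runs_emit _ _ _) <| runs_seq
        (runs_each_emit_ones (n := m + p.length + 1) (by decide) (by decide) (by decide) 1 ?_ ?_)
        (runs_emit_o _ _)).to rfl ?_ ?_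
      · change (ones 1).reverse ++ ones (m + p.length) = _
        rw [reverse_ones, ← ones_add, add_comm]
      · exact h2
      · rw [Tapes.write_write, List.length_append, List.length_singleton, hf, mul_one]
        simp only [Tapes.set, Tapes.write, Tapes.get, List.reverse_append, List.append_assoc,
          reverse_ones]
        rw [← ones_add, show 1 + (m + p.length) = m + (p.length + 1) by omega]
      · omega)
  have hb := runs_each (k := .s) (tmp := .t1) (by decide) (F := fun _ => pop .w fun _ => skip)
    (τ := 2) (ones σ) (fun p => { s.write (f σ) with w := ones (m + (σ - p.length)) }) (by
      intro p a l hp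
      have hpl : p.length + 1 ≤ σ := by
        have := congrArg List.length hp
        simp at this
        omega
      refine (runs_pop_cons (l := ones (m + (σ - (p.length + 1)))) (a := .inl (some true)) ?_
        (runs_skip _)).to rfl ?_ le_rfl
      · change ones (m + (σ - p.length)) = _
        rw [← ones_succ]
        congr 1
        omega
      · rw [List.length_append, List.length_singleton]
        rfl)
  refine (runs_seq (ha.to ?_ ?_ le_rfl) (hb.to rfl ?_ le_rfl)).to rfl rfl ?_
  · cases s
    simp only at hS hw h1 h2
    subst hS hw h1 h2
    rfl
  · simp [Tapes.set]
  · simp only [length_ones, Nat.sub_self, add_zero]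
    cases s
    simp only at hS hw h1 h2
    subst hS hw h1 h2
    rfl
  · simp only [length_ones, Polynomial.eval_add, Polynomial.eval_mul, Polynomial.eval_X,
      Polynomial.eval_ofNat]
    have : σ * (M * 10 + 21) ≤ M * (M * 10 + 21) := Nat.mul_le_mul_right _ hσ
    linarith

/-- The mark that a letter stands for. -/
def letterMark : Letter → Option Bool := Sum.elim id fun _ => none

/-- A part of a row of the matrix of a step. -/
def rowWords (κ : StepKind) (u v : Option Bool) (a : ℕ) : List (List Bool) :=
  (List.range (2 ^ κ.arity)).flatMap fun b =>
    gaussianWords (κ.entry u v (bitsOf κ.arity a) (bitsOf κ.arity b))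

/-- Write the matrix of a step. -/
def matrixProg (κ : StepKind) : Prog :=
  each .l .t1 fun u => seqMap (List.range (2 ^ κ.arity)) fun a =>
    each .l2 .t2 fun v => emit .o (enc (rowWords κ (letterMark u) (letterMark v) a))

/-- The marks on a clock with `R` positions, as letters. -/
def marks (R : ℕ) (μ : ℕ → Option Bool) : List Letter := (List.range R).map fun i => .inl (μ i)

theorem runs_matrixProg : ∃ τ : Polynomial ℕ, ∀ M (κ : StepKind) σ μ (s : Tapes),
    s.l = marks (2 ^ σ) μ → s.l2 = marks (2 ^ σ) μ → s.t1 = [] → s.t2 = [] → 2 ^ σ ≤ M →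
    (matrixProg κ).Runs s (s.write (enc (matWords (stepMat κ σ μ)))) (τ.eval M) := by
  -- The 8 bounds `2 ^ κ.arity`, as gates act on at most three qubits.
  refine ⟨Polynomial.X * (8 * (Polynomial.X * 5 + 4) + 1 + 4) + 4, ?_⟩
  intro M κ σ μ s hl hl2 h1 h2 hM
  have hlen : (marks (2 ^ σ) μ).length = 2 ^ σ := by simp [marks]
  have hrow : ∀ u (s' : Tapes), s'.l2 = marks (2 ^ σ) μ → s'.t2 = [] →
      (seqMap (List.range (2 ^ κ.arity)) fun a => each .l2 .t2 fun v =>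
        emit .o (enc (rowWords κ (letterMark u) (letterMark v) a))).Runs s'
      (s'.write ((List.range (2 ^ κ.arity)).flatMap fun a => (marks (2 ^ σ) μ).flatMap fun v =>
        enc (rowWords κ (letterMark u) (letterMark v) a))) (8 * (M * 5 + 4) + 1) := by
    intro u s' h h'
    refine (runs_seqMap_write (τ := M * 5 + 4) (List.range (2 ^ κ.arity))
      (f := fun a => (marks (2 ^ σ) μ).flatMap fun v =>
        enc (rowWords κ (letterMark u) (letterMark v) a)) ?_).to rfl rfl ?_
    · intro a _ v
      refine (runs_each_write (τ := 1) (k := .l2) (tmp := .t2) (s := s'.write v) (f := fun v =>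
        enc (rowWords κ (letterMark u) (letterMark v) a)) (by decide) (by decide) (by decide) h'
        fun _ _ _ _ _ => runs_emit_o _ _).to rfl ?_ ?_
      · change ((s'.write v).write (List.flatMap _ s'.l2)) = _
        rw [h]
      · change s'.l2.length * _ + _ ≤ _
        rw [h, hlen]
        omega
    · have h8 : 2 ^ κ.arity ≤ 2 ^ 3 := Nat.pow_le_pow_right two_pos κ.arity_le
      rw [List.length_range]
      gcongr
      omega
  refine (runs_each_write (k := .l) (tmp := .t1) (by decide) (by decide) (by decide) h1
    fun u _ v l t => hrow u _ hl2 h2).to rfl ?_ ?_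
  · congr 1
    change (List.flatMap _ s.l) = _
    rw [hl, matWords_stepMat]
    simp only [enc_flatMap, marks, List.flatMap_map, letterMark, Sum.elim_inl, id, rowWords]
  · change s.l.length * _ + _ ≤ _
    rw [hl, hlen]
    simp only [Polynomial.eval_add, Polynomial.eval_mul, Polynomial.eval_X,
      Polynomial.eval_ofNat, Polynomial.eval_one]
    gcongr

/-- Write the term of a step, where `P` writes the qubits of the gate. -/
def termProg (κ : StepKind) (P : Prog) : Prog :=
  emit .o (ones κ.arity) ;; each .s .t1 (fun _ => emit .o (ones 1)) ;; emit .o [.inl none] ;;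
    P ;; clockWords ;; matrixProg κ

/-- `P` runs in the middle of the program, so it has to work after any output `v`; it may use up
letters of `g` but leaves the other stacks alone. -/
theorem runs_termProg : ∃ τ : Polynomial ℕ, ∀ M (κ : StepKind) σ m μ (P : Prog) t g
    (ws : List (List Bool)) (s : Tapes),
    s.l = marks (2 ^ σ) μ → s.l2 = marks (2 ^ σ) μ → s.s = ones σ → s.w = ones m →
    s.t1 = [] → s.t2 = [] → 2 ^ σ ≤ M → m ≤ M →
    (∀ v, P.Runs (s.write v) (({ s with g := g }.write v).write (enc ws)) t) →
    (termProg κ P).Runs s ({ s with g := g }.write (enc (unaryEncodeNat (κ.arity + σ) ::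
      (ws ++ (List.range σ).map (fun i => unaryEncodeNat (m + 1 + i)) ++
        matWords (stepMat κ σ μ))))) (τ.eval M + t) := by
  obtain ⟨τ₁, h₁⟩ := runs_clockWords
  obtain ⟨τ₂, h₂⟩ := runs_matrixProg
  refine ⟨τ₁ + τ₂ + Polynomial.X * 5 + 6, ?_⟩
  intro M κ σ m μ P t g ws s hl hl2 hs hw ht1 ht2 hσ hm hP
  have hσM : σ ≤ M := (Nat.lt_two_pow_self.le).trans hσ
  refine (runs_seq (runs_emit_o _ _) <| runs_seq (runs_each_emit_ones (k := .s) (tmp := .t1)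
    (by decide) (by decide) (by decide) 1 (n := σ) hs ht1) <| runs_seq (runs_emit_o _ _) <|
    runs_seq ((hP (ones κ.arity ++ ones (σ * 1) ++ [.inl none])).to ?_ rfl le_rfl) <|
    runs_seq (h₁ M σ m _ hs hw ht1 ht2 hσM hm) (h₂ M κ σ μ _ hl hl2 ht1 ht2 hσ)).to rfl ?_ ?_
  · rw [Tapes.write_write, Tapes.write_write, List.append_assoc]
  · rw [Tapes.write_write, Tapes.write_write, Tapes.write_write]
    congr 1
    rw [← List.singleton_append (x := unaryEncodeNat _), enc_append, enc_append, enc_append,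
      enc_unary, ones_add]
    simp
  · simp only [Polynomial.eval_add, Polynomial.eval_mul, Polynomial.eval_X,
      Polynomial.eval_ofNat]
    omega

end StackProg

/-! ### The words of the Hamiltonian of a circuit -/

theorem wiresWords_appendEmb {a b n : ℕ} (f : Fin a ↪ Fin n) (g : Fin b ↪ Fin n)
    (h : ∀ i j, f i ≠ g j) : wiresWords (appendEmb f g h) = wiresWords f ++ wiresWords g := by
  have e : (appendEmb f g h : Fin (a + b) → Fin n) = Fin.append f g := rfl
  rw [wiresWords, e, List.ofFn_fin_append, List.flatMap_append]
  rfl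

theorem LocalTerm.words_ofStep {n s : ℕ} (κ : StepKind) (wires : Fin κ.arity ↪ Fin n)
    (clk : Fin s ↪ Fin n) (h : ∀ i j, wires i ≠ clk j) (μ : ℕ → Option Bool) :
    (LocalTerm.ofStep κ wires clk h μ).words = unaryEncodeNat (κ.arity + s) ::
      (wiresWords wires ++ wiresWords clk ++ matWords (stepMat κ s μ)) := by
  change unaryEncodeNat (κ.arity + s) :: (wiresWords (appendEmb wires clk h) ++ _) = _
  rw [wiresWords_appendEmb]
  rfl

namespace OneCleanQubitCircuit

variable (C : OneCleanQubitCircuit) {s : ℕ} (hs : C.mixed + 2 + s ≤ 4 * 2 ^ s)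

theorem wiresWords_clockWire : wiresWords (C.clockWire hs) =
    (List.range s).map fun i => unaryEncodeNat (C.mixed + 1 + 1 + i) := by
  rw [wiresWords_eq, List.ofFn_eq_map, List.map_map, ← List.map_coe_finRange_eq_range, List.map_map]
  rfl

theorem words_endTerm : (C.endTerm hs).words = unaryEncodeNat (StepKind.ends.arity + s) ::
    ([unaryEncodeNat 0, unaryEncodeNat (C.mixed + 1)] ++
      (List.range s).map (fun i => unaryEncodeNat (C.mixed + 1 + 1 + i)) ++
      matWords (stepMat .ends s (endMark (2 ^ s)))) := by
  rw [endTerm, LocalTerm.words_ofStep, wiresWords_clockWire]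
  rfl

theorem words_stepTerm (t : ℕ) : (C.stepTerm hs t).words =
    unaryEncodeNat ((stepKind C.gates[t]?).arity + s) :: (wiresWords (stepWires C.gates[t]?) ++
      (List.range s).map (fun i => unaryEncodeNat (C.mixed + 1 + 1 + i)) ++
      matWords (stepMat (stepKind C.gates[t]?) s (stepMark t))) := by
  rw [stepTerm, LocalTerm.words_ofStep, wiresWords_clockWire]
  congr 3
  rw [wiresWords_eq, wiresWords_eq]
  rfl

end OneCleanQubitCircuit

theorem length_wiresWords {k n : ℕ} (e : Fin k ↪ Fin n) : (wiresWords e).length = k := by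
  rw [wiresWords_eq, List.length_map, List.length_ofFn]

namespace StackProg

/-! ### Programs that write all the terms -/

/-- The gate with a given tag. -/
def kindOf (a b : Letter) : GateKind :=
  if a = .inl (some true) then (if b = .inl (some true) then .toffoli else .cnot)
  else if b = .inl (some true) then .phase else .hadamard

/-- Read a gate, and write the term of the step. -/
def stepProg : Prog :=
  pop .g fun a => match a with
    | none => termProg .idle skip
    | some a => pop .g fun b => match b with
      -- Not reached on a proper encoding, because a tag has two letters.
      | none => skip
      | some b => pop .g fun _ => termProg (.gate (kindOf a b)) (copyWords (kindOf a b).arity)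

/-- If `g` is empty, all the gates have been used and the step is idle. Otherwise three pops remove
the two letters of the tag and its end marker. The words of the wires are copied unchanged, because
the qubits of the circuit keep their numbers in the larger system. -/
theorem runs_stepProg : ∃ τ : Polynomial ℕ, ∀ M (C : OneCleanQubitCircuit) σ
    (hs : C.mixed + 2 + σ ≤ 4 * 2 ^ σ) t (s : Tapes),
    s.l = marks (2 ^ σ) (stepMark t) → s.l2 = marks (2 ^ σ) (stepMark t) → s.s = ones σ →
    s.w = ones (C.mixed + 1) → s.t1 = [] → s.t2 = [] → 2 ^ σ ≤ M → C.mixed + 1 ≤ M →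
    s.g = enc ((C.gates.drop t).flatMap Gate.words) → s.g.length ≤ M →
    stepProg.Runs s ({ s with g := enc ((C.gates.drop (t + 1)).flatMap Gate.words) }.write
      (enc (C.stepTerm hs t).words)) (τ.eval M) := by
  obtain ⟨τ, h⟩ := runs_termProg
  refine ⟨τ + Polynomial.X * 3 + 4, ?_⟩
  intro M C σ hs t s hl hl2 hS hw ht1 ht2 hσ hm hg hgM
  rw [C.words_stepTerm hs]
  simp only [Polynomial.eval_add, Polynomial.eval_mul, Polynomial.eval_X, Polynomial.eval_ofNat]
  rcases hgt : C.gates[t]? with _ | g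
  · have hlen : C.gates.length ≤ t := List.getElem?_eq_none_iff.1 hgt
    rw [List.drop_eq_nil_of_le hlen] at hg
    rw [List.drop_eq_nil_of_le (by omega)]
    refine (runs_pop_nil (k := .g) (s := s) hg (h M .idle σ (C.mixed + 1) (stepMark t) skip 1 []
      [] s hl hl2 hS hw ht1 ht2 hσ hm ?_)).to rfl ?_ (by omega)
    · intro v
      refine (runs_skip _).to rfl ?_ le_rfl
      have : { s with g := [] } = s := by
        cases s
        simp only at hg
        subst hg
        rfl
      rw [this]
      rfl
    · have : wiresWords (stepWires (none : Option (Gate (C.mixed + 1)))) = [] :=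
        List.eq_nil_of_length_eq_zero (length_wiresWords _)
      rw [this]
      rfl
  · obtain ⟨hlt, hget⟩ := List.getElem?_eq_some_iff.1 hgt
    obtain ⟨a, b, htag, hkind⟩ : ∃ a b, g.kind.tag = [a, b] ∧
        kindOf (.inl (some a)) (.inl (some b)) = g.kind := by
      rcases g with ⟨k, w⟩
      cases k <;> exact ⟨_, _, rfl, by simp [kindOf]⟩
    have hdrop : C.gates.drop t = g :: C.gates.drop (t + 1) := by
      rw [List.drop_eq_getElem_cons hlt, hget]
    have hg' : s.g = .inl (some a) :: .inl (some b) :: .inl none ::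
        (enc (wiresWords g.wires) ++ enc ((C.gates.drop (t + 1)).flatMap Gate.words)) := by
      rw [hg, hdrop, List.flatMap_cons, enc_append, Gate.words, enc_cons, htag]
      rfl
    have hlen := congrArg List.length hg'
    simp only [List.length_cons, List.length_append] at hlen
    refine (runs_pop_cons hg' <| runs_pop_cons (s := s.set .g _) rfl <|
      runs_pop_cons (s := (s.set .g _).set .g _) rfl <| ?_ :
      stepProg.Runs s _ (τ.eval M + ((enc (wiresWords g.wires)).length * 3 + 1) + 1 + 1 + 1)).to
      rfl rfl (by omega)
    rw [hkind]
    refine (h M (.gate g.kind) σ (C.mixed + 1) (stepMark t) (copyWords g.kind.arity) _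
      (enc ((C.gates.drop (t + 1)).flatMap Gate.words)) (wiresWords g.wires) { s with
        g := enc (wiresWords g.wires) ++ enc ((C.gates.drop (t + 1)).flatMap Gate.words) } hl hl2 hS hw ht1
      ht2 hσ hm ?_).to rfl ?_ le_rfl
    · intro v
      have := runs_copyWords (wiresWords g.wires)
        (enc ((C.gates.drop (t + 1)).flatMap Gate.words))
        (s := { s with
          g := enc (wiresWords g.wires) ++ enc ((C.gates.drop (t + 1)).flatMap Gate.words)
          o := v.reverse ++ s.o }) rfl
      rw [length_wiresWords] at this
      exact this
    · rfl

/-! ### Lists of marks on the clock positions -/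

theorem marks_succ (R t : ℕ) :
    marks (R + 1) (stepMark (t + 1)) = .inl none :: marks R (stepMark t) := by
  have : ∀ i, stepMark (t + 1) (i + 1) = stepMark t i := by
    intro i
    simp only [stepMark, Nat.add_right_cancel_iff]
  rw [marks, List.range_succ_eq_map, List.map_cons, List.map_map]
  refine congrArg₂ List.cons ?_ (List.map_congr_left fun i _ => congrArg Sum.inl (this i))
  simp [stepMark]

theorem marks_succ_eq_append (R : ℕ) (μ : ℕ → Option Bool) :
    marks (R + 1) μ = marks R μ ++ [.inl (μ R)] := by
  rw [marks, List.range_succ, List.map_append]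
  rfl

theorem length_marks (R : ℕ) (μ : ℕ → Option Bool) : (marks R μ).length = R := by simp [marks]

/-- Pass to the marks of the next step. -/
def shiftMarks (k : Tape) : Prog :=
  move k .t3 ;; pop .t3 (fun _ => skip) ;; move .t3 k ;; emit k [.inl none]

/-- The marks of the next step arise by deleting the last letter and putting `none` in front, by
`marks_succ_eq_append` and `marks_succ`. The detour over `t3` makes the last letter accessible. -/
theorem runs_shiftMarks {k : Tape} (hk : k ≠ .t3) (R t : ℕ) {s : Tapes} (h3 : s.t3 = [])
    (hs : s.get k = marks (R + 1) (stepMark t)) :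
    (shiftMarks k).Runs s (s.set k (marks (R + 1) (stepMark (t + 1)))) (4 * R + 9) := by
  have h3' : s.get .t3 = [] := h3
  rw [marks_succ_eq_append] at hs
  have hlen := length_marks R (stepMark t)
  refine (runs_seq (runs_move hk s) <| runs_seq (runs_pop_cons (a := .inl (stepMark t R))
    (l := (marks R (stepMark t)).reverse) ?_ (runs_skip _)) <| runs_seq (runs_move hk.symm _) <|
    runs_emit _ _ _).to rfl ?_ ?_
  · rw [Tapes.get_set_self, hs, h3']
    simp
  · rw [marks_succ]
    simp only [Tapes.get_set_self, Tapes.set_set, Tapes.get_set_of_ne hk, Tapes.set_comm hk.symm,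
      List.reverse_reverse, List.append_nil]
    conv_rhs => rw [← Tapes.set_get s .t3, h3', Tapes.set_comm hk.symm]
    rfl
  · simp only [Tapes.get_set_self, hs, List.length_append, List.length_reverse, hlen,
      List.length_singleton]
    omega

theorem map_eq_replicate {f : ℕ → Letter} {n : ℕ} {a : Letter}
    (h : ∀ i ∈ List.range n, f i = a) : (List.range n).map f = List.replicate n a := by
  rw [List.eq_replicate_iff]
  refine ⟨by simp, fun b hb => ?_⟩
  obtain ⟨i, hi, rfl⟩ := List.mem_map.1 hb
  exact h i hi

theorem marks_endMark (R : ℕ) : marks (R + 2) (endMark (R + 2)) =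
    .inl (some false) :: (List.replicate R (.inl none) ++ [.inl (some true)]) := by
  have h : ∀ i ∈ List.range R, (.inl (endMark (R + 2) (i + 1)) : Letter) = .inl none := by
    intro i hi
    rw [List.mem_range] at hi
    simp only [endMark]
    rw [if_neg (by omega), if_neg (by omega)]
  have h0 : endMark (R + 2) 0 = some false := rfl
  have h1 : endMark (R + 2) (R + 1) = some true := by simp [endMark]
  rw [marks_succ_eq_append, marks, List.range_succ_eq_map, List.map_cons, List.map_map, h0, h1]
  rw [map_eq_replicate (f := (fun i => (.inl (endMark (R + 2) i) : Letter)) ∘ Nat.succ) h]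
  rfl

theorem marks_stepMark_zero (R : ℕ) : marks (R + 2) (stepMark 0) =
    .inl (some false) :: .inl (some true) :: List.replicate R (.inl none) := by
  have h : ∀ i ∈ List.range R, (.inl (stepMark 0 (i + 1 + 1)) : Letter) = .inl none := by
    intro i _
    simp [stepMark]
  rw [marks, List.range_succ_eq_map, List.map_cons, List.map_map, List.range_succ_eq_map,
    List.map_cons, List.map_map]
  rw [map_eq_replicate (f := ((fun i => (.inl (stepMark 0 i) : Letter)) ∘ Nat.succ) ∘ Nat.succ) h]
  rfl

theorem flatMap_ones_singleton (n : ℕ) (a : Letter) :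
    ((ones n).flatMap fun _ => [a]) = List.replicate n a := by
  induction n with
  | zero => rfl
  | succ n ih => rw [ones_succ, List.flatMap_cons, ih, List.replicate_succ]; rfl

/-- Push the letter `a` once for each letter of `k`. -/
theorem runs_each_push {k k' tmp : Tape} (h : k ≠ tmp) (hk : k' ≠ k) (ht : k' ≠ tmp)
    (v : List Letter) {s : Tapes} (hs : s.get tmp = []) :
    (each k tmp fun _ => emit k' v).Runs s
      (s.set k' (((s.get k).flatMap fun _ => v).reverse ++ s.get k'))
      ((s.get k).length * 5 + 4) := by
  refine (runs_each (τ := 1) h (s.get k)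
    (fun p => s.set k' ((p.flatMap fun _ => v).reverse ++ s.get k')) fun p a l _ => ?_).to ?_ ?_
    le_rfl
  · refine (runs_emit _ _ _).to rfl ?_ le_rfl
    rw [Tapes.get_set_of_ne ht, Tapes.get_set_of_ne hk, Tapes.get_set_self,
      Tapes.set_comm ht.symm, Tapes.set_comm hk.symm, Tapes.set_set]
    simp
  · rw [List.flatMap_nil, List.reverse_nil, List.nil_append, Tapes.set_get, Tapes.set_get, ← hs,
      Tapes.set_get]
  · rw [Tapes.set_comm hk, Tapes.set_get, Tapes.set_comm ht, ← hs, Tapes.set_get]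

/-- Write the marks of the two ends of the clock. -/
def endMarks (k : Tape) : Prog :=
  emit k [.inl (some true)] ;; each .r .t1 (fun _ => emit k [.inl none]) ;;
    pop k (fun _ => pop k fun _ => emit k [.inl (some false)])

/-- The pass over `r` pushes `R + 2` empty marks above the last one. The two surplus ones are
popped, which leaves `R` between the ends. -/
theorem runs_endMarks {k : Tape} (h1 : k ≠ .t1) (hr : k ≠ .r) {R : ℕ} {s : Tapes}
    (hs : s.r = ones (R + 2)) (ht : s.t1 = []) (hk : s.get k = []) :
    (endMarks k).Runs s (s.set k (marks (R + 2) (endMark (R + 2)))) (5 * R + 20) := by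
  have hR : (s.set k [.inl (some true)]).get .r = ones (R + 2) := by
    rw [Tapes.get_set_of_ne hr.symm]; exact hs
  refine (runs_seq ((runs_emit k _ s).to rfl (by rw [hk]; rfl) le_rfl) <|
    runs_seq ((runs_each_push (s := s.set k [.inl (some true)]) (by decide) hr h1 [.inl none] (by
      rw [Tapes.get_set_of_ne h1.symm]; exact ht)).to rfl
      (u' := s.set k (.inl none :: .inl none :: (List.replicate R (.inl none) ++
        [.inl (some true)]))) (by rw [hR, flatMap_ones_singleton, Tapes.set_set, Tapes.get_set_self, List.reverse_replicate,
        List.replicate_succ, List.replicate_succ]; rfl) le_rfl) <|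
    runs_pop_cons (a := .inl none) (Tapes.get_set_self) <|
    runs_pop_cons (a := .inl none) (Tapes.get_set_self) <| runs_emit _ _ _).to rfl ?_ ?_
  · rw [marks_endMark]
    simp
  · rw [hR, length_ones]
    omega

/-- Write the marks of the first step of the clock. -/
def stepMarks (k : Tape) : Prog :=
  each .r .t1 (fun _ => emit k [.inl none]) ;;
    pop k (fun _ => pop k fun _ => emit k [.inl (some true), .inl (some false)])

theorem runs_stepMarks {k : Tape} (h1 : k ≠ .t1) (hr : k ≠ .r) {R : ℕ} {s : Tapes}
    (hs : s.r = ones (R + 2)) (ht : s.t1 = []) (hk : s.get k = []) :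
    (stepMarks k).Runs s (s.set k (marks (R + 2) (stepMark 0))) (5 * R + 20) := by
  have hR : s.get .r = ones (R + 2) := hs
  refine (runs_seq ((runs_each_push (s := s) (by decide) hr h1 [.inl none] ht).to rfl
      (by rw [hR, flatMap_ones_singleton, hk, List.reverse_replicate, List.append_nil,
        List.replicate_succ, List.replicate_succ]) le_rfl) <|
    runs_pop_cons (a := .inl none) (Tapes.get_set_self) <|
    runs_pop_cons (a := .inl none) (Tapes.get_set_self) <| runs_emit _ _ _).to rfl ?_ ?_
  · rw [marks_stepMark_zero]
    simp
  · rw [hR, length_ones]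
    omega

/-- Write `n`, `p` and `1 / ε`. -/
def headerProg : Prog :=
  each .r .t1 (fun _ => emit .o (ones 4)) ;; emit .o [.inl none] ;;
  each .r .t1 (fun _ => emit .o (ones 2)) ;; emit .o [.inl none] ;;
  each .r .t1 (fun _ => emit .o (ones 1)) ;; emit .o [.inl none]

theorem runs_headerProg {R : ℕ} {s : Tapes} (hs : s.r = ones R) (ht : s.t1 = []) :
    headerProg.Runs s (s.write (enc [unaryEncodeNat (4 * R), unaryEncodeNat (2 * R),
      unaryEncodeNat R])) (15 * R + 15) := by
  have h : ∀ c v, (each .r .t1 fun _ => emit .o (ones c)).Runs (s.write v)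
      ((s.write v).write (ones (R * c))) (R * 5 + 4) := fun c v =>
    runs_each_emit_ones (by decide) (by decide) (by decide) c hs ht
  refine (runs_seq (h 4 []) <| runs_seq (runs_emit_o _ _) <| runs_seq ((h 2 _).to
    (by rw [Tapes.write_write, Tapes.write_write]) rfl le_rfl) <|
    runs_seq (runs_emit_o _ _) <| runs_seq ((h 1 _).to
    (by rw [Tapes.write_write, Tapes.write_write]) rfl le_rfl) <| runs_emit_o _ _).to rfl ?_
    (by omega)
  rw [Tapes.write_write, Tapes.write_write]
  congr 1
  change _ = enc ([_] ++ ([_] ++ [_]))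
  rw [enc_append, enc_append, enc_unary, enc_unary, enc_unary]
  simp [mul_comm]

/-- Write the term of the two ends. -/
def endProg : Prog :=
  termProg .ends (emit .o [.inl none] ;; each .w .t1 (fun _ => emit .o (ones 1)) ;;
    emit .o [.inl none])

theorem runs_endProg : ∃ τ : Polynomial ℕ, ∀ M (C : OneCleanQubitCircuit) σ
    (hs : C.mixed + 2 + σ ≤ 4 * 2 ^ σ) (s : Tapes),
    s.l = marks (2 ^ σ) (endMark (2 ^ σ)) → s.l2 = marks (2 ^ σ) (endMark (2 ^ σ)) →
    s.s = ones σ → s.w = ones (C.mixed + 1) → s.t1 = [] → s.t2 = [] → 2 ^ σ ≤ M →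
    C.mixed + 1 ≤ M → endProg.Runs s (s.write (enc (C.endTerm hs).words)) (τ.eval M) := by
  obtain ⟨τ, h⟩ := runs_termProg
  refine ⟨τ + Polynomial.X * 5 + 6, ?_⟩
  intro M C σ hs s hl hl2 hS hw ht1 ht2 hσ hm
  rw [C.words_endTerm hs]
  refine (h M .ends σ (C.mixed + 1) (endMark (2 ^ σ)) _ ((C.mixed + 1) * 5 + 6) s.g _ s hl hl2 hS
    hw ht1 ht2 hσ hm ?_).to rfl rfl ?_
  · intro v
    refine (runs_seq (runs_emit_o _ (s.write v)) <| runs_seq (runs_each_emit_ones (k := .w) (tmp := .t1)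
      (s := (s.write v).write [.inl none]) (by decide) (by decide) (by decide) 1 (n := C.mixed + 1) hw ht1) <|
      runs_emit_o _ _).to rfl ?_ (by omega)
    rw [Tapes.write_write, Tapes.write_write, mul_one]
    change _ = Tapes.write (s.write v) (enc ([_] ++ [_]))
    rw [enc_append, enc_unary, enc_unary]
    rfl
  · simp only [Polynomial.eval_add, Polynomial.eval_mul, Polynomial.eval_X, Polynomial.eval_ofNat]
    omega

/-- Write the instance. -/
def instanceProg : Prog :=
  headerProg ;; endMarks .l ;; endMarks .l2 ;; endProg ;; clear .l ;; clear .l2 ;;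
  stepMarks .l ;; stepMarks .l2 ;; each .r .t1 (fun _ => emit .c (ones 1)) ;;
  pop .c (fun _ => skip) ;; consume .c (fun _ => stepProg ;; shiftMarks .l ;; shiftMarks .l2) ;;
  clear .l ;; clear .l2

/-- Invariant of the main loop after `t` passes: `g` holds the gates from `t` on, `l` and `l2` hold
the marks of step `t`, and the output consists of the header, the end term and the first `t` step
terms. The counter `c` holds one letter less than `r`, as there are `2 ^ σ - 1` steps. -/
theorem runs_instanceProg : ∃ τ : Polynomial ℕ, ∀ M (C : OneCleanQubitCircuit) σ
    (hs : C.mixed + 2 + σ ≤ 4 * 2 ^ σ), 1 ≤ σ → C.gates.length ≤ 2 ^ σ - 1 → 2 ^ σ ≤ M →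
    C.mixed + 1 ≤ M → (enc (C.gates.flatMap Gate.words)).length ≤ M →
    ∀ r2, instanceProg.Runs
      { r := ones (2 ^ σ), r2 := r2, s := ones σ, w := ones (C.mixed + 1),
        g := enc (C.gates.flatMap Gate.words) }
      { r := ones (2 ^ σ), r2 := r2, s := ones σ, w := ones (C.mixed + 1),
        o := (enc (C.toInstance hs).words).reverse }
      (τ.eval M) := by
  obtain ⟨τ₁, h₁⟩ := runs_endProg
  obtain ⟨τ₂, h₂⟩ := runs_stepProg
  refine ⟨τ₁ + Polynomial.X * (τ₂ + 8 * Polynomial.X + 19) + 100 * Polynomial.X + 200, ?_⟩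
  intro M C σ hs hσ hlen hM hm hg r2
  obtain ⟨R, hR⟩ : ∃ R, 2 ^ σ = R + 2 :=
    Nat.exists_eq_add_of_le' (by simpa using Nat.pow_le_pow_right two_pos hσ)
  let f : ℕ → List Letter := fun t => enc ((C.gates.drop t).flatMap Gate.words)
  let st : List Letter → List Letter → List Letter → List Letter → List Letter → Tapes :=
    fun g l l2 c v => ⟨[], g, v.reverse, [], [], ones (2 ^ σ), r2, ones σ, ones (C.mixed + 1), l,
      l2, c, [], [], [], []⟩
  let v₀ := enc [unaryEncodeNat (4 * 2 ^ σ), unaryEncodeNat (2 * 2 ^ σ), unaryEncodeNat (2 ^ σ)]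
  let v : ℕ → List Letter := fun t => v₀ ++ enc (C.endTerm hs).words ++
    enc ((List.range t).flatMap fun t => (C.stepTerm hs t).words)
  have hv : ∀ t, v (t + 1) = v t ++ enc (C.stepTerm hs t).words := by
    intro t
    simp only [v, List.range_succ, List.flatMap_append, List.flatMap_singleton, enc_append,
      List.append_assoc]
  have hf : ∀ t, (f t).length ≤ M := by
    intro t
    refine le_trans ?_ hg
    conv_rhs => rw [← List.take_append_drop t C.gates]
    rw [List.flatMap_append, enc_append, List.length_append]
    exact Nat.le_add_left _ _
  have hloop := runs_consume (k := .c) (F := fun _ => stepProg ;; shiftMarks .l ;; shiftMarks .l2)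
    (τ := τ₂.eval M + 8 * M + 18) (ones (2 ^ σ - 1))
    (fun p c => st (f p.length) (marks (2 ^ σ) (stepMark p.length))
      (marks (2 ^ σ) (stepMark p.length)) c (v p.length)) (fun _ _ => rfl) (by
    intro p a l _
    have e : p.length + 1 = (p ++ [a]).length := by simp
    refine (runs_seq (h₂ M C σ hs p.length (st (f p.length) (marks (2 ^ σ) (stepMark p.length))
      (marks (2 ^ σ) (stepMark p.length)) l (v p.length)) rfl rfl rfl rfl rfl rfl hM hm rfl
      (hf _)) <| runs_seq (runs_shiftMarks (k := .l) (by decide) (R + 1) p.length rfl (by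
        rw [← hR]; rfl)) (runs_shiftMarks (k := .l2) (by decide) (R + 1) p.length rfl (by
        rw [← hR]; rfl))).to rfl ?_ ?_
    · simp only [← e, hv, hR, st, List.reverse_append]
      rfl
    · omega)
  rw [length_ones] at hloop
  have hM2 : ∀ μ, (marks (2 ^ σ) μ).length ≤ M := fun μ => by rw [length_marks]; exact hM
  refine (runs_seq ((runs_headerProg (s := st (f 0) [] [] [] []) rfl rfl).to rfl
      (u' := st (f 0) [] [] [] v₀) ?_ (le_refl (15 * 2 ^ σ + 15))) <|
    runs_seq ((runs_endMarks (k := .l) (R := R) (by decide) (by decide) ?_ rfl rfl).to rfl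
      (u' := st (f 0) (marks (2 ^ σ) (endMark (2 ^ σ))) [] [] v₀) ?_ le_rfl) <|
    runs_seq ((runs_endMarks (k := .l2) (R := R) (by decide) (by decide) ?_ rfl rfl).to rfl
      (u' := st (f 0) (marks (2 ^ σ) (endMark (2 ^ σ))) (marks (2 ^ σ) (endMark (2 ^ σ))) [] v₀)
      ?_ le_rfl) <|
    runs_seq ((h₁ M C σ hs _ rfl rfl rfl rfl rfl rfl hM hm).to rfl
      (u' := st (f 0) (marks (2 ^ σ) (endMark (2 ^ σ))) (marks (2 ^ σ) (endMark (2 ^ σ))) []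
      (v 0)) ?_ le_rfl) <|
    runs_seq (runs_clear .l _) <| runs_seq ((runs_clear .l2 _).to rfl
      (u' := st (f 0) [] [] [] (v 0)) rfl le_rfl) <|
    runs_seq ((runs_stepMarks (k := .l) (R := R) (by decide) (by decide) ?_ rfl rfl).to rfl
      (u' := st (f 0) (marks (2 ^ σ) (stepMark 0)) [] [] (v 0)) ?_ le_rfl) <|
    runs_seq ((runs_stepMarks (k := .l2) (R := R) (by decide) (by decide) ?_ rfl rfl).to rfl
      (u' := st (f 0) (marks (2 ^ σ) (stepMark 0)) (marks (2 ^ σ) (stepMark 0)) [] (v 0))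
      ?_ le_rfl) <|
    runs_seq ((runs_each_push (k := .r) (k' := .c) (tmp := .t1) (by decide) (by decide)
      (by decide) (ones 1) rfl).to rfl
      (u' := st (f 0) (marks (2 ^ σ) (stepMark 0)) (marks (2 ^ σ) (stepMark 0))
        (.inl (some true) :: ones (2 ^ σ - 1)) (v 0)) ?_ le_rfl) <|
    runs_seq (runs_pop_cons (k := .c) rfl (runs_skip _)) <|
    runs_seq (hloop.to rfl rfl le_rfl) <|
    runs_seq (runs_clear .l _) (runs_clear .l2 _)).to rfl ?_ ?_
  · simp [Tapes.write, st, v₀]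
  · rw [← hR]
  · rw [← hR]
    rfl
  · rw [← hR]
  · rw [← hR]
    rfl
  · simp [Tapes.write, st, v]
  · rw [← hR]
  · rw [← hR]
    rfl
  · rw [← hR]
  · rw [← hR]
    rfl
  · change Tapes.set _ .c (((ones (2 ^ σ)).flatMap _).reverse ++ []) = _
    rw [flatMap_ones, reverse_ones, List.append_nil, mul_one, ← ones_succ,
      Nat.sub_add_cancel (by omega)]
    rfl
  -- The clock has at least as many steps as there are gates, so nothing of the circuit is left on
  -- `g`.
  · have hnil : f (2 ^ σ - 1) = [] := by
      simp only [f]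
      rw [List.drop_eq_nil_of_le hlen]
      rfl
    have hfin : v (2 ^ σ - 1) = enc (C.toInstance hs).words := by
      change _ = enc ([_, _, _] ++ (C.endTerm hs :: (List.range (2 ^ σ - 1)).map
        (C.stepTerm hs)).flatMap LocalTerm.words)
      rw [List.flatMap_cons, List.flatMap_map, enc_append, enc_append, ← List.append_assoc]
      rfl
    rw [hnil, hfin]
    rfl
  · have h3 : (2 ^ σ - 1) * (τ₂.eval M + 8 * M + 18 + 1) ≤ M * (τ₂.eval M + 8 * M + 19) :=
      Nat.mul_le_mul (by omega) le_rfl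
    simp only [st, Tapes.get, Tapes.set, length_marks, length_ones, Polynomial.eval_add,
      Polynomial.eval_mul, Polynomial.eval_X, Polynomial.eval_ofNat]
    omega

end StackProg

/-! ### Binary numbers -/

/-- The number with the given binary digits, the least significant one first. -/
def bitVal : List Bool → ℕ
  | [] => 0
  | b :: l => b.toNat + 2 * bitVal l

/-- Add two numbers and a carry, with as many digits as the first one has. -/
def addBits : List Bool → List Bool → Bool → List Bool
  | [], _, _ => []
  | a :: x, y, c => (a ^^ y.headD false ^^ c) ::
      addBits x y.tail ((a && y.headD false) || (a && c) || (y.headD false && c))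

theorem length_addBits (x y : List Bool) (c : Bool) : (addBits x y c).length = x.length := by
  induction x generalizing y c with
  | nil => rfl
  | cons a x ih => simp [addBits, ih]

theorem bitVal_eq_headD (y : List Bool) :
    bitVal y = (y.headD false).toNat + 2 * bitVal y.tail := by
  cases y <;> rfl

/-- A full adder digit by digit; the carry out of the last digit is lost, hence the remainder. -/
theorem bitVal_addBits (x y : List Bool) (c : Bool) :
    bitVal (addBits x y c) = (bitVal x + bitVal y + c.toNat) % 2 ^ x.length := by
  induction x generalizing y c with
  | nil => simp [addBits, bitVal, Nat.mod_one]
  | cons a x ih =>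
    rw [addBits, bitVal, ih, bitVal, bitVal_eq_headD y, List.length_cons, pow_succ', Nat.mod_mul]
    generalize y.headD false = b
    have h : (a.toNat + 2 * bitVal x + (b.toNat + 2 * bitVal y.tail) + c.toNat) =
        (a ^^ b ^^ c).toNat + 2 * (bitVal x + bitVal y.tail +
          ((a && b) || (a && c) || (b && c)).toNat) := by
      cases a <;> cases b <;> cases c <;> simp <;> ring
    rw [h, Nat.add_mul_mod_self_left, Nat.add_mul_div_left _ _ two_pos]
    cases a <;> cases b <;> cases c <;> simp

theorem bitVal_append (l m : List Bool) : bitVal (l ++ m) = bitVal l + 2 ^ l.length * bitVal m := by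
  induction l with
  | nil => simp [bitVal]
  | cons a l ih => simp only [List.cons_append, bitVal, ih, List.length_cons]; ring

theorem bitVal_lt (l : List Bool) : bitVal l < 2 ^ l.length := by
  induction l with
  | nil => simp [bitVal]
  | cons a l ih =>
    rw [bitVal, List.length_cons, pow_succ]
    have := a.toNat_le
    omega

theorem bitVal_replicate_false (n : ℕ) : bitVal (List.replicate n false) = 0 := by
  induction n with
  | zero => rfl
  | succ n ih => rw [List.replicate_succ, bitVal, ih]; rfl

theorem bitVal_drop (l : List Bool) (k : ℕ) : bitVal (l.drop k) = bitVal l / 2 ^ k := by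
  induction k generalizing l with
  | zero => simp
  | succ k ih =>
    cases l with
    | nil => simp [bitVal]
    | cons a l =>
      rw [List.drop_succ_cons, ih, bitVal, pow_succ', ← Nat.div_div_eq_div_mul]
      congr 1
      have := a.toNat_lt
      omega

theorem bitVal_take (l : List Bool) (k : ℕ) : bitVal (l.take k) = bitVal l % 2 ^ k := by
  induction k generalizing l with
  | zero => simp [bitVal, Nat.mod_one]
  | succ k ih =>
    cases l with
    | nil => simp [bitVal]
    | cons a l =>
      rw [List.take_succ_cons, bitVal, ih, bitVal, pow_succ', Nat.mod_mul]
      have := a.toNat_lt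
      congr 1
      · omega
      · congr 2
        omega

theorem exists_eq_append_true {l : List Bool} (h : 0 < bitVal l) :
    ∃ low j, l = low ++ true :: List.replicate j false := by
  induction l using List.reverseRecOn with
  | nil => exact absurd h (lt_irrefl 0)
  | append_singleton l b ih =>
    cases b with
    | true => exact ⟨l, 0, rfl⟩
    | false =>
      rw [bitVal_append] at h
      obtain ⟨low, j, rfl⟩ := ih (by simpa [bitVal] using h)
      exact ⟨low, j + 1, by simp [List.replicate_succ']⟩

/-- The standard binary code has the least significant digit first and ends with `true`, and every
such word occurs. -/
theorem encodePosNum_exists (l : List Bool) :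
    ∃ p : PosNum, encodePosNum p = l ++ [true] ∧ (p : ℕ) = bitVal (l ++ [true]) := by
  induction l with
  | nil => exact ⟨.one, rfl, rfl⟩
  | cons b l ih =>
    obtain ⟨p, h1, h2⟩ := ih
    cases b with
    | false => exact ⟨.bit0 p, by rw [encodePosNum, h1]; rfl, by
        rw [PosNum.cast_bit0, h2, List.cons_append, bitVal]; simp [two_mul]⟩
    | true => exact ⟨.bit1 p, by rw [encodePosNum, h1]; rfl, by
        rw [PosNum.cast_bit1, h2, List.cons_append, bitVal]; simp [two_mul]; ring⟩

theorem encodeNat_bitVal (l : List Bool) : encodeNat (bitVal (l ++ [true])) = l ++ [true] := by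
  obtain ⟨p, h1, h2⟩ := encodePosNum_exists l
  rw [← h2, encodeNat, show (((p : ℕ) : Num)) = Num.pos p from ?_, encodeNum, h1]
  exact Num.of_to_nat (Num.pos p)

/-- The digits of a number in base `B`. -/
theorem sum_div_pow_mod {B : ℕ} (n : ℕ) (a : ℕ → ℕ) (ha : ∀ i, a i < B) (k : ℕ) (hk : k < n) :
    (∑ i ∈ Finset.range n, a i * B ^ i) / B ^ k % B = a k := by
  induction n generalizing a k with
  | zero => omega
  | succ n ih =>
    have hB : 0 < B := (Nat.zero_le _).trans_lt (ha 0)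
    have hsum : ∑ i ∈ Finset.range (n + 1), a i * B ^ i =
        a 0 + B * ∑ i ∈ Finset.range n, a (i + 1) * B ^ i := by
      rw [Finset.sum_range_succ', Finset.mul_sum, add_comm]
      simp only [pow_zero, mul_one, pow_succ]
      congr 1
      exact Finset.sum_congr rfl fun i _ => by ring
    rw [hsum]
    cases k with
    | zero => rw [pow_zero, Nat.div_one, Nat.add_mul_mod_self_left, Nat.mod_eq_of_lt (ha 0)]
    | succ k =>
      rw [pow_succ', ← Nat.div_div_eq_div_mul, Nat.add_mul_div_left _ _ hB,
        Nat.div_eq_of_lt (ha 0), zero_add]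
      exact ih (fun i => a (i + 1)) (fun i => ha _) k (by omega)

/-- The digits of `(1 + B) ^ (2R)` in base `B = 2 ^ (2R)` are the binomial coefficients of `2R`,
without carries because each is smaller than `B`. The middle one is wanted, and `B ^ R = 2 ^ (2 * R
* R)`. -/
theorem centralBinom_eq_digit {R : ℕ} (hR : 0 < R) :
    (1 + 2 ^ (2 * R)) ^ (2 * R) / 2 ^ (2 * R * R) % 2 ^ (2 * R) = R.centralBinom := by
  have h := sum_div_pow_mod (B := 2 ^ (2 * R)) (2 * R + 1) (fun i => (2 * R).choose i)
    (fun i => Nat.choose_lt_two_pow _ i (by omega)) R (by omega)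
  rw [Nat.centralBinom, ← h, add_comm, add_pow, pow_mul 2 (2 * R) R]
  congr 2
  exact Finset.sum_congr rfl fun i _ => by rw [one_pow, mul_one, mul_comm, Nat.cast_id]

/-- One step of the computation of a power of `1 + 2 ^ (2 * R)`. -/
def roundBits (R : ℕ) (x : List Bool) : List Bool :=
  addBits x (List.replicate (2 * R) false ++ x) false

theorem length_iterate_roundBits (R k : ℕ) (x : List Bool) :
    ((roundBits R)^[k] x).length = x.length := by
  induction k with
  | zero => rfl
  | succ k ih => rw [Function.iterate_succ_apply', roundBits, length_addBits, ih]

/-- Putting `2 * R` zeros in front multiplies by `2 ^ (2 * R)`, and adding the number itself gives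
the factor `1 + 2 ^ (2 * R)`. Truncation after each round is harmless modulo `2 ^ x.length`. -/
theorem bitVal_iterate_roundBits (R k : ℕ) (x : List Bool) :
    bitVal ((roundBits R)^[k] x) = (bitVal x * (1 + 2 ^ (2 * R)) ^ k) % 2 ^ x.length := by
  induction k with
  | zero => simp [Nat.mod_eq_of_lt (bitVal_lt x)]
  | succ k ih =>
    rw [Function.iterate_succ_apply', roundBits, bitVal_addBits, length_iterate_roundBits,
      bitVal_append, bitVal_replicate_false, List.length_replicate, ih]
    simp only [zero_add, Bool.toNat_false, add_zero]
    rw [← one_add_mul, Nat.mul_mod, Nat.mod_mod, ← Nat.mul_mod]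
    congr 1
    ring

/-- The `2 * R` binary digits from which the central binomial coefficient can be read off. -/
def centralBits (R : ℕ) : List Bool :=
  (((roundBits R)^[2 * R] (true :: List.replicate (4 * R * R - 1) false)).drop (2 * R * R)).take
    (2 * R)

/-- The wanted digit ends at bit `2 * R * R + 2 * R`, which is within the `4 * R * R` bits that are
kept, so the truncation does not affect it. -/
theorem bitVal_centralBits {R : ℕ} (hR : 0 < R) : bitVal (centralBits R) = R.centralBinom := by
  have hpos : 0 < R * R := Nat.mul_pos hR hR
  have h4 : 4 * R * R = 4 * (R * R) := by ring
  have hle : 2 * R + 2 * R * R ≤ 4 * R * R := by nlinarith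
  rw [centralBits, bitVal_take, bitVal_drop, bitVal_iterate_roundBits, ← centralBinom_eq_digit hR]
  rw [bitVal, bitVal_replicate_false, List.length_cons, List.length_replicate,
    Nat.sub_add_cancel (by omega)]
  obtain ⟨d, hd⟩ := Nat.exists_eq_add_of_le hle
  rw [hd, show 2 * R + 2 * R * R + d = 2 * R * R + (2 * R + d) by ring, pow_add 2 (2 * R * R),
    Nat.mod_mul_right_div_self, Nat.mod_mod_of_dvd _ (pow_dvd_pow 2 (by omega))]
  simp

/-- The code of a number has no leading zeros; the `j` of them in `centralBits R` are what `trim`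
has to remove. -/
theorem exists_centralBits_eq {R : ℕ} (hR : 0 < R) : ∃ low j,
    centralBits R = low ++ true :: List.replicate j false ∧
      encodeNat R.centralBinom = low ++ [true] := by
  have h := bitVal_centralBits hR
  obtain ⟨low, j, e⟩ := exists_eq_append_true (l := centralBits R) (by
    rw [h]; exact R.centralBinom_pos)
  refine ⟨low, j, e, ?_⟩
  rw [← encodeNat_bitVal, ← h, e, bitVal_append, bitVal_append]
  simp [bitVal, bitVal_replicate_false]

namespace StackProg

/-! ### A program that writes the central binomial coefficient -/

theorem runs_consume_nil {k : Tape} {F : Letter → Prog} {s : Tapes} (hk : s.get k = []) :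
    (consume k F).Runs s s 2 := loop_run_nil hk

theorem runs_consume_cons {k : Tape} {F : Letter → Prog} {s s' s'' : Tapes} {t t' : ℕ}
    {a : Letter} {l : List Letter} (hk : s.get k = a :: l) (h : (F a).Runs (s.set k l) s' t)
    (h' : (consume k F).Runs s' s'' t') : (consume k F).Runs s s'' (t + t' + 1) := by
  rw [Prog.Runs, Tapes.get_set] at h
  exact loop_run_cons hk rfl h h'

/-- The letter of a bit. -/
def bit (b : Bool) : Letter := .inl (some b)

/-- The bit that a letter stands for. -/
def letterBit (a : Option Letter) : Bool := a = some (bit true)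

@[simp] theorem letterBit_bit (b : Bool) : letterBit (some (bit b)) = b := by
  cases b <;> simp [letterBit, bit]

@[simp] theorem letterBit_none : letterBit none = false := rfl

/-- Add a bit to the next bit of `y` and the carry. -/
def adder (a : Letter) : Prog :=
  pop .y fun b => pop .c fun c =>
    emit .n [bit (letterBit (some a) ^^ letterBit b ^^ letterBit c)] ;;
    emit .c [bit ((letterBit (some a) && letterBit b) || (letterBit (some a) && letterBit c) ||
      (letterBit b && letterBit c))]

theorem runs_adder (a c : Bool) (Y : List Bool) (z : List Letter) (s : Tapes) :
    (adder (bit a)).Runs { s with y := Y.map bit, c := [bit c], n := z }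
      { s with
        y := Y.tail.map bit
        c := [bit ((a && Y.headD false) || (a && c) || (Y.headD false && c))]
        n := bit (a ^^ Y.headD false ^^ c) :: z } 4 := by
  cases Y with
  | nil =>
    refine (runs_pop_nil (k := .y) rfl (runs_pop_cons (k := .c) rfl (runs_seq (runs_emit _ _ _)
      (runs_emit _ _ _)))).to rfl ?_ le_rfl
    simp only [letterBit_bit, letterBit_none]
    rfl
  | cons b Y =>
    refine (runs_pop_cons (k := .y) rfl (runs_pop_cons (k := .c) rfl (runs_seq (runs_emit _ _ _)
      (runs_emit _ _ _)))).to rfl ?_ le_rfl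
    simp only [letterBit_bit]
    rfl

/-- The stack `c` always holds exactly one carry. Its final value is discarded later, so only its
existence is recorded. -/
theorem runs_consume_adder (X Y : List Bool) (c : Bool) (z : List Letter) (s : Tapes) :
    ∃ c', (consume .x adder).Runs { s with x := X.map bit, y := Y.map bit, c := [bit c], n := z }
      { s with
        x := []
        y := (Y.drop X.length).map bit
        c := [c']
        n := ((addBits X Y c).map bit).reverse ++ z } (X.length * 5 + 2) := by
  induction X generalizing Y c z with
  | nil => exact ⟨bit c, (runs_consume_nil rfl).to rfl rfl (by simp)⟩
  | cons a X ih =>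
    obtain ⟨c', h⟩ := ih Y.tail ((a && Y.headD false) || (a && c) || (Y.headD false && c))
      (bit (a ^^ Y.headD false ^^ c) :: z)
    refine ⟨c', (runs_consume_cons (k := .x) rfl (runs_adder a c Y z { s with x := X.map bit })
      h).to rfl ?_ ?_⟩
    · simp [addBits]
    · simp only [List.length_cons]
      omega

/-- Multiply the number in `x` by `1 + 2 ^ (2 * R)`. -/
def roundProg : Prog :=
  move .x .t3 ;; consume .t3 (fun a => emit .x [a] ;; emit .y [a]) ;;
  each .r2 .t2 (fun _ => emit .y [bit false, bit false]) ;; emit .c [bit false] ;;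
  consume .x adder ;; clear .y ;; clear .c ;; move .n .x

theorem flatMap_ones_bit (R : ℕ) : ((ones R).flatMap fun _ => [bit false, bit false]) =
    (List.replicate (2 * R) false).map bit := by
  induction R with
  | zero => rfl
  | succ R ih =>
    rw [ones_succ, List.flatMap_cons, ih, Nat.mul_succ, List.replicate_add, List.map_append]
    rw [← List.map_append, ← List.replicate_add, add_comm, List.replicate_add, List.map_append]
    rfl

/-- `y` receives a copy of `x` shifted by `2 * R` zeros. The sum has only as many digits as `x`, so
the excess of `y` and the carry are cleared; it arises reversed on `n`, and moving it to `x`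
restores the order. -/
theorem runs_roundProg {R : ℕ} (X : List Bool) {s : Tapes} (hr : s.r2 = ones R) (hy : s.y = [])
    (hc : s.c = []) (hn : s.n = []) (h2 : s.t2 = []) (h3 : s.t3 = []) (hx : s.x = X.map bit) :
    roundProg.Runs s { s with x := (roundBits R X).map bit }
      (X.length * 14 + R * 9 + 100) := by
  obtain ⟨x, g, o, out, n, r, r2, s, w, l, l2, c, t1, t2, t3, y⟩ := s
  simp only at hr hy hc hn h2 h3 hx
  subst hr hy hc hn h2 h3 hx
  let st : List Letter → List Letter → List Letter → List Letter → List Letter → Tapes :=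
    fun x y c n t3 => ⟨x, g, o, out, n, r, ones R, s, w, l, l2, c, t1, [], t3, y⟩
  have hcopy := runs_consume (k := .t3) (F := fun a => emit .x [a] ;; emit .y [a]) (τ := 2)
    (X.map bit).reverse
    (fun p l => st p.reverse p.reverse [] [] l) (fun _ _ => rfl) (by
      intro p a l _
      refine (runs_seq (runs_emit _ _ _) (runs_emit _ _ _)).to rfl ?_ le_rfl
      rw [List.reverse_append]
      rfl)
  obtain ⟨c', hadd⟩ := runs_consume_adder X (List.replicate (2 * R) false ++ X) false []
    (st [] [] [] [] [])
  refine (runs_seq ((runs_move (k := .x) (k' := .t3) (by decide) (st (X.map bit) [] [] [] [])).to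
      rfl (u' := st [] [] [] [] (X.map bit).reverse) (t' := X.length * 2 + 2) ?_ ?_) <|
    runs_seq (hcopy.to rfl (u' := st (X.map bit) (X.map bit) [] [] []) ?_ le_rfl) <|
    runs_seq ((runs_each_push (k := .r2) (k' := .y) (tmp := .t2)
      (s := st (X.map bit) (X.map bit) [] [] []) (by decide) (by decide)
      (by decide) [bit false, bit false] rfl).to rfl
      (u' := st (X.map bit) ((List.replicate (2 * R) false ++ X).map bit) [] [] [])
      (t' := R * 5 + 4) ?_ ?_) <|
    runs_seq (runs_emit .c _ _) <|
    runs_seq (hadd.to rfl rfl le_rfl) <|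
    runs_seq (runs_clear .y _) <| runs_seq (runs_clear .c _) <|
    runs_move (k := .n) (k' := .x) (by decide) _).to rfl ?_ ?_
  · change st [] [] [] [] (_ ++ []) = _
    rw [List.append_nil]
    rfl
  · change (X.map bit).length * 2 + 2 ≤ _
    rw [List.length_map]
  · rw [List.reverse_reverse]
  · change st (X.map bit) (((ones R).flatMap _).reverse ++ X.map bit) [] [] [] = _
    rw [flatMap_ones_bit, List.map_append, ← List.map_reverse, List.reverse_replicate]
  · change (ones R).length * 5 + 4 ≤ _
    rw [length_ones]
  · change st ((_ ++ []).reverse ++ []) [] [] [] [] = _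
    rw [List.append_nil, List.append_nil, List.reverse_reverse]
    rfl
  · simp only [Tapes.get, Tapes.set, List.length_reverse, List.length_map, List.length_drop,
      List.length_append, List.length_replicate, List.length_singleton, List.length_nil,
      length_addBits]
    omega

/-- Drop a letter of `x`. -/
def dropBit : Prog := pop .x fun _ => skip

theorem runs_dropBit (X : List Bool) {s : Tapes} (hx : s.x = X.map bit) :
    dropBit.Runs s { s with x := X.tail.map bit } 2 := by
  cases X with
  | nil =>
    refine (runs_pop_nil (k := .x) hx (runs_skip _)).to rfl ?_ le_rfl
    cases s
    simp only at hx
    subst hx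
    rfl
  | cons a X => exact runs_pop_cons (k := .x) hx (runs_skip _)

/-- Move a bit from `x` to `y`. -/
def takeBit : Prog := pop .x fun a => emit .y [bit (letterBit a)]

theorem runs_takeBit (X : List Bool) {k : ℕ} (hk : k < X.length) {s : Tapes}
    (hx : s.x = (X.drop k).map bit) (hy : s.y = ((X.take k).map bit).reverse) :
    takeBit.Runs s
      { s with x := (X.drop (k + 1)).map bit, y := ((X.take (k + 1)).map bit).reverse } 2 := by
  refine (runs_pop_cons (k := .x) (s := s) (a := bit X[k]) (l := (X.drop (k + 1)).map bit) ?_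
    (runs_emit _ _ _)).to rfl ?_ le_rfl
  · change s.x = _
    rw [hx, List.drop_eq_getElem_cons hk, List.map_cons]
  · change { s with x := _, y := _ ++ s.y } = _
    rw [List.take_succ_eq_append_getElem hk, letterBit_bit, hy]
    simp only [List.map_append, List.reverse_append]
    rfl

/-- Remove zeros, and then a one, from the top of `y`. -/
def trim : Prog :=
  loop (plainRegister Letter) .y id (fun a => a = bit true) fun _ => skip

theorem runs_trim (j : ℕ) (l : List Letter) (s : Tapes) :
    trim.Runs { s with y := List.replicate j (bit false) ++ bit true :: l } { s with y := l }
      (j * 2 + 2) := by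
  induction j with
  | zero =>
    have := loop_run_stop (ρ := plainRegister Letter) (k := Tape.y) (code := id)
      (last := fun a => a = bit true) (F := fun _ => skip)
      (S := Tapes.get { s with y := bit true :: l }) rfl (by simp)
    rw [← Tapes.get_set] at this
    exact this
  | succ j ih =>
    let u : Tapes := { s with y := List.replicate (j + 1) (bit false) ++ bit true :: l }
    let u' : Tapes := { s with y := List.replicate j (bit false) ++ bit true :: l }
    have h : Frag.Run (plainRegister Letter) skip (Function.update u.get .y
        (List.replicate j (bit false) ++ bit true :: l)) u'.get 1 := by
      rw [← Tapes.get_set]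
      exact skip_run _
    have ih' : Frag.Run (plainRegister Letter) (loop (plainRegister Letter) Tape.y id
        (fun a => a = bit true) fun _ => skip) u'.get (Tapes.get { s with y := l }) (j * 2 + 2) :=
      ih
    have := loop_run_cons (ρ := plainRegister Letter) (k := Tape.y) (code := id)
      (last := fun a => a = bit true) (F := fun _ => skip) rfl (by simp [bit]) h ih'
    exact this.mono (by omega)

/-- A letter of the second part of the output. -/
def second : Letter → Letter := Sum.elim .inr .inr

/-- Write the central binomial coefficient. -/
def thresholdProg : Prog :=
  each .r .t1 (fun _ => each .r2 .t2 fun _ =>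
    emit .x [bit false, bit false, bit false, bit false]) ;;
  pop .x (fun _ => emit .x [bit true]) ;;
  each .r .t1 (fun _ => roundProg ;; roundProg) ;;
  each .r .t1 (fun _ => each .r2 .t2 fun _ => dropBit ;; dropBit) ;;
  each .r .t1 (fun _ => takeBit ;; takeBit) ;;
  clear .x ;; trim ;; emit .y [bit true] ;; move .y .x ;;
  consume .x (fun a => emit .o [second a]) ;; emit .o [.inr none, .inr none]

theorem flatMap_ones_four (R : ℕ) :
    (((ones R).flatMap fun _ => [bit false, bit false, bit false, bit false])) =
      (List.replicate (4 * R) false).map bit := by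
  induction R with
  | zero => rfl
  | succ R ih =>
    rw [ones_succ, List.flatMap_cons, ih, Nat.mul_succ, add_comm, List.replicate_add,
      List.map_append]
    rfl

/-- The nested passes over `r` and `r2` count to `R * R`, and double bodies supply the factor 2.
Taking bits from `x` puts the most significant one on top of `y`, where `trim` strips zeros and the
leading one, which is pushed back. The two end markers at the end close the numerator and the empty
unary word of the exponent `0`. -/
theorem runs_thresholdProg : ∃ τ : Polynomial ℕ, ∀ R, 0 < R → ∀ o s w,
    thresholdProg.Runs { r := ones R, r2 := ones R, s := s, w := w, o := o }
      (Tapes.write { r := ones R, r2 := ones R, s := s, w := w, o := o }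
        ((encodeNat R.centralBinom).map (fun b => .inr (some b)) ++ [.inr none, .inr none]))
      (τ.eval R) := by
  refine ⟨Polynomial.X * (Polynomial.X * 5 + 4 + 4) + Polynomial.X *
    ((4 * Polynomial.X * Polynomial.X * 14 + Polynomial.X * 9 + 100) * 2 + 4) +
    Polynomial.X * (Polynomial.X * 8 + 8) + 100 * Polynomial.X * Polynomial.X +
    100 * Polynomial.X + 100, ?_⟩
  intro R hR o s w
  let st : List Letter → List Letter → Tapes := fun x y =>
    ⟨x, [], o, [], [], ones R, ones R, s, w, [], [], [], [], [], [], y⟩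
  let X₀ := true :: List.replicate (4 * R * R - 1) false
  have hRR : 0 < R * R := Nat.mul_pos hR hR
  have h4 : 4 * R * R = 4 * (R * R) := by ring
  have hX₀ : X₀.length = 4 * R * R := by
    simp only [X₀, List.length_cons, List.length_replicate]
    omega
  have hiter : ∀ k, ((roundBits R)^[k] X₀).length = 4 * R * R := fun k => by
    rw [length_iterate_roundBits, hX₀]
  let X₁ := (roundBits R)^[2 * R] X₀
  have h1 : (each .r .t1 (fun _ => each .r2 .t2 fun _ =>
      emit .x [bit false, bit false, bit false, bit false])).Runs (st [] [])
      (st ((List.replicate (4 * R * R) false).map bit) []) (R * (R * 5 + 4 + 4) + 4) := by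
    refine (runs_each (k := .r) (tmp := .t1) (by decide) (ones R) (τ := R * 5 + 4)
      (fun p => st ((List.replicate (4 * R * p.length) false).map bit) []) fun p a l _ => ?_).to
      rfl ?_ ?_
    · refine (runs_each_push (k := .r2) (k' := .x) (tmp := .t2) (by decide) (by decide)
        (by decide) _ rfl).to rfl ?_ ?_
      · change Tapes.set _ .x (((ones R).flatMap _).reverse ++ List.map bit _) = _
        rw [flatMap_ones_four, ← List.map_reverse, List.reverse_replicate, ← List.map_append,
          ← List.replicate_add, List.length_append, List.length_singleton, Nat.mul_succ, add_comm]
        rfl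
      · change (ones R).length * 5 + 4 ≤ _
        rw [length_ones]
    · rw [length_ones]
      rfl
    · rw [length_ones]
  have h2 : (pop .x (fun _ => emit .x [bit true])).Runs
      (st ((List.replicate (4 * R * R) false).map bit) []) (st (X₀.map bit) []) 2 := by
    obtain ⟨d, hd⟩ := Nat.exists_eq_add_of_le' (show 1 ≤ 4 * R * R by omega)
    refine (runs_pop_cons (k := .x) (a := bit false) (l := (List.replicate d false).map bit) ?_
      (runs_emit _ _ _)).to rfl ?_ le_rfl
    · rw [hd]
      rfl
    · simp only [X₀, hd, Nat.add_sub_cancel]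
      rfl
  have h3 : (each .r .t1 (fun _ => roundProg ;; roundProg)).Runs (st (X₀.map bit) [])
      (st (X₁.map bit) []) (R * ((4 * R * R * 14 + R * 9 + 100) * 2 + 4) + 4) := by
    refine (runs_each (k := .r) (tmp := .t1) (by decide) (ones R)
      (τ := (4 * R * R * 14 + R * 9 + 100) * 2)
      (fun p => st (((roundBits R)^[2 * p.length] X₀).map bit) []) fun p a l _ => ?_).to rfl ?_ ?_
    · refine (runs_seq (runs_roundProg (R := R) ((roundBits R)^[2 * p.length] X₀) rfl rfl rfl rfl
        rfl rfl rfl) (runs_roundProg (R := R) (roundBits R ((roundBits R)^[2 * p.length] X₀)) rfl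
        rfl rfl rfl rfl rfl rfl)).to rfl ?_ ?_
      · rw [← Function.iterate_succ_apply' (roundBits R), ← Function.iterate_succ_apply' (roundBits R),
          List.length_append,
          List.length_singleton]
        rfl
      · rw [hiter, roundBits, length_addBits, hiter]
        omega
    · rw [length_ones]
      rfl
    · rw [length_ones]
  have h4 : (each .r .t1 (fun _ => each .r2 .t2 fun _ => dropBit ;; dropBit)).Runs
      (st (X₁.map bit) []) (st ((X₁.drop (2 * R * R)).map bit) []) (R * (R * 8 + 8) + 4) := by
    refine (runs_each (k := .r) (tmp := .t1) (by decide) (ones R) (τ := R * 8 + 4)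
      (fun p => st ((X₁.drop (2 * R * p.length)).map bit) []) fun p a l _ => ?_).to rfl ?_ ?_
    · refine (runs_each (k := .r2) (tmp := .t2) (by decide) (ones R) (τ := 4)
        (fun q => (((st (((X₁.drop (2 * R * p.length)).drop (2 * q.length)).map bit) []).set .r
          l).set .t1 (a :: p.reverse))) fun q a' l' _ => ?_).to rfl ?_ ?_
      · refine (runs_seq (runs_dropBit ((X₁.drop (2 * R * p.length)).drop (2 * q.length)) rfl)
          (runs_dropBit ((X₁.drop (2 * R * p.length)).drop (2 * q.length)).tail rfl)).to rfl ?_ le_rfl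
        rw [List.tail_drop, List.tail_drop, List.length_append, List.length_singleton]
        rfl
      · rw [length_ones, List.drop_drop, List.length_append, List.length_singleton, Nat.mul_succ]
        rfl
      · rw [length_ones]
    · rw [length_ones]
      rfl
    · rw [length_ones]
  let X₂ := X₁.drop (2 * R * R)
  -- Of the `4 * R * R` bits `2 * R * R` have been dropped, and `2 * R` of the rest are still to be
  -- taken.
  have hX₂ : 2 * R ≤ X₂.length := by
    simp only [X₂, X₁, List.length_drop, hiter]
    have : R ≤ R * R := Nat.le_mul_self R
    have h2 : 2 * R * R = 2 * (R * R) := by ring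
    omega
  have h5 : (each .r .t1 (fun _ => takeBit ;; takeBit)).Runs (st (X₂.map bit) [])
      (st ((X₂.drop (2 * R)).map bit) ((X₂.take (2 * R)).map bit).reverse) (R * 8 + 4) := by
    refine (runs_each (k := .r) (tmp := .t1) (by decide) (ones R) (τ := 4)
      (fun p => st ((X₂.drop (2 * p.length)).map bit) ((X₂.take (2 * p.length)).map bit).reverse)
      fun p a l hp => ?_).to rfl ?_ ?_
    · have hpl := congrArg List.length hp
      simp only [List.length_append, List.length_cons, length_ones] at hpl
      refine (runs_seq (runs_takeBit X₂ (k := 2 * p.length) (by omega) rfl rfl)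
        (runs_takeBit X₂ (k := 2 * p.length + 1) (by omega) rfl rfl)).to rfl ?_ le_rfl
      rw [List.length_append, List.length_singleton]
      rfl
    · rw [length_ones]
      rfl
    · rw [length_ones]
  obtain ⟨low, j, hc, henc⟩ := exists_centralBits_eq hR
  have hj : low.length + 1 + j = 2 * R := by
    have := congrArg List.length hc
    rw [centralBits, List.length_take, min_eq_left hX₂] at this
    simp at this
    omega
  have hout := runs_consume (k := .x) (F := fun a => emit .o [second a]) (τ := 1)
    ((low ++ [true]).map bit) (fun p l => (st l []).write (p.map second)) (fun _ _ => rfl) (by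
      intro p a l _
      refine (runs_emit_o _ _).to rfl ?_ le_rfl
      rw [List.map_append, ← Tapes.write_write]
      rfl)
  refine (runs_seq h1 <| runs_seq h2 <| runs_seq h3 <| runs_seq h4 <| runs_seq h5 <|
    runs_seq ((runs_clear .x _).to rfl (u' := st [] (List.replicate j (bit false) ++ bit true ::
      (low.map bit).reverse)) ?_ le_rfl) <|
    runs_seq ((runs_trim j (low.map bit).reverse (st [] [])).to rfl
      (u' := st [] (low.map bit).reverse) rfl le_rfl) <|
    runs_seq (runs_emit .y _ _) <| runs_seq (runs_move (k := .y) (k' := .x) (by decide) _) <|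
    runs_seq (hout.to ?_ rfl le_rfl) <| runs_emit_o _ _).to rfl ?_ ?_
  · change st [] ((centralBits R).map bit).reverse = _
    rw [hc]
    simp
  · change _ = st (([bit true] ++ (low.map bit).reverse).reverse ++ []) []
    simp
  · rw [Tapes.write_write, henc]
    congr 2
    rw [List.map_map]
    rfl
  · simp only [st, Tapes.get, Tapes.set, List.length_reverse, List.length_map, List.length_drop,
      List.length_append, List.length_singleton,
      X₂, X₁, hiter, Polynomial.eval_add, Polynomial.eval_mul, Polynomial.eval_X,
      Polynomial.eval_ofNat]
    have e1 : (100 * R * R) = 25 * (4 * R * R) := by ring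
    omega

end StackProg

/-- A monomial in `m + 1` with a constant factor is easy to compute in unary by repeated
multiplication. Positive `a` and `d` make it an upper bound for `m` as well. -/
theorem exists_eval_le (q : Polynomial ℕ) :
    ∃ a d : ℕ, 0 < a ∧ 0 < d ∧ ∀ m, q.eval m ≤ a * (m + 1) ^ d := by
  refine ⟨(∑ i ∈ Finset.range (q.natDegree + 1), q.coeff i) + 1, q.natDegree + 1, Nat.succ_pos _,
    Nat.succ_pos _, fun m => ?_⟩
  rw [Polynomial.eval_eq_sum_range, add_mul, Finset.sum_mul]
  refine le_add_right (Finset.sum_le_sum fun i hi => Nat.mul_le_mul_left _ ?_)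
  rw [Finset.mem_range] at hi
  exact (Nat.pow_le_pow_left (Nat.le_succ m) i).trans (Nat.pow_le_pow_right (Nat.succ_pos m)
    (by omega))

/-- The number of doublings of a counter in the first `i` steps, and the number of steps that are
left until the next one. -/
def doubling : ℕ → ℕ × ℕ
  | 0 => (0, 0)
  | i + 1 => if (doubling i).2 = 0 then ((doubling i).1 + 1, 2 ^ (doubling i).1 - 1)
      else ((doubling i).1, (doubling i).2 - 1)

/-- Consequently `i + 1 ≤ 2 ^ (doubling i).1 ≤ 2 * i + 1`: counting to `i` yields a power of two
above `i` that is still linear in `i`, together with its exponent. -/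
theorem doubling_spec (i : ℕ) :
    i + 1 + (doubling i).2 = 2 ^ (doubling i).1 ∧ (doubling i).2 ≤ i := by
  induction i with
  | zero => simp [doubling]
  | succ i ih =>
    rw [doubling]
    split_ifs with h
    · rw [h] at ih
      simp only [pow_succ]
      omega
    · simp only
      omega

namespace StackProg

/-! ### A program that chooses the parameters -/

theorem flatMap_const_ones (l : List Letter) (c : ℕ) :
    (l.flatMap fun _ => ones c) = ones (l.length * c) := by
  induction l with
  | nil => simp [ones]
  | cons a l ih => rw [List.flatMap_cons, ih, ← ones_add, List.length_cons, Nat.succ_mul, add_comm]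

/-- Push onto `k'` for each letter of `k`. -/
theorem runs_each_push_ones {k k' tmp : Tape} (h : k ≠ tmp) (hk : k' ≠ k) (ht : k' ≠ tmp)
    (c : ℕ) {s : Tapes} (hs : s.get tmp = []) :
    (each k tmp fun _ => emit k' (ones c)).Runs s
      (s.set k' (ones ((s.get k).length * c) ++ s.get k')) ((s.get k).length * 5 + 4) := by
  have := runs_each_push h hk ht (ones c) hs
  rwa [flatMap_const_ones, reverse_ones] at this

/-- Multiply the number in `y` by one more than the length of the input. -/
def mulProg : Prog :=
  consume .y (fun _ => each .x .t1 (fun _ => emit .c (ones 1)) ;; emit .c (ones 1)) ;; move .c .y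

theorem runs_mulProg (p : ℕ) (x g : List Letter) :
    mulProg.Runs { x := x, g := g, y := ones p } { x := x, g := g, y := ones (p * (x.length + 1)) }
      (p * (x.length * 7 + 10) + 4) := by
  have h := runs_consume (k := .y)
    (F := fun _ => each .x .t1 (fun _ => emit .c (ones 1)) ;; emit .c (ones 1))
    (τ := x.length * 5 + 5) (ones p)
    (fun q l => { x := x, g := g, y := l, c := ones (q.length * (x.length + 1)) })
    (fun _ _ => rfl) (by
      intro q a l _
      refine (runs_seq (runs_each_push_ones (k := .x) (k' := .c) (tmp := .t1) (by decide)
        (by decide) (by decide) 1 rfl) (runs_emit _ _ _)).to rfl ?_ le_rfl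
      rw [List.length_append, List.length_singleton, reverse_ones, Nat.succ_mul,
        show q.length * (x.length + 1) + (x.length + 1) =
          1 + (x.length * 1 + q.length * (x.length + 1)) by ring, ones_add, ones_add]
      rfl)
  refine (runs_seq h (runs_move (k := .c) (k' := .y) (by decide) _)).to ?_ ?_ ?_
  · simp [ones]
  · change Tapes.mk _ _ _ _ _ _ _ _ _ _ _ _ _ _ _ ((ones _).reverse ++ []) = _
    rw [reverse_ones, List.append_nil, length_ones]
    rfl
  · simp only [Tapes.get, length_ones]
    ring_nf
    omega

/-- Raise to the power `d`. -/
def powProg : ℕ → Prog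
  | 0 => emit .y (ones 1)
  | d + 1 => powProg d ;; mulProg

theorem runs_powProg (d : ℕ) : ∃ τ : Polynomial ℕ, ∀ M (x g : List Letter), x.length ≤ M →
    (x.length + 1) ^ d ≤ M → (powProg d).Runs { x := x, g := g }
      { x := x, g := g, y := ones ((x.length + 1) ^ d) } (τ.eval M) := by
  induction d with
  | zero => exact ⟨1, fun M x g _ _ => (runs_emit _ _ _).to rfl rfl (by simp)⟩
  | succ d ih =>
    obtain ⟨τ, h⟩ := ih
    refine ⟨τ + Polynomial.X * (Polynomial.X * 7 + 10) + 4, fun M x g hx hM => ?_⟩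
    have hd : (x.length + 1) ^ d ≤ M :=
      (Nat.pow_le_pow_right (Nat.succ_pos _) (Nat.le_succ d)).trans hM
    refine (runs_seq (h M x g hx hd) (runs_mulProg _ _ _)).to rfl (by rw [pow_succ]) ?_
    have := Nat.mul_le_mul hd (show x.length * 7 + 10 ≤ M * 7 + 10 by omega)
    simp only [Polynomial.eval_add, Polynomial.eval_mul, Polynomial.eval_X, Polynomial.eval_ofNat]
    omega

/-- Double the counter in `r` if the stack `y` is empty. -/
def doubleProg : Prog :=
  pop .y fun a => match a with
    | some _ => skip
    | none => move .r .t3 ;; consume .t3 (fun _ => emit .r (ones 2) ;; emit .y (ones 1)) ;;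
        pop .y (fun _ => skip) ;; emit .s (ones 1)

/-- `y` holds the steps left until the next doubling. A doubling refills it with the old value of
`r` less one. -/
theorem runs_doubleProg (n g : List Letter) (i M : ℕ) (hM : 2 ^ (doubling i).1 ≤ M) :
    doubleProg.Runs
      { n := n, g := g, r := ones (2 ^ (doubling i).1), s := ones (doubling i).1,
        y := ones (doubling i).2 }
      { n := n, g := g, r := ones (2 ^ (doubling (i + 1)).1), s := ones (doubling (i + 1)).1,
        y := ones (doubling (i + 1)).2 } (M * 5 + 10) := by
  rw [doubling]
  rcases h : (doubling i).2 with _ | q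
  · rw [if_pos rfl]
    set σ := (doubling i).1
    have hpos : 1 ≤ 2 ^ σ := Nat.one_le_two_pow
    have h1 := runs_consume (k := .t3) (F := fun _ => emit .r (ones 2) ;; emit .y (ones 1))
      (τ := 2) (ones (2 ^ σ))
      (fun p l =>
        { n := n, g := g, r := ones (p.length * 2), s := ones σ, y := ones p.length, t3 := l })
      (fun _ _ => rfl) (by
      intro p a l _
      refine (runs_seq (runs_emit _ _ _) (runs_emit _ _ _)).to rfl ?_ le_rfl
      rw [List.length_append, List.length_singleton, reverse_ones, reverse_ones, Nat.succ_mul,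
        add_comm, add_comm p.length, ones_add, ones_add]
      rfl)
    rw [length_ones] at h1
    refine (runs_pop_nil (k := .y) rfl <| runs_seq ((runs_move (k := .r) (k' := .t3) (by decide)
      _).to rfl (u' := { n := n, g := g, s := ones σ, t3 := ones (2 ^ σ) })
      (t' := 2 ^ σ * 2 + 2) ?_ ?_) <| runs_seq (h1.to rfl rfl le_rfl) <|
      runs_seq (runs_pop_cons (k := .y) (a := .inl (some true)) (l := ones (2 ^ σ - 1)) ?_
        (runs_skip _)) (runs_emit _ _ _)).to rfl ?_ ?_
    · change Tapes.mk _ _ _ _ _ _ _ _ _ _ _ _ _ _ ((ones (2 ^ σ)).reverse ++ []) _ = _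
      rw [reverse_ones, List.append_nil]
      rfl
    · change (ones (2 ^ σ)).length * 2 + 2 ≤ _
      rw [length_ones]
    · rw [← ones_succ, Nat.sub_add_cancel hpos]
      rfl
    · simp only [pow_succ]
      rfl
    · omega
  · rw [if_neg (Nat.succ_ne_zero q)]
    refine (runs_pop_cons (k := .y)
      (s := { n := n, g := g, r := ones (2 ^ (doubling i).1), s := ones (doubling i).1,
              y := ones (q + 1) })
      (a := .inl (some true)) (l := ones q) (ones_succ q) (runs_skip _)).to rfl rfl (by omega)

/-- Choose the size of the clock and read the number of qubits. -/
def setupProg (a d : ℕ) : Prog :=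
  powProg d ;; consume .y (fun _ => emit .n (ones a)) ;; each .g .t1 (fun _ => emit .n (ones 1)) ;;
  clear .x ;; emit .r (ones 1) ;; consume .n (fun _ => doubleProg) ;; clear .y ;;
  each .r .t1 (fun _ => emit .r2 (ones 1)) ;; readWord .g (fun _ => emit .w (ones 1)) ;;
  emit .w (ones 1)

/-- `N` is assembled in unary from the bound on `q` and the length of the circuit's encoding, which
in turn bounds the numbers of qubits and gates. Counting through it with `doubleProg` leaves a
suitable clock size in `r` and its number of qubits in `s`; the first word of the circuit then gives
`w`. -/
theorem runs_setupProg {a d : ℕ} (ha : 0 < a) (hd : 0 < d) : ∃ τ : Polynomial ℕ,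
    ∀ (x : List Letter) (C : OneCleanQubitCircuit) N,
      N = (x.length + 1) ^ d * a + (enc C.words).length →
      (setupProg a d).Runs { x := x, g := enc C.words }
        { r := ones (2 ^ (doubling N).1), r2 := ones (2 ^ (doubling N).1),
          s := ones (doubling N).1, w := ones (C.mixed + 1),
          g := enc (C.gates.flatMap Gate.words) } (τ.eval N) := by
  obtain ⟨τ, hτ⟩ := runs_powProg d
  refine ⟨τ + Polynomial.X * ((Polynomial.X * 2 + 1) * 5 + 11) + Polynomial.X * 100 + 100, ?_⟩
  intro x C N hN
  have hp : (x.length + 1) ^ d ≤ (x.length + 1) ^ d * a := Nat.le_mul_of_pos_right _ ha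
  have hx : x.length ≤ N := by
    have : (x.length + 1) ^ 1 ≤ (x.length + 1) ^ d := Nat.pow_le_pow_right (Nat.succ_pos _) hd
    rw [pow_one] at this
    omega
  have hM : ∀ i ≤ N, 2 ^ (doubling i).1 ≤ N * 2 + 1 := fun i hi => by
    have := doubling_spec i
    omega
  have hq := (doubling_spec N).2
  have hG : enc C.words = ones C.mixed ++ .inl none :: enc (C.gates.flatMap Gate.words) := by
    change enc ([_] ++ C.gates.flatMap Gate.words) = _
    rw [enc_append, enc_unary, List.append_assoc]
    rfl
  have hGl := congrArg List.length hG
  simp only [List.length_append, length_ones, List.length_cons] at hGl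
  have h1 := runs_consume (k := .y) (F := fun _ => emit .n (ones a)) (τ := 1)
    (ones ((x.length + 1) ^ d))
    (fun p l => { x := x, g := enc C.words, n := ones (p.length * a), y := l }) (fun _ _ => rfl) (by
      intro p b l _
      refine (runs_emit _ _ _).to rfl ?_ le_rfl
      rw [List.length_append, List.length_singleton, reverse_ones, Nat.succ_mul, add_comm, ones_add]
      rfl)
  have h2 := runs_consume (k := .n) (F := fun _ => doubleProg) (τ := (N * 2 + 1) * 5 + 10)
    (ones N)
    (fun p l =>
      { n := l, g := enc C.words, r := ones (2 ^ (doubling p.length).1),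
        s := ones (doubling p.length).1, y := ones (doubling p.length).2 }) (fun _ _ => rfl) (by
      intro p b l hp
      have := congrArg List.length hp
      simp only [List.length_append, List.length_cons, length_ones] at this
      refine (runs_doubleProg l (enc C.words) p.length (N * 2 + 1) (hM _ (by omega))).to rfl ?_
        le_rfl
      rw [List.length_append, List.length_singleton])
  have h3 := runs_readWord (k := .g) (F := fun _ => emit .w (ones 1)) (τ := 1) (ones C.mixed)
    (enc (C.gates.flatMap Gate.words)) (by
      intro b hb
      rw [List.eq_of_mem_replicate hb]
      simp)
    (fun p l =>
      { g := l, r := ones (2 ^ (doubling N).1), r2 := ones (2 ^ (doubling N).1),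
        s := ones (doubling N).1, w := ones p.length }) (fun _ _ => rfl) (by
      intro p b l _
      refine (runs_emit _ _ _).to rfl ?_ le_rfl
      have e : ones (p.length + 1) = ones 1 ++ ones p.length := by rw [add_comm, ones_add]
      rw [List.length_append, List.length_singleton, reverse_ones, e]
      rfl)
  simp only [length_ones] at h1 h2 h3
  refine (runs_seq (hτ N x (enc C.words) hx (by omega)) <| runs_seq (h1.to ?_ rfl le_rfl) <|
    runs_seq (runs_each_push_ones (k := .g) (k' := .n) (tmp := .t1) (by decide) (by decide)
      (by decide) 1 rfl) <| runs_seq (runs_clear .x _) <| runs_seq (runs_emit .r _ _) <|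
    runs_seq (h2.to ?_ rfl le_rfl) <| runs_seq (runs_clear .y _) <|
    runs_seq ((runs_each_push_ones (k := .r) (k' := .r2) (tmp := .t1) (by decide) (by decide)
      (by decide) 1 rfl).to rfl rfl le_rfl) <| runs_seq (h3.to ?_ rfl le_rfl) <|
      runs_emit _ _ _).to rfl ?_ ?_
  · simp [ones]
  · change _ = Tapes.mk _ _ _ _ (ones _ ++ ones _) _ _ _ _ _ _ _ _ _ _ _
    rw [← ones_add, mul_one, show (Tapes.get _ Tape.g).length + _ = N from by
      rw [hN, add_comm]; rfl]
    rfl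
  · rw [← hG]
    change _ = Tapes.mk _ _ _ _ _ _ (ones ((ones (2 ^ (doubling N).1)).length * 1) ++ []) _ _ _ _
      _ _ _ _ _
    rw [length_ones, mul_one, List.append_nil]
    rfl
  · rw [reverse_ones]
    change Tapes.mk _ _ _ _ _ _ _ _ (ones 1 ++ ones C.mixed) _ _ _ _ _ _ _ = _
    have e : ones 1 ++ ones C.mixed = ones (C.mixed + 1) := by rw [← ones_add, add_comm]
    rw [e]
    rfl
  · have h5 : N * ((N * 2 + 1) * 5 + 10 + 1) = N * ((N * 2 + 1) * 5 + 11) := rfl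
    have h4 := hM N le_rfl
    simp only [Tapes.get, Tapes.set, length_ones, Polynomial.eval_add, Polynomial.eval_mul,
      Polynomial.eval_X, Polynomial.eval_ofNat, Polynomial.eval_one]
    omega

/-! ### The reduction -/

/-- Needed for the last transfer of the output, whose cost is the length of what has been written;
this length is bounded by the time spent on writing it. -/
theorem exists_length_le (F : Prog) : ∃ c : ℕ, ∀ s s' t, F.Runs s s' t →
    ∀ k, (s'.get k).length ≤ (s.get k).length + c * t := by
  obtain ⟨c, hc⟩ := exists_length_stepsTo_le F.m
  refine ⟨c, fun s s' t h k => ?_⟩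
  obtain ⟨v', _, n, hn, h⟩ := h none trivial
  exact (hc _ _ _ h k).trans (Nat.add_le_add_left (Nat.mul_le_mul_left c hn) _)

theorem length_gates_le (C : OneCleanQubitCircuit) :
    C.gates.length ≤ (enc (C.gates.flatMap Gate.words)).length := by
  induction C.gates with
  | nil => exact Nat.zero_le _
  | cons g l ih =>
    rw [List.flatMap_cons, enc_append, List.length_append, List.length_cons, Gate.words, enc_cons]
    simp only [List.length_append, List.length_cons]
    omega

theorem length_enc_words (C : OneCleanQubitCircuit) : (enc C.words).length =
      C.mixed + 1 + (enc (C.gates.flatMap Gate.words)).length := by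
  change (enc ([_] ++ C.gates.flatMap Gate.words)).length = _
  rw [enc_append, enc_unary]
  simp only [List.length_append, length_ones, List.length_singleton]

/-- Compute the instance and the threshold. -/
def reductionProg (a d : ℕ) : Prog :=
  (setupProg a d ;; instanceProg ;; thresholdProg) ;; clear .r ;; clear .r2 ;; clear .s ;;
    clear .w ;; move .o .out

theorem runs_reductionProg {a d : ℕ} (ha : 0 < a) (hd : 0 < d) : ∃ τ : Polynomial ℕ,
    ∀ (x : List Letter) (C : OneCleanQubitCircuit) N,
      N = (x.length + 1) ^ d * a + (enc C.words).length →
      ∀ hs : C.mixed + 2 + (doubling N).1 ≤ 4 * 2 ^ (doubling N).1, 1 ≤ (doubling N).1 →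
      C.gates.length ≤ 2 ^ (doubling N).1 - 1 →
      (reductionProg a d).Runs { x := x, g := enc C.words }
        { out := enc (C.toInstance hs).words ++
          ((encodeNat (2 ^ (doubling N).1).centralBinom).map (fun b => .inr (some b)) ++
            [.inr none, .inr none]) } (τ.eval N) := by
  obtain ⟨τ₁, h₁⟩ := runs_setupProg ha hd
  obtain ⟨τ₂, h₂⟩ := runs_instanceProg
  obtain ⟨τ₃, h₃⟩ := runs_thresholdProg
  obtain ⟨c, hc⟩ := exists_length_le (setupProg a d ;; instanceProg ;; thresholdProg)
  let M : Polynomial ℕ := Polynomial.X * 2 + 1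
  let T : Polynomial ℕ := τ₁ + τ₂.comp M + τ₃.comp M
  refine ⟨T + Polynomial.C c * T * 2 + 20 * M + 100, ?_⟩
  intro x C N hN hs h1 hT
  have hq := doubling_spec N
  set σ := (doubling N).1
  have hG := length_enc_words C
  have hσ : σ < 2 ^ σ := Nat.lt_two_pow_self
  have hM : M.eval N = N * 2 + 1 := by simp [M]
  have hR : τ₃.eval (2 ^ σ) ≤ τ₃.eval (M.eval N) := eval_mono τ₃ (by omega)
  set v : List Letter := (encodeNat (2 ^ σ).centralBinom).map (fun b => .inr (some b)) ++
    [.inr none, .inr none] with hv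
  have hF : Prog.Runs (setupProg a d ;; instanceProg ;; thresholdProg) { x := x, g := enc C.words }
      { r := ones (2 ^ σ), r2 := ones (2 ^ σ), s := ones σ, w := ones (C.mixed + 1),
        o := (enc (C.toInstance hs).words ++ v).reverse } (T.eval N) := by
    refine (runs_seq (h₁ x C N hN) <| runs_seq (h₂ (M.eval N) C σ hs h1 hT (by omega) (by omega)
      (by omega) _) (h₃ _ (by omega) _ _ _)).to rfl ?_ ?_
    · rw [List.reverse_append]
      rfl
    · simp only [T, Polynomial.eval_add, Polynomial.eval_comp]
      omega
  have ho := hc _ _ _ hF .o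
  change (List.reverse _).length ≤ 0 + c * T.eval N at ho
  refine (runs_seq hF <| runs_seq (runs_clear .r _) <| runs_seq (runs_clear .r2 _) <|
    runs_seq (runs_clear .s _) <| runs_seq (runs_clear .w _) <|
    runs_move (k := .o) (k' := .out) (by decide) _).to rfl ?_ ?_
  · change Tapes.mk _ _ _ (List.reverse (List.reverse _) ++ []) _ _ _ _ _ _ _ _ _ _ _ _ = _
    rw [List.reverse_reverse, List.append_nil]
    rfl
  · simp only [Tapes.get, Tapes.set, length_ones, Polynomial.eval_add, Polynomial.eval_mul,
      Polynomial.eval_C, Polynomial.eval_ofNat, hM]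
    omega

end StackProg

/-! ### The reduction and its correctness -/

open StackProg OneCleanQubitCircuit

theorem inputTapes_get (x g : List Letter) :
    ({ x := x, g := g } : Tapes).get =
      Function.update (Function.update (fun _ => []) Tape.x x) Tape.g g := by
  funext k
  cases k <;> rfl

theorem outputTapes_get (l : List Letter) :
    ({ out := l } : Tapes).get = Function.update (fun _ => []) Tape.out l := by
  funext k
  cases k <;> rfl

theorem theorem2 : ∃ c : ℕ, (schattenEstimation c).IsDQC1Hard := by
  refine ⟨1, fun L ⟨C, q, hC, hq, hyes, hno⟩ => ?_⟩
  obtain ⟨a, d, ha, hd, had⟩ := exists_eval_le q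
  obtain ⟨τ, hτ⟩ := runs_reductionProg ha hd
  let N : List Bool → ℕ := fun x => (x.length + 1) ^ d * a + (enc (C x).words).length
  let σ : List Bool → ℕ := fun x => (doubling (N x)).1
  have hl := fun x => length_enc_words (C x)
  have hg := fun x => length_gates_le (C x)
  have hN : ∀ x, N x = (x.length + 1) ^ d * a + (enc (C x).words).length := fun x => rfl
  -- Everything required of the clock follows from this: `N x` dominates the number of mixed qubits,
  -- the number of gates and `q.eval x.length`.
  have hR : ∀ x, N x + 1 ≤ 2 ^ σ x := fun x => by
    rw [← (doubling_spec (N x)).1]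
    exact Nat.le_add_right _ _
  have h1 : ∀ x, 1 ≤ σ x := fun x => by
    by_contra! h
    have h2 := hR x
    have := hl x
    have := hN x
    rw [Nat.lt_one_iff.1 h] at h2
    omega
  have hs : ∀ x, (C x).mixed + 2 + σ x ≤ 4 * 2 ^ σ x := fun x => by
    have : σ x < 2 ^ σ x := Nat.lt_two_pow_self
    have := hl x
    have := hR x
    have := hN x
    omega
  have hT : ∀ x, (C x).gates.length ≤ 2 ^ σ x - 1 := fun x => by
    have := hl x
    have := hg x
    have := hR x
    have := hN x
    omega
  have hqs : ∀ x, q.eval x.length ≤ 2 ^ σ x := fun x => by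
    have := had x.length
    rw [mul_comm] at this
    have := hR x
    have := hN x
    omega
  -- The threshold is an integer, so the exponent of its dyadic form is `0`.
  refine ⟨fun x => ((C x).toInstance (hs x), ((2 ^ σ x).centralBinom, 0)), ?_, ?_, ?_⟩
  · refine polyTimeGenerated_postprocess hC _ (fun b => (.inl (some b) : Letter))
      (fun a b h => by simpa using h) Sum.inl (jx := Tape.x) (jg := .g) (jt := .t1) (jo := .out)
      (by decide) (by decide) (by decide) (reductionProg a d)
      (τ.comp ((Polynomial.X + 1) ^ d * Polynomial.C a + Polynomial.X)) fun x => ?_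
    have h := hτ (x.map fun b => .inl (some b)) (C x) (N x) (by rw [List.length_map]) (hs x) (h1 x)
      (hT x)
    rw [Prog.Runs, inputTapes_get, outputTapes_get] at h
    -- The exponent `0` is the empty word in unary and adds nothing but its end marker, so the code
    -- closes with two markers.
    have hout : (encodingProd (schattenEstimation 1).encoding dyadicEncoding).encode
        ((C x).toInstance (hs x), ((2 ^ σ x).centralBinom, 0)) =
        enc ((C x).toInstance (hs x)).words ++
          ((encodeNat (2 ^ σ x).centralBinom).map (fun b => .inr (some b)) ++
            [.inr none, .inr none]) := by
      change List.map _ (joinWords _) ++ List.map _ (joinWords _) = _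
      simp [enc, joinWords, unaryEncodeNat]
    rw [hout]
    refine h.mono ?_
    rw [Polynomial.eval_comp]
    refine eval_mono τ ?_
    simp only [Polynomial.eval_add, Polynomial.eval_mul, Polynomial.eval_pow, Polynomial.eval_C,
      Polynomial.eval_X, Polynomial.eval_one]
    have : (enc (C x).words).length = (circuitEncoding.encode (C x)).length := List.length_map _
    -- The time bound has to be a polynomial in the sum of the two lengths. Both parts of `N x` are
    -- monotone, so they may be evaluated at that sum.
    have h2 : (x.length + 1) ^ d * a ≤
      (x.length + (circuitEncoding.encode (C x)).length + 1) ^ d * a := by gcongr; omega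
    have := hN x
    omega
  · intro x hx
    refine ⟨(C x).isLogLocal_toInstance (hs x) (h1 x), fun y hy => ?_⟩
    have := (C x).lt_of_isEstimate (hs x) (h1 x) (hT x) (hq _) (hqs x) (hyes x hx) hy
    simpa using this
  · intro x hx
    refine ⟨(C x).isLogLocal_toInstance (hs x) (h1 x), fun y hy => ?_⟩
    have := (C x).isEstimate_lt (hs x) (h1 x) (hT x) (hq _) (hqs x) (hno x hx) hy
    simpa using this

end
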